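/- **Setting.** Let $\mathcal S$ be a measurable state space and $\mathcal A$ a finite action space. The nominal environment $\mathbb P_0$ is a law of $(S,(R(a))_{a\in\mathcal A})\in\mathcal S\times[0,1]^{\mathcal A}$. A policy is a Markov kernel $\pi(a\mid s)$, and $R(\pi(S))$ denotes $R(A)$ with $A\sim\pi(S)$ drawn given $S$, conditionally independently of the potential rewards. The data $(s_i,a_i,r_i)_{i\le N}$, $N\ge1$, are i.i.d. copies of $(S,A,R(A))$ with $A\sim\pi_0(S)$ drawn in this way (unconfoundedness) from a behavior policy $\pi_0$ with strong overlap $\eta:=\inf_{s,a}\pi_0(a\mid s)>0$. For some $\omega>0$, either (continuous case) all conditional laws of $R(a)$ given $S=s$ have a density that is at least $\omega$ on $[0,1]$, or (discrete case) they are all supported on a common countable set $\mathbb D\subseteq[0,1]$ with $0\in\mathbb D$, and have point masses at least $\omega$ on $\mathbb D$. For $\delta>0$ let $\mathcal V_\delta(\pi)=\inf\mathbb E_{\mathbb P_1}[R(\pi(S))]$ over all laws $\mathbb P_1\ll\mathbb P_0$ with $D_{KL}(\mathbb P_1\|\mathbb P_0)\le\delta$, where the nominal law is that of the state, the potential rewards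 and the action drawn by $\pi$. Let $\Pi$ be a (pointwise measurable) class of policies, and let the robust regret of $\pi$ be $\sup_{\pi'\in\Pi}\mathcal V_\delta(\pi')-\mathcal V_\delta(\pi)$. Put $W(\pi,\alpha)=\mathbb E[e^{-R(\pi(S))/\alpha}]$, $\phi(\pi,\alpha)=-\alpha\log W(\pi,\alpha)-\alpha\delta$, $\overline\alpha=1/\delta$, and let $\alpha^\star(\pi)$ be the maximizer of $\phi(\pi,\cdot)$ over $\alpha>0$. Assume $\underline\alpha:=\inf_{\pi\in\Pi}\alpha^\star(\pi)>0$. Put $\underline W=\omega\min(\underline\alpha,1)/2$ in the continuous case and $\underline W=\omega$ in the discrete case. Let $d_H(\pi,\pi')=\frac1n\sum_{i\le n}\mathbf 1\{\pi(s_i)\ne\pi'(s_i)\}$ be the Hamming distance on a finite sample of states, $\mathcal N(\epsilon,\Pi)$ the largest $\epsilon$-covering number of $\Pi$ in $d_H$ over all samples of all sizes $n\ge1$, and $\kappa(\Pi)=\int_0^1\log^{1/2}\mathcal N(t^2,\Pi)\,dt$. **Cross-fitting.** The index set $\{1,\dots,N\}$ is split into $K$ folds $\mathcal I_1,\dots,\mathcal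 I_K$ whose sizes differ by at most one. For each $k$, estimators $\hat\pi_0^{(k)}(a\mid s)\in[\eta,1]$ of $\pi_0$ and $\hat f_0^{(k)}(s,a;\alpha)\in(0,1]$, $\alpha\in[\underline\alpha,\overline\alpha]$, of $f_0(s,a;\alpha)=\mathbb E[e^{-R/\alpha}\mid S=s,A=a]$ are trained on the data outside $\mathcal I_k$ (possibly with independent randomization), and $\alpha\mapsto\hat f_0^{(k)}(s,a;\alpha)$ is Lipschitz with constant $1/\underline\alpha^2$ on $[\underline\alpha,\overline\alpha]$ (as it is for every estimator $\sum_i\hat\omega_i(s,a)e^{-r_i/\alpha}$ with convex weights). Let $$\hat W^{DR}(\pi,\alpha)=\frac1N\sum_{k=1}^K\sum_{i\in\mathcal I_k}\Big[\frac{\pi(a_i\mid s_i)}{\hat\pi_0^{(k)}(a_i\mid s_i)}\big(e^{-r_i/\alpha}-\hat f_0^{(k)}(s_i,a_i;\alpha)\big)+\sum_{a\in\mathcal A}\pi(a\mid s_i)\hat f_0^{(k)}(s_i,a;\alpha)\Big],$$ $$\hat{\mathcal V}^{DR}_\delta(\pi)=\max_{\alpha\in[\underline\alpha,\overline\alpha]}\big(-\alpha\log\hat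 W^{DR}(\pi,\alpha)-\alpha\delta\big),\qquad \hat\pi^{DR}\in\arg\max_{\pi\in\Pi}\hat{\mathcal V}^{DR}_\delta(\pi).$$ Let $\beta\in(0,1/6)$, and let $\mathrm{Rate}_{\pi_0}=\mathrm{Rate}_{\pi_0}(N,\beta/K)\ge0$ and $\mathrm{Rate}_f^{\mathfrak c}=\mathrm{Rate}_f^{\mathfrak c}(N,\beta/K)\ge0$ be deterministic numbers such that, for each $k$, each of the following holds with probability at least $1-\beta/K$: $\|\hat\pi_0^{(k)}(A\mid S)-\pi_0(A\mid S)\|_{L_2}\le\mathrm{Rate}_{\pi_0}$, respectively $\big\|\sup_{\alpha\in[\underline\alpha,\overline\alpha]}|\hat f_0^{(k)}(S,A;\alpha)-f_0(S,A;\alpha)|\big\|_{L_2}\le\mathrm{Rate}_f^{\mathfrak c}$, the $L_2$ norms being those of the law of a fresh observation. Suppose that $N$ is sufficiently large: $\kappa(\Pi)<\infty$ and, with $L=1/\underline\alpha^2$, $$\frac{\underline W}{2}\ge\frac{288}{\eta\sqrt N}\big(\kappa(\Pi)+\max(L\overline\alpha,1)\big)+\frac{4}{\eta\sqrt N}\log^{1/2}(1/\beta),$$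 $$\frac{\underline W}{4}\ge\frac{384\sqrt K}{\eta\sqrt N}\big(\kappa(\Pi)+\max(L\overline\alpha,1)\big)+\frac{8\sqrt K}{\eta\sqrt N}\log^{1/2}(K/\beta)+\frac{\mathrm{Rate}_{\pi_0}\cdot\mathrm{Rate}_f^{\mathfrak c}}{\eta^2}.$$ **Theorem.** With probability at least $1-6\beta$, the robust regret of every such $\hat\pi^{DR}$ is at most $$\frac{2112\,\overline\alpha\sqrt K}{\underline W\,\eta\sqrt N}\Big(\kappa(\Pi)+\frac{\overline\alpha}{\underline\alpha^2}+\log^{1/2}(K/\beta)\Big)+\frac{4\overline\alpha}{\underline W\eta^2}\,\mathrm{Rate}_{\pi_0}(N,\beta/K)\cdot\mathrm{Rate}_f^{\mathfrak c}(N,\beta/K).$$ -/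

import Mathlib

open MeasureTheory ProbabilityTheory Filter Topology
open scoped ENNReal NNReal

noncomputable section

namespace KLDRO

/-- A (stochastic) policy: a Markov kernel from states to actions. -/
def Policy (S A : Type*) [MeasurableSpace S] [MeasurableSpace A] : Type _ :=
  {κ : Kernel S A // IsMarkovKernel κ}

/-- `π(a ∣ s)`. -/
def Policy.prob {S A : Type*} [MeasurableSpace S] [MeasurableSpace A]
    (p : Policy S A) (s : S) (a : A) : ℝ :=
  (p.1 s).real {a}

/-- An environment: a law of the state and of the potential rewards `(S, (R(a))_a)`. -/
abbrev Env (S A : Type*) [MeasurableSpace S] [MeasurableSpace A] : Type _ :=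
  Measure (S × (A → ℝ))

/-- One logged observation `(s, a, r)`. -/
abbrev Obs (S A : Type*) : Type _ := S × A × ℝ

section Population

variable {S A : Type*} [MeasurableSpace S] [MeasurableSpace A]

/-- The law of `((S, (R(a))_a), A)` when `A ∼ p(S)` is drawn given `S` only, that is,
conditionally independently of the potential rewards (unconfoundedness). -/
def jointLaw (P₀ : Env S A) (p : Policy S A) : Measure ((S × (A → ℝ)) × A) :=
  P₀ ⊗ₘ (p.1.prodMkRight (A → ℝ))

/-- The reward of the chosen action, `R(A)`. -/
def chosenReward (x : (S × (A → ℝ)) × A) : ℝ := x.1.2 x.2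

/-- The law of an observation `(S, A, R(A))` when actions are drawn from the behavior policy. -/
def obsLaw (P₀ : Env S A) (π₀ : Policy S A) : Measure (Obs S A) :=
  (jointLaw P₀ π₀).map (fun x => (x.1.1, x.2, chosenReward x))

instance (P₀ : Env S A) [IsFiniteMeasure P₀] (p : Policy S A) :
    IsFiniteMeasure (jointLaw P₀ p) := by
  have := p.2
  unfold jointLaw
  infer_instance

instance (P₀ : Env S A) [IsFiniteMeasure P₀] (p : Policy S A) :
    IsFiniteMeasure (obsLaw P₀ p) := by
  unfold obsLaw
  infer_instance

/-- The strong-overlap constant `η = inf_{s,a} π₀(a ∣ s)`. -/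
def overlap (π₀ : Policy S A) : ℝ := ⨅ x : S × A, π₀.prob x.1 x.2

/-- The conditional law of `R(a)` given `S = s`. -/
def rewardLaw (P₀ : Env S A) [IsFiniteMeasure P₀] (a : A) (s : S) : Measure ℝ :=
  condDistrib (fun x : S × (A → ℝ) => x.2 a) (fun x => x.1) P₀ s

/-- The two kinds of conditional reward distributions that are considered. -/
inductive RewardKind
  | continuous
  | discrete

/-- The conditional reward laws are bounded below by `ω`: either every `R(a) ∣ S = s` has a
Lebesgue density that is at least `ω` on `[0, 1]`, or every `R(a) ∣ S = s` is supported on a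
common countable set `D ⊆ [0, 1]` containing `0`, with point masses at least `ω` on `D`. -/
def RewardLowerBound (P₀ : Env S A) [IsFiniteMeasure P₀] (ω : ℝ) : RewardKind → Prop
  | .continuous => ∀ᵐ s ∂P₀.fst, ∀ a, rewardLaw P₀ a s ≪ volume ∧
      ∀ᵐ r ∂(volume.restrict (Set.Icc (0 : ℝ) 1)),
        ENNReal.ofReal ω ≤ (rewardLaw P₀ a s).rnDeriv volume r
  | .discrete => ∃ D : Set ℝ, D.Countable ∧ D ⊆ Set.Icc 0 1 ∧ (0 : ℝ) ∈ D ∧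
      ∀ᵐ s ∂P₀.fst, ∀ a, rewardLaw P₀ a s D = 1 ∧
        ∀ r ∈ D, ENNReal.ofReal ω ≤ rewardLaw P₀ a s {r}

/-- The lower bound `W̲` for the moment generating function. -/
def Wlow (ω αlow : ℝ) : RewardKind → ℝ
  | .continuous => ω * (min αlow 1 / 2)
  | .discrete => ω

/-- The distributionally robust value `V_δ(p)`: the worst-case expected reward of the policy over
all laws `P₁ ≪ P₀` within Kullback–Leibler radius `δ`, where the nominal law is that of the state,
the potential rewards and the action drawn by `p`. -/
def robustValue (P₀ : Env S A) (δ : ℝ) (p : Policy S A) : ℝ :=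
  sInf {v : ℝ | ∃ P₁ : Measure ((S × (A → ℝ)) × A), IsProbabilityMeasure P₁ ∧
    P₁ ≪ jointLaw P₀ p ∧ InformationTheory.klDiv P₁ (jointLaw P₀ p) ≤ ENNReal.ofReal δ ∧
    v = ∫ x, chosenReward x ∂P₁}

/-- The distributionally robust regret of `p` in the class `Pol`; the benchmark is the largest
robust value over the class. -/
def robustRegret (P₀ : Env S A) (δ : ℝ) (Pol : Set (Policy S A)) (p : Policy S A) : ℝ :=
  sSup (robustValue P₀ δ '' Pol) - robustValue P₀ δ p

/-- `W(p, α) = E[exp(-R(p(S))/α)]`. -/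
def W (P₀ : Env S A) (p : Policy S A) (α : ℝ) : ℝ :=
  ∫ x, Real.exp (-(chosenReward x) / α) ∂(jointLaw P₀ p)

/-- The dual objective `φ(p, α) = -α log W(p, α) - α δ`. -/
def dualObj (P₀ : Env S A) (δ : ℝ) (p : Policy S A) (α : ℝ) : ℝ :=
  -α * Real.log (W P₀ p α) - α * δ

/-- `α⋆(p)`, the maximizer of `φ(p, ·)` over `(0, ∞)`; it is `0` if there is none. -/
def alphaStar (P₀ : Env S A) (δ : ℝ) (p : Policy S A) : ℝ :=
  sSup {α : ℝ | 0 < α ∧ ∀ α' : ℝ, 0 < α' → dualObj P₀ δ p α' ≤ dualObj P₀ δ p α}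

/-- `α̲ = inf_{p ∈ Pol} α⋆(p)`. -/
def alphaLow (P₀ : Env S A) (δ : ℝ) (Pol : Set (Policy S A)) : ℝ :=
  sInf (alphaStar P₀ δ '' Pol)

/-- `ᾱ = 1/δ`. -/
def alphaUp (δ : ℝ) : ℝ := 1 / δ

/-- The regression function `f₀(s, a; α) = E[exp(-R/α) ∣ S = s, A = a]`. -/
def f₀ (P₀ : Env S A) [IsFiniteMeasure P₀] (π₀ : Policy S A) (s : S) (a : A) (α : ℝ) : ℝ :=
  ∫ r, Real.exp (-r / α)
    ∂(condDistrib (fun z : Obs S A => z.2.2) (fun z => (z.1, z.2.1)) (obsLaw P₀ π₀) (s, a))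

end Population

section Complexity

variable {S A : Type*} [MeasurableSpace S] [MeasurableSpace A]

open Classical in
/-- The Hamming distance of two policies on the states `s₁, …, sₙ`. -/
def hammingDistance {n : ℕ} (s : Fin n → S) (p q : Policy S A) : ℝ :=
  ((Finset.univ.filter (fun i => p.1 (s i) ≠ q.1 (s i))).card : ℝ) / n

/-- The Hamming covering number of `Pol` on the states `s₁, …, sₙ`. -/
def coveringNumber {n : ℕ} (s : Fin n → S) (ε : ℝ) (Pol : Set (Policy S A)) : ℕ∞ :=
  ⨅ (T : Set (Policy S A)) (_ : ∀ p ∈ Pol, ∃ q ∈ T, hammingDistance s p q ≤ ε), T.encard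

/-- The largest Hamming covering number over all samples of all sizes `n ≥ 1`. -/
def maxCoveringNumber (ε : ℝ) (Pol : Set (Policy S A)) : ℕ∞ :=
  ⨆ (n : ℕ) (s : Fin (n + 1) → S), coveringNumber s ε Pol

/-- The Hamming entropy integral `κ(Pol) = ∫₀¹ log^{1/2} N(t², Pol) dt`, in `[0, ∞]`. -/
def entropyIntegral (Pol : Set (Policy S A)) : ℝ≥0∞ :=
  ∫⁻ t in Set.Ioo (0 : ℝ) 1,
    ((ENNReal.log (maxCoveringNumber (t ^ 2) Pol : ℝ≥0∞)).toENNReal) ^ (1 / 2 : ℝ)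

/-- Pointwise measurability of the policy class: every policy of the class is a pointwise limit of
a sequence from a fixed countable subclass. -/
def PointwiseMeasurable (Pol : Set (Policy S A)) : Prop :=
  ∃ C : Set (Policy S A), C ⊆ Pol ∧ C.Countable ∧ ∀ p ∈ Pol, ∃ q : ℕ → Policy S A,
    (∀ n, q n ∈ C) ∧ ∀ s a, Tendsto (fun n => (q n).prob s a) atTop (𝓝 (p.prob s a))

end Complexity

section CrossFitting

variable {S A U : Type*} [MeasurableSpace S] [MeasurableSpace A] [MeasurableSpace U] {N K : ℕ}

/-- The folds `{i : fold i = k}`, `k < K`, have sizes that differ by at most one. -/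
def EvenFolds (fold : Fin N → Fin K) : Prop :=
  ∀ k l, (Finset.univ.filter (fun i => fold i = k)).card
    ≤ (Finset.univ.filter (fun i => fold i = l)).card + 1

/-- The data outside fold `k`. -/
abbrev OutOfFold (S A : Type*) (fold : Fin N → Fin K) (k : Fin K) : Type _ :=
  {i : Fin N // fold i ≠ k} → Obs S A

/-- The restriction of a data set to the observations outside fold `k`. -/
def outOfFold (fold : Fin N → Fin K) (k : Fin K) (D : Fin N → Obs S A) : OutOfFold S A fold k :=
  fun i => D i.1

/-- Estimators of the propensities `π₀(a ∣ s)`, one for each fold, each trained on the data outside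
its fold, possibly with the help of a random seed in `U`. -/
structure PropensityLearner (S A U : Type*) [MeasurableSpace S] [MeasurableSpace A]
    [MeasurableSpace U] (fold : Fin N → Fin K) where
  /-- The estimate `π̂₀⁽ᵏ⁾(a ∣ s)`. -/
  est : (k : Fin K) → U → OutOfFold S A fold k → S → A → ℝ
  measurable_est : ∀ k a,
    Measurable (fun x : U × OutOfFold S A fold k × S => est k x.1 x.2.1 x.2.2 a)

/-- Estimators of the continuum of regression functions `f₀(s, a; α)`, one for each fold, each
trained on the data outside its fold, possibly with the help of a random seed in `U`. -/
structure RegressionLearner (S A U : Type*) [MeasurableSpace S] [MeasurableSpace A]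
    [MeasurableSpace U] (fold : Fin N → Fin K) where
  /-- The estimate `f̂₀⁽ᵏ⁾(s, a; α)`. -/
  est : (k : Fin K) → U → OutOfFold S A fold k → S → A → ℝ → ℝ
  measurable_est : ∀ k a α,
    Measurable (fun x : U × OutOfFold S A fold k × S => est k x.1 x.2.1 x.2.2 a α)

/-- The law of the seed and of `N` i.i.d. observations. -/
def dataLaw (ρ : Measure U) (P₀ : Env S A) [IsFiniteMeasure P₀] (π₀ : Policy S A) (N : ℕ) :
    Measure (U × (Fin N → Obs S A)) :=
  ρ.prod (Measure.pi (fun _ => obsLaw P₀ π₀))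

/-- For each fold, with probability at least `1 - b`, the number `rate` bounds the `L²` error
`‖π̂₀⁽ᵏ⁾(A ∣ S) - π₀(A ∣ S)‖`. -/
def IsPropensityRate (ρ : Measure U) (P₀ : Env S A) [IsFiniteMeasure P₀] (π₀ : Policy S A)
    {fold : Fin N → Fin K} (πhat : PropensityLearner S A U fold) (b : ℝ) (rate : ℝ≥0) : Prop :=
  ∀ k, dataLaw ρ P₀ π₀ N {x | ¬ eLpNorm (fun z : Obs S A =>
      πhat.est k x.1 (outOfFold fold k x.2) z.1 z.2.1 - π₀.prob z.1 z.2.1) 2 (obsLaw P₀ π₀)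
        ≤ (rate : ℝ≥0∞)} ≤ ENNReal.ofReal b

/-- For each fold, with probability at least `1 - b`, the number `rate` bounds the `L²` error
`‖sup_{α ∈ [lo, hi]} |f̂₀⁽ᵏ⁾(S, A; α) - f₀(S, A; α)|‖`. -/
def IsRegressionRate (ρ : Measure U) (P₀ : Env S A) [IsFiniteMeasure P₀] (π₀ : Policy S A)
    {fold : Fin N → Fin K} (fhat : RegressionLearner S A U fold) (lo hi b : ℝ) (rate : ℝ≥0) :
    Prop :=
  ∀ k, dataLaw ρ P₀ π₀ N {x | ¬ eLpNorm (fun z : Obs S A => ⨆ α : Set.Icc lo hi,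
      |fhat.est k x.1 (outOfFold fold k x.2) z.1 z.2.1 α - f₀ P₀ π₀ z.1 z.2.1 α|) 2 (obsLaw P₀ π₀)
        ≤ (rate : ℝ≥0∞)} ≤ ENNReal.ofReal b

/-- The cross-fitted doubly robust estimate `Ŵ(p, α)` from the seed `x.1` and the data `x.2`. -/
def Wdr [Fintype A] {fold : Fin N → Fin K} (πhat : PropensityLearner S A U fold)
    (fhat : RegressionLearner S A U fold) (x : U × (Fin N → Obs S A)) (p : Policy S A)
    (α : ℝ) : ℝ :=
  (1 / (N : ℝ)) * ∑ i : Fin N,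
    (p.prob (x.2 i).1 (x.2 i).2.1
        / πhat.est (fold i) x.1 (outOfFold fold (fold i) x.2) (x.2 i).1 (x.2 i).2.1
      * (Real.exp (-(x.2 i).2.2 / α)
        - fhat.est (fold i) x.1 (outOfFold fold (fold i) x.2) (x.2 i).1 (x.2 i).2.1 α)
    + ∑ a : A, p.prob (x.2 i).1 a
        * fhat.est (fold i) x.1 (outOfFold fold (fold i) x.2) (x.2 i).1 a α)

/-- The doubly robust objective `V̂_δ(p) = max_{α ∈ [lo, hi]} (-α log Ŵ(p, α) - α δ)`. -/
def Vdr [Fintype A] {fold : Fin N → Fin K} (πhat : PropensityLearner S A U fold)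
    (fhat : RegressionLearner S A U fold) (δ lo hi : ℝ) (x : U × (Fin N → Obs S A))
    (p : Policy S A) : ℝ :=
  sSup ((fun α => -α * Real.log (Wdr πhat fhat x p α) - α * δ) '' Set.Icc lo hi)

end CrossFitting

/-- The sample size is sufficiently large (`L = 1/α̲²` is a Lipschitz constant, `r₁`, `r₂` are the
nuisance rates at confidence `β/K`). -/
def SufficientlyLarge (N K : ℕ) (Wl η κ αlow αup β r₁ r₂ : ℝ) : Prop :=
  288 / (η * √N) * (κ + max (1 / αlow ^ 2 * αup) 1) + 4 / (η * √N) * √(Real.log (1 / β)) ≤ Wl / 2 ∧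
  384 * √K / (η * √N) * (κ + max (1 / αlow ^ 2 * αup) 1)
    + 8 * √K / (η * √N) * √(Real.log (K / β)) + r₁ * r₂ / η ^ 2 ≤ Wl / 4

end KLDRO

end

namespace KLDRO

/-- The sign `±1` encoded by a Boolean. -/
def boolSign (b : Bool) : ℝ := if b then 1 else -1

lemma abs_boolSign (b : Bool) : |boolSign b| = 1 := by
  cases b <;> simp [boolSign]

section Rademacher

variable {I : Type*} [Fintype I]

open Classical in
lemma sum_exp_boolSign (a : I → ℝ) :
    ∑ ε : I → Bool, Real.exp (∑ i, boolSign (ε i) * a i) = ∏ i, (2 * Real.cosh (a i)) := by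
  have h : ∀ i, 2 * Real.cosh (a i) = ∑ b : Bool, Real.exp (boolSign b * a i) := by
    intro i
    rw [Real.cosh_eq]
    simp [boolSign]
    ring
  simp_rw [h, Fintype.prod_sum, Real.exp_sum]

open Classical in
lemma sum_exp_boolSign_le (a : I → ℝ) {v : ℝ} (ha : ∑ i, a i ^ 2 ≤ v) (l : ℝ) :
    ∑ ε : I → Bool, Real.exp (l * ∑ i, boolSign (ε i) * a i)
      ≤ 2 ^ Fintype.card I * Real.exp (l ^ 2 * v / 2) := by
  have h := sum_exp_boolSign (fun i => l * a i)
  have h1 : ∀ ε : I → Bool, ∑ i, boolSign (ε i) * (l * a i)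
      = l * ∑ i, boolSign (ε i) * a i := by
    intro ε
    rw [Finset.mul_sum]
    exact Finset.sum_congr rfl fun i _ => by ring
  simp_rw [h1] at h
  rw [h, Finset.prod_mul_distrib]
  simp only [Finset.prod_const, Finset.card_univ]
  gcongr
  calc ∏ i, Real.cosh (l * a i) ≤ ∏ i, Real.exp ((l * a i) ^ 2 / 2) := by
        exact Finset.prod_le_prod (fun i _ => (Real.cosh_pos _).le)
          fun i _ => Real.cosh_le_exp_half_sq _
    _ = Real.exp (∑ i, (l * a i) ^ 2 / 2) := (Real.exp_sum _ _).symm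
    _ ≤ Real.exp (l ^ 2 * v / 2) := by
        gcongr
        calc ∑ i, (l * a i) ^ 2 / 2 = l ^ 2 * (∑ i, a i ^ 2) / 2 := by
              rw [Finset.mul_sum, Finset.sum_div]
              exact Finset.sum_congr rfl fun i _ => by ring
          _ ≤ _ := by gcongr

open Classical in
/-- Hoeffding's inequality for a Rademacher sum, as a count of sign vectors. -/
lemma card_boolSign_gt_le (a : I → ℝ) {v u : ℝ} (hv : 0 < v) (hu : 0 ≤ u)
    (ha : ∑ i, a i ^ 2 ≤ v) :
    ((Finset.univ.filter (fun ε : I → Bool => u < |∑ i, boolSign (ε i) * a i|)).card : ℝ)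
      ≤ 2 * Real.exp (-u ^ 2 / (2 * v)) * 2 ^ Fintype.card I := by
  set l := u / v with hl
  have hl0 : 0 ≤ l := by positivity
  have key : ∀ ε : I → Bool, u < |∑ i, boolSign (ε i) * a i| →
      1 ≤ Real.exp (-(l * u)) * (Real.exp (l * ∑ i, boolSign (ε i) * a i)
        + Real.exp (-l * ∑ i, boolSign (ε i) * a i)) := by
    intro ε hε
    rw [mul_add, ← Real.exp_add, ← Real.exp_add]
    rcases lt_abs.mp hε with h | h
    · have : 1 ≤ Real.exp (-(l * u) + l * ∑ i, boolSign (ε i) * a i) :=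
        Real.one_le_exp (by nlinarith)
      linarith [Real.exp_pos (-(l * u) + -l * ∑ i, boolSign (ε i) * a i)]
    · have : 1 ≤ Real.exp (-(l * u) + -l * ∑ i, boolSign (ε i) * a i) :=
        Real.one_le_exp (by nlinarith)
      linarith [Real.exp_pos (-(l * u) + l * ∑ i, boolSign (ε i) * a i)]
  calc ((Finset.univ.filter (fun ε : I → Bool => u < |∑ i, boolSign (ε i) * a i|)).card : ℝ)
      = ∑ ε ∈ Finset.univ.filter (fun ε : I → Bool => u < |∑ i, boolSign (ε i) * a i|),
          (1 : ℝ) := by simp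
    _ ≤ ∑ ε ∈ Finset.univ.filter (fun ε : I → Bool => u < |∑ i, boolSign (ε i) * a i|),
          Real.exp (-(l * u)) * (Real.exp (l * ∑ i, boolSign (ε i) * a i)
        + Real.exp (-l * ∑ i, boolSign (ε i) * a i)) :=
        Finset.sum_le_sum fun ε hε => key ε (Finset.mem_filter.mp hε).2
    _ ≤ ∑ ε : I → Bool, Real.exp (-(l * u)) * (Real.exp (l * ∑ i, boolSign (ε i) * a i)
        + Real.exp (-l * ∑ i, boolSign (ε i) * a i)) :=
        Finset.sum_le_sum_of_subset_of_nonneg (Finset.filter_subset _ _)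
          fun ε _ _ => by positivity
    _ ≤ Real.exp (-(l * u)) * (2 ^ Fintype.card I * Real.exp (l ^ 2 * v / 2)
          + 2 ^ Fintype.card I * Real.exp ((-l) ^ 2 * v / 2)) := by
        rw [← Finset.mul_sum, Finset.sum_add_distrib]
        gcongr
        · exact sum_exp_boolSign_le a ha l
        · exact sum_exp_boolSign_le a ha (-l)
    _ = 2 * (Real.exp (-(l * u)) * Real.exp (l ^ 2 * v / 2)) * 2 ^ Fintype.card I := by
        rw [neg_sq]; ring
    _ = 2 * Real.exp (-u ^ 2 / (2 * v)) * 2 ^ Fintype.card I := by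
        rw [← Real.exp_add]
        congr 3
        rw [hl]
        field_simp
        ring

open Classical in
/-- The chaining union bound: if every vector of `V` is a sum of one link from each level, up to
an `ℓ¹` remainder, then few sign vectors make a Rademacher sum over `V` large. -/
lemma card_chain_le (V : Set (I → ℝ)) (J : ℕ) (E : ℕ → Finset (I → ℝ)) (v u : ℕ → ℝ)
    (r : ℝ) (hv : ∀ j, 0 < v j) (hu : ∀ j, 0 ≤ u j)
    (hE : ∀ j, ∀ e ∈ E j, ∑ i, e i ^ 2 ≤ v j)
    (hV : ∀ a ∈ V, ∃ e : ℕ → I → ℝ, (∀ j, e j ∈ E j) ∧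
      ∑ i, |a i - ∑ j ∈ Finset.range J, e j i| ≤ r) :
    ((Finset.univ.filter (fun ε : I → Bool => ∃ a ∈ V,
        ∑ j ∈ Finset.range J, u j + r < |∑ i, boolSign (ε i) * a i|)).card : ℝ)
      ≤ (∑ j ∈ Finset.range J, (E j).card * (2 * Real.exp (-u j ^ 2 / (2 * v j))))
        * 2 ^ Fintype.card I := by
  set B : ℕ → (I → ℝ) → Finset (I → Bool) := fun j e =>
    Finset.univ.filter (fun ε : I → Bool => u j < |∑ i, boolSign (ε i) * e i|) with hB
  have hsub : (Finset.univ.filter (fun ε : I → Bool => ∃ a ∈ V,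
        ∑ j ∈ Finset.range J, u j + r < |∑ i, boolSign (ε i) * a i|))
      ⊆ (Finset.range J).biUnion (fun j => (E j).biUnion (B j)) := by
    intro ε hε
    obtain ⟨a, haV, ha⟩ := (Finset.mem_filter.mp hε).2
    obtain ⟨e, heE, her⟩ := hV a haV
    by_contra hcon
    simp only [Finset.mem_biUnion, hB, Finset.mem_filter, Finset.mem_univ, true_and, not_exists,
      not_and, not_lt] at hcon
    refine absurd ha (not_lt.mpr ?_)
    have h1 : ∑ i, boolSign (ε i) * a i
        = ∑ j ∈ Finset.range J, ∑ i, boolSign (ε i) * e j i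
          + ∑ i, boolSign (ε i) * (a i - ∑ j ∈ Finset.range J, e j i) := by
      rw [Finset.sum_comm, ← Finset.sum_add_distrib]
      refine Finset.sum_congr rfl fun i _ => ?_
      rw [← Finset.mul_sum]; ring
    rw [h1]
    refine (abs_add_le _ _).trans (add_le_add ?_ ?_)
    · refine (Finset.abs_sum_le_sum_abs _ _).trans (Finset.sum_le_sum fun j hj => ?_)
      exact hcon j hj (e j) (heE j)
    · refine ((Finset.abs_sum_le_sum_abs _ _).trans (Finset.sum_le_sum fun i _ => ?_)).trans her
      rw [abs_mul, abs_boolSign, one_mul]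
  calc _ ≤ (((Finset.range J).biUnion (fun j => (E j).biUnion (B j))).card : ℝ) := by
        exact_mod_cast Finset.card_le_card hsub
    _ ≤ ∑ j ∈ Finset.range J, (((E j).biUnion (B j)).card : ℝ) := by
        exact_mod_cast Finset.card_biUnion_le
    _ ≤ ∑ j ∈ Finset.range J, ∑ e ∈ E j, ((B j e).card : ℝ) := by
        gcongr with j
        exact_mod_cast Finset.card_biUnion_le
    _ ≤ ∑ j ∈ Finset.range J, ∑ e ∈ E j,
          2 * Real.exp (-u j ^ 2 / (2 * v j)) * 2 ^ Fintype.card I := by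
        gcongr with j _ e he
        exact card_boolSign_gt_le e (hv j) (hu j) (hE j e he)
    _ = _ := by
        rw [Finset.sum_mul]
        refine Finset.sum_congr rfl fun j _ => ?_
        rw [Finset.sum_const, nsmul_eq_mul]; ring

end Rademacher

section Symmetrization

variable {I Z : Type*} [Fintype I] [MeasurableSpace Z]

lemma half_le_measure_deviation_lt (P : Measure Z) [IsProbabilityMeasure P] {f : Z → ℝ}
    (hf : Measurable f) {M τ : ℝ} (hM : ∀ z, |f z| ≤ M) (hτ₀ : 0 < τ)
    (hτ : 8 * Fintype.card I * M ^ 2 ≤ τ ^ 2) :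
    1 / 2 ≤ Measure.pi (fun _ : I => P) {z | |∑ i, (f (z i) - ∫ y, f y ∂P)| < τ / 2} := by
  set μ := Measure.pi (fun _ : I => P)
  have hmem : MemLp f 2 P :=
    MemLp.of_bound hf.aestronglyMeasurable M (ae_of_all _ hM)
  set X : (I → Z) → ℝ := ∑ i, fun z : I → Z => f (z i) with hX
  have hXm : Measurable X := by rw [hX]; fun_prop
  have hXmem : MemLp X 2 μ := by
    refine memLp_finsetSum' _ fun i _ => ?_
    exact hmem.comp_measurePreserving (measurePreserving_eval (fun _ : I => P) i)
  have hvar : Var[X; μ] ≤ Fintype.card I * M ^ 2 := by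
    rw [hX, variance_sum_pi (fun _ => hmem)]
    calc ∑ _i : I, Var[f; P] ≤ ∑ _i : I, M ^ 2 := by
          gcongr
          refine (variance_le_expectation_sq hf.aestronglyMeasurable).trans ?_
          have : ∫ z, (f ^ 2) z ∂P ≤ ∫ _z, M ^ 2 ∂P :=
            integral_mono hmem.integrable_sq (integrable_const _)
              fun z => sq_le_sq' (abs_le.mp (hM z)).1 (abs_le.mp (hM z)).2
          simpa using this
      _ = _ := by simp
  have hmean : ∫ z, X z ∂μ = Fintype.card I * ∫ y, f y ∂P := by
    have h1 : ∀ i : I, ∫ z : I → Z, f (z i) ∂μ = ∫ y, f y ∂P := fun i =>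
      (measurePreserving_eval (fun _ : I => P) i).hasLaw.integral_comp hf.aestronglyMeasurable
    simp only [hX, Finset.sum_apply]
    rw [integral_finsetSum]
    · simp [h1]
    · intro i _
      exact (hmem.comp_measurePreserving
        (measurePreserving_eval (fun _ : I => P) i)).integrable one_le_two
  have hset : {z : I → Z | |∑ i, (f (z i) - ∫ y, f y ∂P)| < τ / 2}
      = {z | τ / 2 ≤ |X z - ∫ z, X z ∂μ|}ᶜ := by
    ext z
    have h2 : ∑ i, (f (z i) - ∫ y, f y ∂P) = X z - ∫ z, X z ∂μ := by
      rw [hmean]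
      simp [hX, Finset.sum_sub_distrib]
    rw [Set.mem_compl_iff, Set.mem_ofPred_eq, Set.mem_ofPred_eq, h2, not_le]
  have hcheb := meas_ge_le_variance_div_sq hXmem (half_pos hτ₀)
  have hle : μ {z | τ / 2 ≤ |X z - ∫ z, X z ∂μ|} ≤ 1 / 2 := by
    refine hcheb.trans ?_
    have : Var[X; μ] / (τ / 2) ^ 2 ≤ 1 / 2 := by
      rw [div_le_iff₀ (by positivity)]
      linarith [hvar]
    calc ENNReal.ofReal (Var[X; μ] / (τ / 2) ^ 2) ≤ ENNReal.ofReal (1 / 2) :=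
          ENNReal.ofReal_le_ofReal this
      _ = 1 / 2 := by
          rw [ENNReal.ofReal_div_of_pos two_pos]; simp
  rw [hset, prob_compl_eq_one_sub
    (measurableSet_le measurable_const (by fun_prop))]
  calc (1 / 2 : ℝ≥0∞) = 1 - 1 / 2 := by simp
    _ ≤ _ := tsub_le_tsub_left hle 1

open Classical in
/-- Symmetrization with a ghost sample: the deviation probability of a countable class is
controlled by the worst-case proportion of sign vectors with a large symmetrized sum. -/
theorem measure_exists_deviation_le (P : Measure Z) [IsProbabilityMeasure P] {ι : Type*}
    [Countable ι] {F : ι → Z → ℝ} (hF : ∀ j, Measurable (F j)) {M τ q : ℝ}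
    (hM : ∀ j z, |F j z| ≤ M) (hτ₀ : 0 < τ) (hτ : 8 * Fintype.card I * M ^ 2 ≤ τ ^ 2)
    (hq : ∀ w : I → Z × Z, ((Finset.univ.filter (fun ε : I → Bool => ∃ j,
      τ / 2 < |∑ i, boolSign (ε i) * (F j (w i).1 - F j (w i).2)|)).card : ℝ)
        ≤ q * 2 ^ Fintype.card I) :
    Measure.pi (fun _ : I => P) {z | ∃ j, τ < |∑ i, (F j (z i) - ∫ y, F j y ∂P)|}
      ≤ ENNReal.ofReal (2 * q) := by
  set μ := Measure.pi (fun _ : I => P) with hμ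
  set ν := Measure.pi (fun _ : I => P.prod P) with hν
  set A := {z : I → Z | ∃ j, τ < |∑ i, (F j (z i) - ∫ y, F j y ∂P)|} with hA
  set G := {y : (I → Z) × (I → Z) | ∃ j, τ / 2 < |∑ i, (F j (y.1 i) - F j (y.2 i))|} with hG
  set G' := {w : I → Z × Z | ∃ j, τ / 2 < |∑ i, (F j (w i).1 - F j (w i).2)|} with hG'
  have hAm : MeasurableSet A := by
    simp only [hA, Set.ofPred_exists]
    exact MeasurableSet.iUnion fun j => measurableSet_lt measurable_const (by fun_prop)
  have hGm : MeasurableSet G := by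
    simp only [hG, Set.ofPred_exists]
    exact MeasurableSet.iUnion fun j => measurableSet_lt measurable_const (by fun_prop)
  have hG'm : MeasurableSet G' := by
    simp only [hG', Set.ofPred_exists]
    exact MeasurableSet.iUnion fun j => measurableSet_lt measurable_const (by fun_prop)
  have h1 : 1 / 2 * μ A ≤ (μ.prod μ) G := by
    rw [Measure.prod_apply hGm, ← lintegral_indicator_const hAm]
    refine lintegral_mono fun z => ?_
    by_cases hz : z ∈ A
    · rw [Set.indicator_of_mem hz]
      obtain ⟨j, hj⟩ := hz
      refine (half_le_measure_deviation_lt P (hF j) (hM j) hτ₀ hτ).trans (measure_mono ?_)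
      intro z' hz'
      refine ⟨j, ?_⟩
      have h2 : ∑ i, (F j (z i) - ∫ y, F j y ∂P)
          = ∑ i, (F j (z i) - F j (z' i)) + ∑ i, (F j (z' i) - ∫ y, F j y ∂P) := by
        rw [← Finset.sum_add_distrib]
        exact Finset.sum_congr rfl fun i _ => by ring
      have h3 := abs_add_le (∑ i, (F j (z i) - F j (z' i))) (∑ i, (F j (z' i) - ∫ y, F j y ∂P))
      rw [← h2] at h3
      simp only [Set.mem_ofPred_eq] at hz'
      show τ / 2 < |∑ i, (F j (z i) - F j (z' i))|
      linarith
    · rw [Set.indicator_of_notMem hz]; exact zero_le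
  have h2 : (μ.prod μ) G = ν G' := by
    have := (measurePreserving_arrowProdEquivProdArrow Z Z I (fun _ => P)
      (fun _ => P)).measure_preimage hGm.nullMeasurableSet
    rw [← this]
    rfl
  set T : (I → Bool) → (I → Z × Z) → (I → Z × Z) := fun ε w i =>
    if ε i then w i else (w i).swap with hT
  have hTmp : ∀ ε, MeasurePreserving (T ε) ν ν := by
    intro ε
    refine measurePreserving_pi (fun _ : I => P.prod P) (fun _ : I => P.prod P)
      (f := fun i x => if ε i then x else x.swap) fun i => ?_
    cases ε i
    · simpa using Measure.measurePreserving_swap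
    · simp only [if_true]; exact MeasurePreserving.id _
  have h3 : (2 : ℝ≥0∞) ^ Fintype.card I * ν G' ≤ ENNReal.ofReal (q * 2 ^ Fintype.card I) := by
    calc (2 : ℝ≥0∞) ^ Fintype.card I * ν G' = ∑ ε : I → Bool, ν (T ε ⁻¹' G') := by
          simp_rw [fun ε => (hTmp ε).measure_preimage hG'm.nullMeasurableSet]
          simp
      _ = ∑ ε : I → Bool, ∫⁻ w, (T ε ⁻¹' G').indicator 1 w ∂ν := by
          refine Finset.sum_congr rfl fun ε _ => ?_
          rw [lintegral_indicator_one ((hTmp ε).measurable hG'm)]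
      _ = ∫⁻ w, ∑ ε : I → Bool, (T ε ⁻¹' G').indicator 1 w ∂ν := by
          rw [lintegral_finsetSum]
          exact fun ε _ => measurable_one.indicator ((hTmp ε).measurable hG'm)
      _ ≤ ∫⁻ _w, ENNReal.ofReal (q * 2 ^ Fintype.card I) ∂ν := by
          refine lintegral_mono fun w => ?_
          have h4 : ∑ ε : I → Bool, (T ε ⁻¹' G').indicator (1 : (I → Z × Z) → ℝ≥0∞) w
              = (((Finset.univ.filter (fun ε : I → Bool => ∃ j,
                τ / 2 < |∑ i, boolSign (ε i) * (F j (w i).1 - F j (w i).2)|)).card : ℝ≥0∞)) := by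
            rw [Finset.card_filter]
            push_cast
            refine Finset.sum_congr rfl fun ε _ => ?_
            have h5 : w ∈ T ε ⁻¹' G' ↔ ∃ j,
                τ / 2 < |∑ i, boolSign (ε i) * (F j (w i).1 - F j (w i).2)| := by
              simp only [hG', hT, Set.mem_preimage, Set.mem_ofPred_eq]
              refine exists_congr fun j => ?_
              have : ∀ i, F j (if ε i then w i else (w i).swap).1
                  - F j (if ε i then w i else (w i).swap).2
                  = boolSign (ε i) * (F j (w i).1 - F j (w i).2) := by
                intro i
                cases ε i <;> simp [boolSign]
              simp_rw [this]
            by_cases h6 : w ∈ T ε ⁻¹' G'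
            · rw [Set.indicator_of_mem h6, if_pos (h5.mp h6)]; rfl
            · rw [Set.indicator_of_notMem h6, if_neg (fun h => h6 (h5.mpr h))]
          rw [h4, ← ENNReal.ofReal_natCast]
          exact ENNReal.ofReal_le_ofReal (hq w)
      _ = _ := by simp
  have h5 : ν G' ≤ ENNReal.ofReal q := by
    rw [mul_comm q, ENNReal.ofReal_mul (by positivity), ENNReal.ofReal_pow (by norm_num)] at h3
    simp only [ENNReal.ofReal_ofNat] at h3
    exact (ENNReal.mul_le_mul_iff_right (by simp) (by simp)).mp h3
  calc μ A = 2 * (1 / 2 * μ A) := by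
        rw [← mul_assoc, one_div, ENNReal.mul_inv_cancel two_ne_zero ENNReal.ofNat_ne_top, one_mul]
    _ ≤ 2 * ENNReal.ofReal q := by
        gcongr
        exact h1.trans (h2.le.trans h5)
    _ = ENNReal.ofReal (2 * q) := by
        rw [ENNReal.ofReal_mul (by norm_num)]; simp

end Symmetrization

section Covering

variable {S A : Type*} [MeasurableSpace S] [MeasurableSpace A]

lemma maxCoveringNumber_anti (Pol : Set (Policy S A)) :
    Antitone (fun ε : ℝ => maxCoveringNumber ε Pol) := by
  intro ε ε' h
  refine iSup_mono fun n => iSup_mono fun s => ?_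
  refine le_iInf₂ fun T hT => iInf₂_le_of_le T (fun p hp => ?_) le_rfl
  obtain ⟨q, hq, hd⟩ := hT p hp
  exact ⟨q, hq, hd.trans h⟩

open Classical in
/-- A sample of states indexed by a finite type has a Hamming net whose size is at most the
uniform covering number. -/
lemma exists_finset_cover {I : Type*} [Fintype I] [Nonempty I] (s : I → S) {ε : ℝ}
    {Pol : Set (Policy S A)} (hfin : maxCoveringNumber ε Pol ≠ ⊤) :
    ∃ T : Finset (Policy S A), T.card ≤ (maxCoveringNumber ε Pol).toNat ∧ ∀ p ∈ Pol, ∃ q ∈ T,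
      ((Finset.univ.filter (fun i => p.1 (s i) ≠ q.1 (s i))).card : ℝ) ≤ ε * Fintype.card I := by
  obtain ⟨n, hn⟩ : ∃ n, Fintype.card I = n + 1 :=
    Nat.exists_eq_succ_of_ne_zero Fintype.card_ne_zero
  let e : I ≃ Fin (n + 1) := Fintype.equivFinOfCardEq hn
  have h1 : coveringNumber (s ∘ e.symm) ε Pol ≤ maxCoveringNumber ε Pol :=
    le_iSup₂ (f := fun (n : ℕ) (s : Fin (n + 1) → S) => coveringNumber s ε Pol) n (s ∘ e.symm)
  have h2 : coveringNumber (s ∘ e.symm) ε Pol < maxCoveringNumber ε Pol + 1 :=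
    h1.trans_lt ((ENat.lt_add_one_iff hfin).mpr le_rfl)
  unfold coveringNumber at h2
  simp only [iInf_lt_iff] at h2
  obtain ⟨T, hT, hcard⟩ := h2
  have hcard' : T.encard ≤ maxCoveringNumber ε Pol := (ENat.lt_add_one_iff hfin).mp hcard
  have hTf : T.Finite := Set.encard_ne_top_iff.mp (ne_top_of_le_ne_top hfin hcard')
  refine ⟨hTf.toFinset, ?_, fun p hp => ?_⟩
  · rw [hTf.encard_eq_coe_toFinset_card] at hcard'
    have := ENat.toNat_le_toNat hcard' hfin
    simpa using this
  · obtain ⟨q, hq, hd⟩ := hT p hp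
    refine ⟨q, by simpa using hq, ?_⟩
    unfold hammingDistance at hd
    rw [div_le_iff₀ (by positivity)] at hd
    rw [hn]
    refine le_trans (le_of_eq ?_) hd
    congr 1
    refine Finset.card_bij (fun i _ => e i) ?_ ?_ ?_
    · intro i hi; simpa using hi
    · intro i _ j _ h; exact e.injective h
    · intro j hj; exact ⟨e.symm j, by simpa using hj, by simp⟩

lemma entropyIntegrand_eq {N : ℕ∞} (hN : N ≠ ⊤) :
    ((ENNReal.log (N : ℝ≥0∞)).toENNReal) ^ (1 / 2 : ℝ)
      = ENNReal.ofReal √(Real.log N.toNat) := by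
  lift N to ℕ using hN
  rcases Nat.eq_zero_or_pos N with rfl | hpos
  · simp
  · have : ENNReal.log ((N : ℕ∞) : ℝ≥0∞) = ((Real.log N : ℝ) : EReal) := by
      rw [ENNReal.log_pos_real (by simpa using hpos.ne') (by simp)]
      simp
    rw [this, EReal.toENNReal_of_ne_top (by simp), Real.sqrt_eq_rpow,
      ← ENNReal.ofReal_rpow_of_nonneg (Real.log_natCast_nonneg _) (by norm_num)]
    simp

lemma entropyIntegral_ge (Pol : Set (Policy S A)) (J : ℕ) :
    ∑ j ∈ Finset.range J, ENNReal.ofReal ((1 / 2) ^ (j + 1)) *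
      ((ENNReal.log (maxCoveringNumber ((1 / 4) ^ j) Pol : ℝ≥0∞)).toENNReal) ^ (1 / 2 : ℝ)
      ≤ entropyIntegral Pol := by
  set g : ℝ → ℝ≥0∞ := fun t =>
    ((ENNReal.log (maxCoveringNumber t Pol : ℝ≥0∞)).toENNReal) ^ (1 / 2 : ℝ) with hg
  have hganti : Antitone g := by
    intro a b h
    refine ENNReal.rpow_le_rpow (EReal.toENNReal_le_toENNReal
      (ENNReal.log_monotone ?_)) (by norm_num)
    exact_mod_cast maxCoveringNumber_anti Pol h
  have hdisj : Set.PairwiseDisjoint (↑(Finset.range J) : Set ℕ)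
      (fun j : ℕ => Set.Ioo ((1 / 2 : ℝ) ^ (j + 1)) ((1 / 2) ^ j)) := by
    intro i _ j _ hij
    rw [Function.onFun, Set.disjoint_left]
    rintro x ⟨hx1, hx2⟩ ⟨hx3, hx4⟩
    rcases lt_or_gt_of_ne hij with h | h
    · have := pow_le_pow_of_le_one (by norm_num : (0 : ℝ) ≤ 1 / 2) (by norm_num)
        (Nat.succ_le_of_lt h)
      simp only [Nat.succ_eq_add_one] at this
      linarith
    · have := pow_le_pow_of_le_one (by norm_num : (0 : ℝ) ≤ 1 / 2) (by norm_num)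
        (Nat.succ_le_of_lt h)
      simp only [Nat.succ_eq_add_one] at this
      linarith
  calc ∑ j ∈ Finset.range J, ENNReal.ofReal ((1 / 2) ^ (j + 1)) * g ((1 / 4) ^ j)
      ≤ ∑ j ∈ Finset.range J, ∫⁻ t in Set.Ioo ((1 / 2 : ℝ) ^ (j + 1)) ((1 / 2) ^ j), g (t ^ 2) := by
        refine Finset.sum_le_sum fun j _ => ?_
        calc ENNReal.ofReal ((1 / 2) ^ (j + 1)) * g ((1 / 4) ^ j)
            = ∫⁻ _t in Set.Ioo ((1 / 2 : ℝ) ^ (j + 1)) ((1 / 2) ^ j), g ((1 / 4) ^ j) := by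
              rw [setLIntegral_const, Real.volume_Ioo, mul_comm]
              congr 2
              rw [pow_succ]; ring
          _ ≤ _ := by
              refine setLIntegral_mono' measurableSet_Ioo fun t ht => hganti ?_
              have h0 : (0 : ℝ) < (1 / 2) ^ (j + 1) := by positivity
              calc t ^ 2 ≤ ((1 / 2) ^ j) ^ 2 := by
                    have := ht.1; have := ht.2
                    gcongr
                    linarith
                _ = (1 / 4) ^ j := by rw [← pow_mul, mul_comm, pow_mul]; norm_num
    _ = ∫⁻ t in ⋃ j ∈ Finset.range J, Set.Ioo ((1 / 2 : ℝ) ^ (j + 1)) ((1 / 2) ^ j),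
          g (t ^ 2) := (lintegral_biUnion_finset hdisj (fun _ _ => measurableSet_Ioo) _).symm
    _ ≤ entropyIntegral Pol := by
        refine lintegral_mono_set ?_
        refine Set.iUnion₂_subset fun j _ => Set.Ioo_subset_Ioo (by positivity) ?_
        exact pow_le_one₀ (by norm_num) (by norm_num)

lemma maxCoveringNumber_ne_top {Pol : Set (Policy S A)} (hκ : entropyIntegral Pol ≠ ∞) (j : ℕ) :
    maxCoveringNumber ((1 / 4) ^ j) Pol ≠ ⊤ := by
  intro htop
  have h := entropyIntegral_ge Pol (j + 1)
  rw [Finset.sum_range_succ] at h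
  have h2 := le_add_self.trans h
  rw [htop] at h2
  simp only [ENat.toENNReal_top, ENNReal.log_top, EReal.toENNReal_top] at h2
  rw [ENNReal.top_rpow_of_pos (by norm_num), ENNReal.mul_top (by simp)] at h2
  exact hκ (top_le_iff.mp h2)

/-- The dyadic Riemann sums of the entropy integral. -/
lemma sum_sqrt_log_maxCoveringNumber_le {Pol : Set (Policy S A)} (hκ : entropyIntegral Pol ≠ ∞)
    (J : ℕ) :
    ∑ j ∈ Finset.range J, (1 / 2 : ℝ) ^ (j + 1) *
      √(Real.log (maxCoveringNumber ((1 / 4) ^ j) Pol).toNat) ≤ (entropyIntegral Pol).toReal := by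
  have h := ENNReal.toReal_mono hκ (entropyIntegral_ge Pol J)
  refine le_trans (le_of_eq ?_) h
  rw [ENNReal.toReal_sum]
  · refine Finset.sum_congr rfl fun j _ => ?_
    rw [entropyIntegrand_eq (maxCoveringNumber_ne_top hκ j), ENNReal.toReal_mul,
      ENNReal.toReal_ofReal (by positivity), ENNReal.toReal_ofReal (by positivity)]
  · intro j _
    rw [entropyIntegrand_eq (maxCoveringNumber_ne_top hκ j)]
    exact ENNReal.mul_ne_top ENNReal.ofReal_ne_top ENNReal.ofReal_ne_top

end Covering

lemma exists_finset_grid {lo hi h : ℝ} (hlo : lo ≤ hi) (hh : 0 < h) :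
    ∃ G : Finset ℝ, (G.card : ℝ) ≤ (hi - lo) / h + 1 ∧ (∀ α ∈ G, α ∈ Set.Icc lo hi) ∧
      ∀ α ∈ Set.Icc lo hi, ∃ α' ∈ G, |α - α'| ≤ h := by
  have h0 : 0 ≤ (hi - lo) / h := div_nonneg (by linarith) hh.le
  refine ⟨(Finset.range (⌊(hi - lo) / h⌋₊ + 1)).image (fun k : ℕ => lo + k * h), ?_, ?_, ?_⟩
  · calc _ ≤ ((Finset.range (⌊(hi - lo) / h⌋₊ + 1)).card : ℝ) := by
          exact_mod_cast Finset.card_image_le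
      _ ≤ _ := by
          rw [Finset.card_range]
          push_cast
          gcongr
          exact Nat.floor_le h0
  · intro α hα
    obtain ⟨k, hk, rfl⟩ := Finset.mem_image.mp hα
    have hk' : (k : ℝ) ≤ (hi - lo) / h :=
      (Nat.le_floor_iff h0).mp (Nat.lt_succ_iff.mp (Finset.mem_range.mp hk))
    rw [le_div_iff₀ hh] at hk'
    exact ⟨by nlinarith [(Nat.cast_nonneg k : (0 : ℝ) ≤ k)], by linarith⟩
  · intro α hα
    have h1 : 0 ≤ (α - lo) / h := div_nonneg (by linarith [hα.1]) hh.le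
    refine ⟨lo + ⌊(α - lo) / h⌋₊ * h, Finset.mem_image.mpr ⟨⌊(α - lo) / h⌋₊, ?_, rfl⟩, ?_⟩
    · rw [Finset.mem_range, Nat.lt_succ_iff]
      refine Nat.floor_le_floor ?_
      gcongr
      exact hα.2
    · have h2 := Nat.floor_le h1
      have h3 := (Nat.lt_floor_add_one ((α - lo) / h)).le
      rw [le_div_iff₀ hh] at h2
      rw [div_le_iff₀ hh] at h3
      rw [abs_le]
      constructor <;> linarith

section Increments

variable {S A Z I : Type*} [MeasurableSpace S] [MeasurableSpace A] [Fintype I]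

open Classical in
/-- The indicator that two policies act differently in a state. -/
noncomputable def disagree (p q : Policy S A) (s : S) : ℝ := if p.1 s = q.1 s then 0 else 1

lemma disagree_nonneg (p q : Policy S A) (s : S) : 0 ≤ disagree p q s := by
  unfold disagree; split_ifs <;> norm_num

lemma disagree_le_one (p q : Policy S A) (s : S) : disagree p q s ≤ 1 := by
  unfold disagree; split_ifs <;> norm_num

lemma disagree_eq_zero {p q : Policy S A} {s : S} (h : p.1 s = q.1 s) : disagree p q s = 0 :=
  if_pos h

lemma disagree_eq_one {p q : Policy S A} {s : S} (h : p.1 s ≠ q.1 s) : disagree p q s = 1 :=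
  if_neg h

lemma disagree_comm (p q : Policy S A) (s : S) : disagree p q s = disagree q p s := by
  by_cases h : p.1 s = q.1 s
  · rw [disagree_eq_zero h, disagree_eq_zero h.symm]
  · rw [disagree_eq_one h, disagree_eq_one (Ne.symm h)]

lemma disagree_triangle (p q r : Policy S A) (s : S) :
    disagree p r s ≤ disagree p q s + disagree q r s := by
  by_cases h1 : p.1 s = q.1 s
  · have : disagree p r s = disagree q r s := by unfold disagree; rw [h1]
    linarith [disagree_nonneg p q s]
  · rw [disagree_eq_one h1]
    linarith [disagree_le_one p r s, disagree_nonneg q r s]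

/-- The symmetrized vector of a function along a paired sample. -/
def pairDiff (w : I → Z × Z) (f : Z → ℝ) (i : I) : ℝ := f (w i).1 - f (w i).2

lemma exists_nets (st : Z → S) (w : I → Z × Z) [Nonempty I] {Pol : Set (Policy S A)}
    (hκ : entropyIntegral Pol ≠ ∞) (j : ℕ) :
    ∃ T : Finset (Policy S A), T.card ≤ (maxCoveringNumber ((1 / 4) ^ j) Pol).toNat ∧
      ∀ p ∈ Pol, ∃ q ∈ T, ∑ i, (disagree p q (st (w i).1) + disagree p q (st (w i).2))
        ≤ 2 * (1 / 4) ^ j * Fintype.card I := by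
  classical
  obtain ⟨T, hT, hc⟩ := exists_finset_cover (I := I ⊕ I)
    (Sum.elim (fun i => st (w i).1) (fun i => st (w i).2)) (maxCoveringNumber_ne_top hκ j)
  refine ⟨T, hT, fun p hp => ?_⟩
  obtain ⟨q, hq, hd⟩ := hc p hp
  refine ⟨q, hq, ?_⟩
  rw [Finset.card_filter] at hd
  push_cast at hd
  have h1 : ∑ i : I ⊕ I, disagree p q (Sum.elim (fun i => st (w i).1) (fun i => st (w i).2) i)
      ≤ (1 / 4) ^ j * (Fintype.card (I ⊕ I) : ℝ) := by
    refine (Finset.sum_congr rfl fun i _ => ?_).trans_le hd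
    split_ifs with h
    · exact disagree_eq_one h
    · exact disagree_eq_zero (not_not.mp h)
  rw [Fintype.sum_sum_type, Fintype.card_sum] at h1
  push_cast at h1
  simp only [Sum.elim_inl, Sum.elim_inr] at h1
  rw [Finset.sum_add_distrib]
  linarith

variable {F : Policy S A → ℝ → Z → ℝ} {st : Z → S} {lo hi M L : ℝ}

/-- A family of functions indexed by a policy and a dual variable, bounded by `M`, local in the
policy and Lipschitz in the dual variable. -/
structure IsRegularFamily (F : Policy S A → ℝ → Z → ℝ) (st : Z → S) (lo hi M L : ℝ) : Prop where
  bound : ∀ p, ∀ α ∈ Set.Icc lo hi, ∀ z, |F p α z| ≤ M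
  local_policy : ∀ p q, ∀ α ∈ Set.Icc lo hi, ∀ z, p.1 (st z) = q.1 (st z) → F p α z = F q α z
  lipschitz : ∀ p, ∀ α ∈ Set.Icc lo hi, ∀ α' ∈ Set.Icc lo hi, ∀ z,
    |F p α z - F p α' z| ≤ 3 * M * L * |α - α'|

lemma IsRegularFamily.abs_sub_le (h : IsRegularFamily F st lo hi M L) (p q : Policy S A)
    {α α' : ℝ} (hα : α ∈ Set.Icc lo hi) (hα' : α' ∈ Set.Icc lo hi) (z : Z) :
    |F p α z - F q α' z| ≤ M * (2 * disagree p q (st z) + 3 * L * |α - α'|) := by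
  have h1 : |F p α z - F q α z| ≤ M * (2 * disagree p q (st z)) := by
    by_cases hpq : p.1 (st z) = q.1 (st z)
    · simp [disagree_eq_zero hpq, h.local_policy p q α hα z hpq]
    · rw [disagree_eq_one hpq]
      have h2 := abs_sub (F p α z) (F q α z)
      linarith [h.bound p α hα z, h.bound q α hα z]
  have h2 := h.lipschitz q α hα α' hα' z
  have h3 := _root_.abs_sub_le (F p α z) (F q α z) (F q α' z)
  linarith

omit [Fintype I] in
lemma IsRegularFamily.abs_pairDiff_sub_le (h : IsRegularFamily F st lo hi M L)
    (w : I → Z × Z) (p q : Policy S A) {α α' : ℝ} (hα : α ∈ Set.Icc lo hi)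
    (hα' : α' ∈ Set.Icc lo hi) (i : I) :
    |pairDiff w (F p α) i - pairDiff w (F q α') i|
      ≤ M * (2 * (disagree p q (st (w i).1) + disagree p q (st (w i).2))
        + 6 * L * |α - α'|) := by
  have h1 := h.abs_sub_le p q hα hα' (w i).1
  have h2 := h.abs_sub_le p q hα hα' (w i).2
  have h3 := abs_sub (F p α (w i).1 - F q α' (w i).1) (F p α (w i).2 - F q α' (w i).2)
  have h4 : pairDiff w (F p α) i - pairDiff w (F q α') i
      = (F p α (w i).1 - F q α' (w i).1) - (F p α (w i).2 - F q α' (w i).2) := by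
    unfold pairDiff; ring
  rw [h4]
  linarith

lemma IsRegularFamily.sum_pairDiff_sub_sq_le (h : IsRegularFamily F st lo hi M L) (hM : 0 ≤ M)
    (w : I → Z × Z) (p q : Policy S A) {α α' x : ℝ} (hα : α ∈ Set.Icc lo hi)
    (hα' : α' ∈ Set.Icc lo hi) (hx : 6 * L * |α - α'| ≤ x) :
    ∑ i, (pairDiff w (F p α) i - pairDiff w (F q α') i) ^ 2
      ≤ M ^ 2 * (16 * ∑ i, (disagree p q (st (w i).1) + disagree p q (st (w i).2))
        + 2 * x ^ 2 * Fintype.card I) := by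
  have h1 : ∀ i, (pairDiff w (F p α) i - pairDiff w (F q α') i) ^ 2
      ≤ M ^ 2 * (16 * (disagree p q (st (w i).1) + disagree p q (st (w i).2)) + 2 * x ^ 2) := by
    intro i
    set d := disagree p q (st (w i).1) + disagree p q (st (w i).2) with hd
    have hd0 : 0 ≤ d := add_nonneg (disagree_nonneg _ _ _) (disagree_nonneg _ _ _)
    have hd2 : d ≤ 2 := by
      linarith [disagree_le_one p q (st (w i).1), disagree_le_one p q (st (w i).2)]
    have h2 : |pairDiff w (F p α) i - pairDiff w (F q α') i| ≤ M * (2 * d + x) :=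
      (h.abs_pairDiff_sub_le w p q hα hα' i).trans (by gcongr)
    calc (pairDiff w (F p α) i - pairDiff w (F q α') i) ^ 2
        = |pairDiff w (F p α) i - pairDiff w (F q α') i| ^ 2 := (sq_abs _).symm
      _ ≤ (M * (2 * d + x)) ^ 2 := by gcongr
      _ = M ^ 2 * (2 * d + x) ^ 2 := by ring
      _ ≤ _ := by
          gcongr
          nlinarith [sq_nonneg (2 * d - x)]
  calc _ ≤ ∑ i, M ^ 2 * (16 * (disagree p q (st (w i).1) + disagree p q (st (w i).2))
        + 2 * x ^ 2) := Finset.sum_le_sum fun i _ => h1 i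
    _ = _ := by
        rw [← Finset.mul_sum, Finset.sum_add_distrib, ← Finset.mul_sum, Finset.sum_const,
          Finset.card_univ, nsmul_eq_mul]
        ring

lemma IsRegularFamily.sum_abs_pairDiff_sub_le (h : IsRegularFamily F st lo hi M L) (hM : 0 ≤ M)
    (w : I → Z × Z) (p q : Policy S A) {α α' x : ℝ} (hα : α ∈ Set.Icc lo hi)
    (hα' : α' ∈ Set.Icc lo hi) (hx : 6 * L * |α - α'| ≤ x) :
    ∑ i, |pairDiff w (F p α) i - pairDiff w (F q α') i|
      ≤ M * (2 * ∑ i, (disagree p q (st (w i).1) + disagree p q (st (w i).2))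
        + x * Fintype.card I) := by
  calc _ ≤ ∑ i, M * (2 * (disagree p q (st (w i).1) + disagree p q (st (w i).2)) + x) := by
        refine Finset.sum_le_sum fun i _ => (h.abs_pairDiff_sub_le w p q hα hα' i).trans ?_
        gcongr
    _ = _ := by
        rw [← Finset.mul_sum, Finset.sum_add_distrib, ← Finset.mul_sum, Finset.sum_const,
          Finset.card_univ, nsmul_eq_mul]
        ring

end Increments

lemma sum_range_half_pow (J : ℕ) :
    ∑ l ∈ Finset.range J, (1 / 2 : ℝ) ^ l = 2 - 2 * (1 / 2) ^ J := by
  induction J with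
  | zero => simp
  | succ J ih => rw [Finset.sum_range_succ, ih, pow_succ]; ring

lemma sum_range_mul_half_pow (J : ℕ) :
    ∑ l ∈ Finset.range J, (1 / 2 : ℝ) ^ l * l = 2 - 2 * (J + 1) * (1 / 2) ^ J := by
  induction J with
  | zero => simp
  | succ J ih => rw [Finset.sum_range_succ, ih, pow_succ]; push_cast; ring

/-- The union bound over the links of one level of the chain. -/
lemma chain_level_le (N l : ℕ) {D b v u : ℝ} (hD : 1 ≤ D) (hb : 0 < b) (hb1 : b ≤ 1)
    (hv : 0 < v)
    (hu : u = √v * (2 * √(Real.log N) + 3 / 2 * √(Real.log (1 / b)) + (5 + l) * D)) :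
    (N * (8 * D * 2 ^ (l + 3))) ^ 2 * (2 * Real.exp (-u ^ 2 / (2 * v)))
      ≤ b * (1 / 2) ^ l := by
  rcases Nat.eq_zero_or_pos N with rfl | hN
  · simp only [Nat.cast_zero, zero_mul, ne_eq, OfNat.ofNat_ne_zero, not_false_eq_true, zero_pow]
    positivity
  have hN1 : (1 : ℝ) ≤ N := by exact_mod_cast hN
  set c := √(Real.log N)
  set g := √(Real.log (1 / b))
  have hc : c ^ 2 = Real.log N := Real.sq_sqrt (Real.log_nonneg hN1)
  have hg : g ^ 2 = -Real.log b := by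
    rw [Real.sq_sqrt (Real.log_nonneg (by rw [le_div_iff₀ hb]; linarith)), one_div, Real.log_inv]
  have hc0 : 0 ≤ c := Real.sqrt_nonneg _
  have hg0 : 0 ≤ g := Real.sqrt_nonneg _
  have hu2 : -u ^ 2 / (2 * v) = -(2 * c + 3 / 2 * g + (5 + l) * D) ^ 2 / 2 := by
    rw [hu, mul_pow, Real.sq_sqrt hv.le]
    field_simp
  have hlogD : Real.log D ≤ D - 1 := Real.log_le_sub_one_of_pos (by linarith)
  have hl0 : (0 : ℝ) ≤ l := Nat.cast_nonneg l
  have h2 : Real.log 2 ≤ 0.7 := by linarith [Real.log_two_lt_d9]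
  have h8 : N * (8 * D * 2 ^ (l + 3))
      = Real.exp (Real.log N + Real.log D + (l + 6) * Real.log 2) := by
    rw [Real.exp_add, Real.exp_add, Real.exp_log (by linarith), Real.exp_log (by linarith),
      mul_comm ((l : ℝ) + 6), Real.exp_mul, Real.exp_log two_pos]
    rw [show (l : ℝ) + 6 = ((l + 6 : ℕ) : ℝ) by push_cast; ring, Real.rpow_natCast]
    ring
  have hrhs : b * (1 / 2) ^ l = 2 * Real.exp (Real.log b - (l + 1) * Real.log 2) := by
    rw [Real.exp_sub, Real.exp_log hb, mul_comm ((l : ℝ) + 1), Real.exp_mul, Real.exp_log two_pos]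
    rw [show (l : ℝ) + 1 = ((l + 1 : ℕ) : ℝ) by push_cast; ring, Real.rpow_natCast,
      one_div, inv_pow]
    field_simp
    ring
  rw [h8, hrhs, hu2, ← Real.exp_nat_mul, mul_left_comm, ← Real.exp_add]
  gcongr
  push_cast
  have h3 : (2 * c) ^ 2 + (3 / 2 * g) ^ 2 + ((5 + l) * D) ^ 2
      ≤ (2 * c + 3 / 2 * g + (5 + l) * D) ^ 2 := by
    have : 0 ≤ (5 + (l : ℝ)) * D := by positivity
    nlinarith [mul_nonneg hc0 hg0, mul_nonneg hc0 this, mul_nonneg hg0 this]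
  have h4 : (5 + (l : ℝ)) ^ 2 * D ≤ ((5 + l) * D) ^ 2 := by
    rw [mul_pow]
    gcongr
    nlinarith
  have h5 : 2 * (D - 1) + (3 * (l : ℝ) + 13) * 0.7 ≤ (5 + (l : ℝ)) ^ 2 * D / 2 := by
    nlinarith [mul_nonneg hl0 (by linarith : (0 : ℝ) ≤ D - 1),
      mul_nonneg (mul_nonneg hl0 hl0) (by linarith : (0 : ℝ) ≤ D - 1), mul_nonneg hl0 hl0]
  have h6 : (3 * (l : ℝ) + 13) * Real.log 2 ≤ (3 * (l : ℝ) + 13) * 0.7 := by gcongr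
  nlinarith [sq_nonneg g]

section Chaining

variable {S A Z I : Type*} [MeasurableSpace S] [MeasurableSpace A] [Fintype I]
variable {F : Policy S A → ℝ → Z → ℝ} {st : Z → S} {lo hi M L : ℝ}

open Classical in
/-- Chaining in the Hamming distance and the dual variable: few sign vectors make the symmetrized
process large. -/
theorem IsRegularFamily.card_boolSign_le [Nonempty I] (h : IsRegularFamily F st lo hi M L)
    (hM : 0 < M) (hL : 0 < L) (hlo : lo ≤ hi) {D b : ℝ} (hD1 : 1 ≤ D) (hD : L * (hi - lo) ≤ D)
    (hb : 0 < b) (hb1 : b ≤ 1) {Pol : Set (Policy S A)} (hκ : entropyIntegral Pol ≠ ∞)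
    (w : I → Z × Z) :
    ((Finset.univ.filter (fun ε : I → Bool => ∃ p ∈ Pol, ∃ α ∈ Set.Icc lo hi,
        M * √(Fintype.card I) * (64 * (entropyIntegral Pol).toReal + 25 * D
          + 6 * √(Real.log (1 / b)))
        < |∑ i, boolSign (ε i) * pairDiff w (F p α) i|)).card : ℝ)
      ≤ 2 * b * 2 ^ Fintype.card I := by
  set n : ℝ := (Fintype.card I : ℝ) with hn
  have hn1 : 1 ≤ n := by
    rw [hn]; exact_mod_cast Fintype.card_pos
  set κ := (entropyIntegral Pol).toReal with hκdef
  set g := √(Real.log (1 / b)) with hg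
  set N : ℕ → ℕ := fun j => (maxCoveringNumber ((1 / 4) ^ j) Pol).toNat with hN
  have hNmono : Monotone N := by
    refine monotone_nat_of_le_succ fun j => ?_
    refine ENat.toNat_le_toNat (maxCoveringNumber_anti Pol ?_) (maxCoveringNumber_ne_top hκ _)
    exact pow_le_pow_of_le_one (by norm_num) (by norm_num) (Nat.le_succ j)
  choose T hTcard hT using fun j => exists_nets st w hκ j
  have hstep : ∀ j : ℕ, 0 < (1 / 2 : ℝ) ^ j / (6 * L) := fun j => by positivity
  choose G hGcard hGmem hG using fun j => exists_finset_grid hlo (hstep j)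
  have hGcard' : ∀ j, ((G j).card : ℝ) ≤ 8 * D * 2 ^ j := by
    intro j
    refine (hGcard j).trans ?_
    have h1 : (hi - lo) / ((1 / 2 : ℝ) ^ j / (6 * L)) = 6 * (L * (hi - lo)) * 2 ^ j := by
      rw [one_div, inv_pow]
      field_simp
    have h2 : (1 : ℝ) ≤ 2 ^ j := one_le_pow₀ (by norm_num)
    rw [h1]
    nlinarith [mul_le_mul_of_nonneg_right hD (by linarith : (0 : ℝ) ≤ 2 ^ j)]
  set a : Policy S A × ℝ → I → ℝ := fun x => pairDiff w (F x.1 x.2) with ha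
  set v : ℕ → ℝ := fun l => 4 * M ^ 2 * n * (1 / 4) ^ l with hv
  set E : ℕ → Finset (I → ℝ) := fun l => Nat.casesOn l
    ((T 3 ×ˢ G 3).image a)
    (fun l => (((T (l + 4) ×ˢ G (l + 4)) ×ˢ (T (l + 3) ×ˢ G (l + 3))).image
      (fun x => a x.1 - a x.2)).filter (fun e => ∑ i, e i ^ 2 ≤ v (l + 1))) with hE
  set u : ℕ → ℝ := fun l => √(v l) * (2 * √(Real.log (N (l + 3))) + 3 / 2 * g + (5 + l) * D)
    with hu
  have hv0 : ∀ l, 0 < v l := fun l => by simp only [hv]; positivity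
  have hu0 : ∀ l, 0 ≤ u l := fun l => by simp only [hu]; positivity
  have hTG : ∀ j, ((T j ×ˢ G j).card : ℝ) ≤ N j * (8 * D * 2 ^ j) := by
    intro j
    rw [Finset.card_product]
    push_cast
    have := hTcard j
    gcongr
    exact hGcard' j
  have hEcard : ∀ l, ((E l).card : ℝ) ≤ (N (l + 3) * (8 * D * 2 ^ (l + 3))) ^ 2 := by
    intro l
    cases l with
    | zero =>
      have h1 : ((E 0).card : ℝ) ≤ N 3 * (8 * D * 2 ^ 3) :=
        le_trans (by exact_mod_cast Finset.card_image_le) (hTG 3)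
      refine h1.trans ?_
      rcases Nat.eq_zero_or_pos (N 3) with h0 | h0
      · simp [h0]
      · have : (1 : ℝ) ≤ N 3 := by exact_mod_cast h0
        have h2 : 1 ≤ (N 3 : ℝ) * (8 * D * 2 ^ 3) := by nlinarith
        simp only [zero_add]
        nlinarith
    | succ l =>
      have h1 : ((E (l + 1)).card : ℝ)
          ≤ ((T (l + 4) ×ˢ G (l + 4)).card : ℝ) * ((T (l + 3) ×ˢ G (l + 3)).card : ℝ) := by
        have h2 : (E (l + 1)).card
            ≤ ((T (l + 4) ×ˢ G (l + 4)) ×ˢ (T (l + 3) ×ˢ G (l + 3))).card :=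
          (Finset.card_filter_le _ _).trans Finset.card_image_le
        rw [Finset.card_product] at h2
        exact_mod_cast h2
      refine h1.trans ?_
      rw [sq, show l + 1 + 3 = l + 4 by ring]
      have h3 : (N (l + 3) : ℝ) ≤ N (l + 4) := by exact_mod_cast hNmono (by omega)
      have h4 : (2 : ℝ) ^ (l + 3) ≤ 2 ^ (l + 4) := pow_le_pow_right₀ (by norm_num) (by omega)
      refine mul_le_mul (hTG _) ((hTG _).trans ?_) (by positivity) (by positivity)
      gcongr
  have hEsq : ∀ l, ∀ e ∈ E l, ∑ i, e i ^ 2 ≤ v l := by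
    intro l e he
    cases l with
    | zero =>
      obtain ⟨x, hx, rfl⟩ := Finset.mem_image.mp he
      have hx2 := hGmem 3 x.2 (Finset.mem_product.mp hx).2
      calc ∑ i, a x i ^ 2 ≤ ∑ _i : I, (2 * M) ^ 2 := by
            refine Finset.sum_le_sum fun i _ => ?_
            rw [← sq_abs]
            gcongr
            have := abs_sub (F x.1 x.2 (w i).1) (F x.1 x.2 (w i).2)
            have h1 := h.bound x.1 x.2 hx2 (w i).1
            have h2 := h.bound x.1 x.2 hx2 (w i).2
            simp only [ha, pairDiff]
            linarith
        _ = v 0 := by simp [hv, hn]; ring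
    | succ l => exact (Finset.mem_filter.mp he).2
  have hn0 : 0 < n := by linarith
  set J := 5 * Fintype.card I with hJ
  have hchain := card_chain_le {e | ∃ p ∈ Pol, ∃ α ∈ Set.Icc lo hi, e = pairDiff w (F p α)}
    J E v u M hv0 hu0 hEsq ?_
  · have hsum : ∑ l ∈ Finset.range J, u l + M ≤ M * √n * (64 * κ + 25 * D + 6 * g) := by
      have hsv : ∀ l, √(v l) = 2 * M * √n * (1 / 2) ^ l := by
        intro l
        rw [Real.sqrt_eq_iff_mul_self_eq_of_pos (by positivity)]
        simp only [hv]
        have : (1 / 4 : ℝ) ^ l = (1 / 2) ^ l * (1 / 2) ^ l := by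
          rw [← mul_pow]; norm_num
        rw [this]
        nlinarith [Real.mul_self_sqrt hn0.le]
      have h1 : ∑ l ∈ Finset.range J, u l = 2 * M * √n *
          (2 * ∑ l ∈ Finset.range J, (1 / 2 : ℝ) ^ l * √(Real.log (N (l + 3)))
            + (3 / 2 * g + 5 * D) * ∑ l ∈ Finset.range J, (1 / 2 : ℝ) ^ l
            + D * ∑ l ∈ Finset.range J, (1 / 2 : ℝ) ^ l * l) := by
        simp only [hu, hsv]
        rw [Finset.mul_sum, Finset.mul_sum, Finset.mul_sum, ← Finset.sum_add_distrib,
          ← Finset.sum_add_distrib, Finset.mul_sum]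
        exact Finset.sum_congr rfl fun l _ => by ring
      have h2 : ∑ l ∈ Finset.range J, (1 / 2 : ℝ) ^ l * √(Real.log (N (l + 3))) ≤ 16 * κ := by
        have h3 := sum_sqrt_log_maxCoveringNumber_le hκ (3 + J)
        rw [Finset.sum_range_add] at h3
        have h4 : 0 ≤ ∑ j ∈ Finset.range 3, (1 / 2 : ℝ) ^ (j + 1) *
          √(Real.log (maxCoveringNumber ((1 / 4) ^ j) Pol).toNat) :=
          Finset.sum_nonneg fun j _ => by positivity
        have h5 : ∑ l ∈ Finset.range J, (1 / 2 : ℝ) ^ l * √(Real.log (N (l + 3)))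
            = 16 * ∑ x ∈ Finset.range J, (1 / 2 : ℝ) ^ (3 + x + 1) *
              √(Real.log (maxCoveringNumber ((1 / 4) ^ (3 + x)) Pol).toNat) := by
          rw [Finset.mul_sum]
          refine Finset.sum_congr rfl fun l _ => ?_
          simp only [hN]
          rw [add_comm l 3, show 3 + l + 1 = l + 4 by ring, pow_add]
          ring
        rw [h5]
        linarith
      have h3 : ∑ l ∈ Finset.range J, (1 / 2 : ℝ) ^ l ≤ 2 := by
        rw [sum_range_half_pow]
        have : (0 : ℝ) ≤ (1 / 2) ^ J := by positivity
        linarith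
      have h4 : ∑ l ∈ Finset.range J, (1 / 2 : ℝ) ^ l * l ≤ 2 := by
        rw [sum_range_mul_half_pow]
        have : (0 : ℝ) ≤ 2 * (J + 1) * (1 / 2) ^ J := by positivity
        linarith
      have h5 : 1 ≤ √n := Real.one_le_sqrt.mpr hn1
      have hg0 : 0 ≤ g := Real.sqrt_nonneg _
      rw [h1]
      have h6 : 2 * ∑ l ∈ Finset.range J, (1 / 2 : ℝ) ^ l * √(Real.log (N (l + 3)))
            + (3 / 2 * g + 5 * D) * ∑ l ∈ Finset.range J, (1 / 2 : ℝ) ^ l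
            + D * ∑ l ∈ Finset.range J, (1 / 2 : ℝ) ^ l * l
          ≤ 2 * (16 * κ) + (3 / 2 * g + 5 * D) * 2 + D * 2 := by gcongr
      have h7 : M ≤ M * √n * D := by
        have : 1 ≤ √n * D := by nlinarith
        nlinarith
      have h8 : 0 < 2 * M * √n := by positivity
      have h9 := mul_le_mul_of_nonneg_left h6 h8.le
      linarith
    have hprob : ∑ l ∈ Finset.range J, ((E l).card : ℝ) * (2 * Real.exp (-u l ^ 2 / (2 * v l)))
        ≤ 2 * b := by
      calc _ ≤ ∑ l ∈ Finset.range J, b * (1 / 2) ^ l := by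
            refine Finset.sum_le_sum fun l _ => ?_
            refine (mul_le_mul_of_nonneg_right (hEcard l) (by positivity)).trans ?_
            exact chain_level_le (N (l + 3)) l hD1 hb hb1 (hv0 l) rfl
        _ ≤ 2 * b := by
            rw [← Finset.mul_sum, sum_range_half_pow]
            have : (0 : ℝ) ≤ (1 / 2) ^ J := by positivity
            nlinarith
    refine le_trans ?_ (hchain.trans (mul_le_mul_of_nonneg_right hprob (by positivity)))
    rw [Nat.cast_le]
    refine Finset.card_le_card fun ε hε => ?_
    obtain ⟨p, hp, α, hα, hlt⟩ := (Finset.mem_filter.mp hε).2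
    exact Finset.mem_filter.mpr ⟨Finset.mem_univ _, _, ⟨p, hp, α, hα, rfl⟩, hsum.trans_lt hlt⟩
  · rintro _ ⟨p, hp, α, hα, rfl⟩
    choose q hqT hqd using fun j => hT j p hp
    choose β hβG hβd using fun j => hG j α hα
    have hβm : ∀ j, β j ∈ Set.Icc lo hi := fun j => hGmem j _ (hβG j)
    refine ⟨fun l => Nat.casesOn l (a (q 3, β 3))
      (fun l => a (q (l + 4), β (l + 4)) - a (q (l + 3), β (l + 3))), ?_, ?_⟩
    · intro l
      cases l with
      | zero =>
        exact Finset.mem_image_of_mem a (Finset.mem_product.mpr ⟨hqT 3, hβG 3⟩)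
      | succ l =>
        refine Finset.mem_filter.mpr ⟨?_, ?_⟩
        · exact Finset.mem_image_of_mem
            (fun x : (Policy S A × ℝ) × (Policy S A × ℝ) => a x.1 - a x.2)
            (a := ((q (l + 4), β (l + 4)), (q (l + 3), β (l + 3))))
            (by simp [hqT, hβG])
        · have hx : 6 * L * |β (l + 4) - β (l + 3)| ≤ 3 * (1 / 2) ^ (l + 4) := by
            have h1 := hβd (l + 4)
            have h2 := hβd (l + 3)
            have h3 : |β (l + 4) - β (l + 3)|
                ≤ (1 / 2) ^ (l + 4) / (6 * L) + (1 / 2) ^ (l + 3) / (6 * L) := by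
              refine (_root_.abs_sub_le _ α _).trans ?_
              rw [abs_sub_comm (β (l + 4))]
              linarith
            have h4 := mul_le_mul_of_nonneg_left h3 (by positivity : 0 ≤ 6 * L)
            refine h4.trans (le_of_eq ?_)
            rw [mul_add, mul_div_cancel₀ _ (by positivity), mul_div_cancel₀ _ (by positivity)]
            rw [pow_succ (1 / 2 : ℝ) (l + 3)]
            ring
          refine (h.sum_pairDiff_sub_sq_le hM.le w (q (l + 4)) (q (l + 3)) (hβm _) (hβm _)
            hx).trans ?_
          have hd : ∑ i, (disagree (q (l + 4)) (q (l + 3)) (st (w i).1)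
                + disagree (q (l + 4)) (q (l + 3)) (st (w i).2))
              ≤ 2 * (1 / 4) ^ (l + 4) * n + 2 * (1 / 4) ^ (l + 3) * n := by
            refine le_trans ?_ (add_le_add (hqd (l + 4)) (hqd (l + 3)))
            rw [← Finset.sum_add_distrib]
            refine Finset.sum_le_sum fun i _ => ?_
            have h1 := disagree_triangle (q (l + 4)) p (q (l + 3)) (st (w i).1)
            have h2 := disagree_triangle (q (l + 4)) p (q (l + 3)) (st (w i).2)
            rw [disagree_comm (q (l + 4)) p] at h1 h2
            linarith
          have h4 : ((1 / 2 : ℝ) ^ (l + 4)) ^ 2 = (1 / 4) ^ (l + 4) := by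
            rw [← pow_mul, mul_comm, pow_mul]; norm_num
          calc M ^ 2 * (16 * ∑ i, (disagree (q (l + 4)) (q (l + 3)) (st (w i).1)
                + disagree (q (l + 4)) (q (l + 3)) (st (w i).2))
                + 2 * (3 * (1 / 2) ^ (l + 4)) ^ 2 * (Fintype.card I : ℝ))
              ≤ M ^ 2 * (16 * (2 * (1 / 4) ^ (l + 4) * n + 2 * (1 / 4) ^ (l + 3) * n)
                + 2 * (3 * (1 / 2) ^ (l + 4)) ^ 2 * n) := by gcongr
            _ = M ^ 2 * n * (1 / 4) ^ l * (178 / 256) := by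
                rw [mul_pow, h4, pow_add, pow_add]; ring
            _ ≤ M ^ 2 * n * (1 / 4) ^ l * 1 := by gcongr; norm_num
            _ = v (l + 1) := by simp only [hv]; rw [pow_succ]; ring
    · obtain ⟨J', hJ'⟩ : ∃ J', J = J' + 1 :=
        Nat.exists_eq_succ_of_ne_zero (by rw [hJ]; have := Fintype.card_ne_zero (α := I); omega)
      have htel : ∀ i, ∑ l ∈ Finset.range J, (Nat.casesOn (motive := fun _ => I → ℝ) l
            (a (q 3, β 3))
            (fun l => a (q (l + 4), β (l + 4)) - a (q (l + 3), β (l + 3)))) i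
          = a (q (J' + 3), β (J' + 3)) i := by
        intro i
        rw [hJ', Finset.sum_range_succ']
        have := Finset.sum_range_sub (fun l => a (q (l + 3), β (l + 3)) i) J'
        simp only [Pi.sub_apply]
        rw [show ∑ l ∈ Finset.range J', (a (q (l + 4), β (l + 4)) i - a (q (l + 3), β (l + 3)) i)
          = a (q (J' + 3), β (J' + 3)) i - a (q (0 + 3), β (0 + 3)) i from this]
        simp
      simp only [htel]
      have hx : 6 * L * |α - β (J' + 3)| ≤ (1 / 2) ^ (J' + 3) := by
        have := mul_le_mul_of_nonneg_left (hβd (J' + 3)) (by positivity : 0 ≤ 6 * L)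
        rwa [mul_div_cancel₀ _ (by positivity)] at this
      refine (h.sum_abs_pairDiff_sub_le hM.le w p (q (J' + 3)) hα (hβm _) hx).trans ?_
      have h1 := hqd (J' + 3)
      have h2 : (1 / 4 : ℝ) ^ (J' + 3) ≤ (1 / 2) ^ (J' + 3) := by gcongr; norm_num
      have h3 : (5 * n) * (1 / 2) ^ (J' + 3) ≤ 1 := by
        have h4 : (5 * n) ≤ 2 ^ (J' + 3) := by
          have h5 : J < 2 ^ J := Nat.lt_two_pow_self
          have h6 : (J : ℝ) ≤ 2 ^ J := by exact_mod_cast h5.le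
          have h7 : (2 : ℝ) ^ J ≤ 2 ^ (J' + 3) := pow_le_pow_right₀ (by norm_num) (by omega)
          have h8 : (J : ℝ) = 5 * n := by rw [hJ, hn]; push_cast; ring
          linarith
        rw [one_div, inv_pow, ← div_eq_mul_inv, div_le_one (by positivity)]
        exact h4
      have h5 : 2 * ∑ i, (disagree p (q (J' + 3)) (st (w i).1)
          + disagree p (q (J' + 3)) (st (w i).2)) + (1 / 2) ^ (J' + 3) * n ≤ 1 := by
        nlinarith
      calc M * (2 * ∑ i, (disagree p (q (J' + 3)) (st (w i).1)
          + disagree p (q (J' + 3)) (st (w i).2)) + (1 / 2) ^ (J' + 3) * n) ≤ M * 1 := by gcongr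
        _ = M := mul_one M

end Chaining

section UniformDeviation

variable {S A Z I : Type*} [MeasurableSpace S] [MeasurableSpace A] [MeasurableSpace Z] [Fintype I]
variable {F : Policy S A → ℝ → Z → ℝ} {st : Z → S} {lo hi M L : ℝ}

/-- Uniform deviation of a regular family over an i.i.d. sample, along a countable subfamily. -/
theorem IsRegularFamily.measure_deviation_le (h : IsRegularFamily F st lo hi M L)
    (hM : 0 < M) (hL : 0 < L) (hlo : lo ≤ hi) {D b : ℝ} (hD1 : 1 ≤ D) (hD : L * (hi - lo) ≤ D)
    (hb : 0 < b) (hb1 : b ≤ 1) {Pol : Set (Policy S A)} (hκ : entropyIntegral Pol ≠ ∞)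
    (P : Measure Z) [IsProbabilityMeasure P] {ι : Type*} [Countable ι] (p : ι → Policy S A)
    (α : ι → ℝ) (hp : ∀ j, p j ∈ Pol) (hα : ∀ j, α j ∈ Set.Icc lo hi)
    (hmeas : ∀ j, Measurable (F (p j) (α j))) :
    Measure.pi (fun _ : I => P) {z | ∃ j,
        M * √(Fintype.card I) * (128 * (entropyIntegral Pol).toReal + 50 * D
          + 12 * √(Real.log (1 / b)))
        < |∑ i, (F (p j) (α j) (z i) - ∫ y, F (p j) (α j) y ∂P)|} ≤ ENNReal.ofReal (4 * b) := by
  classical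
  have hκ0 : 0 ≤ (entropyIntegral Pol).toReal := ENNReal.toReal_nonneg
  have hg0 := Real.sqrt_nonneg (Real.log (1 / b))
  rcases isEmpty_or_nonempty I with hI | hI
  · have : {z : I → Z | ∃ j,
        M * √(Fintype.card I) * (128 * (entropyIntegral Pol).toReal + 50 * D
          + 12 * √(Real.log (1 / b)))
        < |∑ i, (F (p j) (α j) (z i) - ∫ y, F (p j) (α j) y ∂P)|} = ∅ := by
      ext z
      simp
    rw [this]
    simp
  · have hn1 : (1 : ℝ) ≤ Fintype.card I := by exact_mod_cast Fintype.card_pos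
    have hn0 : (0 : ℝ) < Fintype.card I := by linarith
    rw [show 4 * b = 2 * (2 * b) by ring]
    have hc : 50 ≤ 128 * (entropyIntegral Pol).toReal + 50 * D + 12 * √(Real.log (1 / b)) := by
      linarith
    refine measure_exists_deviation_le P (M := M) (F := fun j => F (p j) (α j)) hmeas
      (fun j z => h.bound _ _ (hα j) z) (by positivity) ?_ fun w => ?_
    · rw [mul_pow, mul_pow, Real.sq_sqrt hn0.le]
      have : (8 : ℝ) ≤ (128 * (entropyIntegral Pol).toReal + 50 * D
          + 12 * √(Real.log (1 / b))) ^ 2 := by nlinarith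
      have h2 : 0 < M ^ 2 * (Fintype.card I : ℝ) := by positivity
      nlinarith
    · refine le_trans ?_ (h.card_boolSign_le hM hL hlo hD1 hD hb hb1 hκ w)
      rw [Nat.cast_le]
      refine Finset.card_le_card fun ε hε => ?_
      obtain ⟨j, hj⟩ := (Finset.mem_filter.mp hε).2
      refine Finset.mem_filter.mpr ⟨Finset.mem_univ _, p j, hp j, α j, hα j, ?_⟩
      refine lt_of_eq_of_lt ?_ hj
      ring

end UniformDeviation

section Duality

variable {Ω : Type*} [MeasurableSpace Ω] {μ : Measure Ω} [IsProbabilityMeasure μ] {X : Ω → ℝ}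

/-- The Donsker–Varadhan lower bound for the mean over a Kullback–Leibler ball. -/
lemma neg_log_integral_exp_le_integral (hXm : AEMeasurable X μ)
    (hX : ∀ᵐ ω ∂μ, X ω ∈ Set.Icc (0 : ℝ) 1) {ν : Measure Ω} [IsProbabilityMeasure ν] (hν : ν ≪ μ)
    {δ α : ℝ} (hδ : 0 ≤ δ) (hkl : InformationTheory.klDiv ν μ ≤ ENNReal.ofReal δ) (hα : 0 < α) :
    -α * Real.log (∫ ω, Real.exp (-(X ω) / α) ∂μ) - α * δ ≤ ∫ ω, X ω ∂ν := by
  set f : Ω → ℝ := fun ω => -(X ω) / α with hf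
  have hne : InformationTheory.klDiv ν μ ≠ ∞ := ne_top_of_le_ne_top ENNReal.ofReal_ne_top hkl
  obtain ⟨-, hint⟩ := InformationTheory.klDiv_ne_top_iff.mp hne
  have hXν : Integrable X ν :=
    Integrable.of_mem_Icc 0 1 (hXm.mono_ac hν) (hν.ae_le hX)
  have hfν : Integrable f ν := hXν.neg.div_const α
  have hfμ : Integrable (fun ω => Real.exp (f ω)) μ := by
    have := integrable_exp_mul_of_mem_Icc (t := -1 / α) hXm hX
    refine this.congr (ae_of_all _ fun ω => ?_)
    simp only [hf]
    congr 1
    ring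
  have hac : ν ≪ μ.tilted f := hν.trans (absolutelyContinuous_tilted hfμ)
  have := isProbabilityMeasure_tilted hfμ
  have h1 := InformationTheory.toReal_klDiv_of_measure_eq hac (by simp)
  rw [integral_llr_tilted_right hν hfν hfμ hint] at h1
  have h2 := InformationTheory.toReal_klDiv_of_measure_eq hν (by simp)
  have h3 : (InformationTheory.klDiv ν μ).toReal ≤ δ := ENNReal.toReal_le_of_le_ofReal hδ hkl
  have h4 : ∫ ω, f ω ∂ν = -(∫ ω, X ω ∂ν) / α := by
    rw [hf, integral_div, integral_neg]
  have h5 : 0 ≤ (InformationTheory.klDiv ν (μ.tilted f)).toReal := ENNReal.toReal_nonneg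
  rw [h1, ← h2, h4] at h5
  have h6 : 0 ≤ α * (δ - -(∫ ω, X ω ∂ν) / α + Real.log (∫ ω, Real.exp (f ω) ∂μ)) :=
    mul_nonneg hα.le (by linarith)
  have h7 : α * (δ - -(∫ ω, X ω ∂ν) / α + Real.log (∫ ω, Real.exp (f ω) ∂μ))
      = α * δ + ∫ ω, X ω ∂ν + α * Real.log (∫ ω, Real.exp (f ω) ∂μ) := by
    field_simp
    ring
  rw [h7] at h6
  linarith

omit [IsProbabilityMeasure μ] in
lemma log_integral_exp_eq_cgf (α : ℝ) :
    Real.log (∫ ω, Real.exp (-(X ω) / α) ∂μ) = cgf X μ (-1 / α) := by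
  unfold cgf mgf
  congr 2
  ext ω
  congr 1
  ring

lemma mem_interior_integrableExpSet (hXm : AEMeasurable X μ)
    (hX : ∀ᵐ ω ∂μ, X ω ∈ Set.Icc (0 : ℝ) 1) (t : ℝ) : t ∈ interior (integrableExpSet X μ) := by
  have : integrableExpSet X μ = Set.univ :=
    Set.eq_univ_of_forall fun t => integrable_exp_mul_of_mem_Icc hXm hX
  simp [this]

lemma hasDerivAt_dual (hXm : AEMeasurable X μ) (hX : ∀ᵐ ω ∂μ, X ω ∈ Set.Icc (0 : ℝ) 1)
    (δ : ℝ) {α : ℝ} (hα : 0 < α) :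
    HasDerivAt (fun α => -α * Real.log (∫ ω, Real.exp (-(X ω) / α) ∂μ) - α * δ)
      (-cgf X μ (-1 / α) - (∫ ω, X ω ∂(μ.tilted (fun ω => -1 / α * X ω))) / α - δ) α := by
  have h1 := mem_interior_integrableExpSet hXm hX (-1 / α)
  have h2 : HasDerivAt (cgf X μ) (∫ ω, X ω ∂(μ.tilted (fun ω => -1 / α * X ω))) (-1 / α) := by
    rw [integral_tilted_mul_self h1]
    exact (analyticAt_cgf h1).differentiableAt.hasDerivAt
  have h3 : HasDerivAt (fun α : ℝ => -1 / α) (1 / α ^ 2) α := by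
    have := (hasDerivAt_inv hα.ne').const_mul (-1)
    simp only [div_eq_mul_inv]
    refine this.congr_deriv ?_
    ring
  simp_rw [log_integral_exp_eq_cgf]
  have h4 := h2.comp α h3
  have h5 := (((hasDerivAt_id α).neg).mul h4).sub ((hasDerivAt_id α).mul_const δ)
  refine h5.congr_deriv ?_
  simp only [id, Pi.neg_apply, Function.comp]
  field_simp
  ring

/-- At a maximizer of the dual objective, the exponentially tilted law attains the dual value. -/
lemma exists_worst_case (hXm : AEMeasurable X μ) (hX : ∀ᵐ ω ∂μ, X ω ∈ Set.Icc (0 : ℝ) 1)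
    {δ α : ℝ} (hα : 0 < α)
    (hmax : ∀ α' : ℝ, 0 < α' → -α' * Real.log (∫ ω, Real.exp (-(X ω) / α') ∂μ) - α' * δ
      ≤ -α * Real.log (∫ ω, Real.exp (-(X ω) / α) ∂μ) - α * δ) :
    ∃ ν : Measure Ω, IsProbabilityMeasure ν ∧ ν ≪ μ ∧
      InformationTheory.klDiv ν μ ≤ ENNReal.ofReal δ ∧
      -α * Real.log (∫ ω, Real.exp (-(X ω) / α) ∂μ) - α * δ = ∫ ω, X ω ∂ν := by
  set f : Ω → ℝ := fun ω => -1 / α * X ω with hf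
  have hloc : IsLocalMax (fun α => -α * Real.log (∫ ω, Real.exp (-(X ω) / α) ∂μ) - α * δ) α := by
    filter_upwards [lt_mem_nhds hα] with α' hα' using hmax α' hα'
  have hfoc := hloc.hasDerivAt_eq_zero (hasDerivAt_dual hXm hX δ hα)
  have hfμ : Integrable (fun ω => Real.exp (f ω)) μ := integrable_exp_mul_of_mem_Icc hXm hX
  have hac : μ.tilted f ≪ μ := tilted_absolutelyContinuous μ f
  have hprob := isProbabilityMeasure_tilted hfμ
  have hval : ∫ ω, X ω ∂(μ.tilted f) = -α * cgf X μ (-1 / α) - α * δ := by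
    have : α * (-cgf X μ (-1 / α) - (∫ ω, X ω ∂(μ.tilted f)) / α - δ) = 0 := by
      rw [hfoc, mul_zero]
    have h2 : α * (-cgf X μ (-1 / α) - (∫ ω, X ω ∂(μ.tilted f)) / α - δ)
      = -α * cgf X μ (-1 / α) - (∫ ω, X ω ∂(μ.tilted f)) - α * δ := by field_simp
    linarith
  have hXν : Integrable X (μ.tilted f) :=
    Integrable.of_mem_Icc 0 1 (hXm.mono_ac hac) (hac.ae_le hX)
  have hllr : llr (μ.tilted f) μ =ᵐ[μ.tilted f] fun ω => f ω - cgf X μ (-1 / α) :=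
    hac.ae_le (log_rnDeriv_tilted_left_self hfμ)
  have hint : Integrable (llr (μ.tilted f) μ) (μ.tilted f) :=
    ((hXν.const_mul _).sub (integrable_const _)).congr hllr.symm
  refine ⟨μ.tilted f, hprob, hac, ?_, ?_⟩
  · rw [InformationTheory.klDiv_of_ac_of_integrable hac hint]
    refine ENNReal.ofReal_le_ofReal (le_of_eq ?_)
    rw [integral_congr_ae hllr, integral_sub (hXν.const_mul _) (integrable_const _)]
    have h1 : ∫ ω, f ω ∂(μ.tilted f) = -1 / α * ∫ ω, X ω ∂(μ.tilted f) := integral_const_mul _ _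
    have h2 : ∫ _ω, cgf X μ (-1 / α) ∂(μ.tilted f) = cgf X μ (-1 / α) := by simp
    rw [h1, h2, hval, probReal_univ, probReal_univ]
    field_simp
    ring
  · rw [hval, log_integral_exp_eq_cgf]

end Duality

section Robust

variable {S A : Type*} [MeasurableSpace S] [MeasurableSpace A]

instance (P₀ : Env S A) [IsProbabilityMeasure P₀] (p : Policy S A) :
    IsProbabilityMeasure (jointLaw P₀ p) := by
  have := p.2
  unfold jointLaw
  infer_instance

lemma jointLaw_ae_of_ae {P₀ : Env S A} [IsProbabilityMeasure P₀] (p : Policy S A)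
    {q : S × (A → ℝ) → Prop} (h : ∀ᵐ x ∂P₀, q x) : ∀ᵐ x ∂jointLaw P₀ p, q x.1 := by
  have := p.2
  have h1 : (jointLaw P₀ p).map Prod.fst = P₀ := Measure.fst_compProd _ _
  rw [← h1] at h
  exact ae_of_ae_map measurable_fst.aemeasurable h

variable [Fintype A] [MeasurableSingletonClass A]

lemma measurable_chosenReward : Measurable (chosenReward : (S × (A → ℝ)) × A → ℝ) := by
  refine measurable_from_prod_countable_left fun a => ?_
  exact (measurable_pi_apply a).comp measurable_snd

variable {P₀ : Env S A} [IsProbabilityMeasure P₀]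

omit [Fintype A] [MeasurableSingletonClass A] in
lemma chosenReward_mem (hR : ∀ᵐ x ∂P₀, ∀ a, x.2 a ∈ Set.Icc (0 : ℝ) 1) (p : Policy S A) :
    ∀ᵐ x ∂jointLaw P₀ p, chosenReward x ∈ Set.Icc (0 : ℝ) 1 := by
  filter_upwards [jointLaw_ae_of_ae p hR] with x hx using hx x.2

lemma dualObj_le_robustValue (hR : ∀ᵐ x ∂P₀, ∀ a, x.2 a ∈ Set.Icc (0 : ℝ) 1) {δ : ℝ} (hδ : 0 ≤ δ)
    (p : Policy S A) {α : ℝ} (hα : 0 < α) : dualObj P₀ δ p α ≤ robustValue P₀ δ p := by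
  refine le_csInf ⟨_, jointLaw P₀ p, inferInstance, Measure.AbsolutelyContinuous.rfl, by simp,
    rfl⟩ ?_
  rintro _ ⟨P₁, hP₁, hac, hkl, rfl⟩
  exact neg_log_integral_exp_le_integral measurable_chosenReward.aemeasurable
    (chosenReward_mem hR p) hac hδ hkl hα

lemma robustValue_le_dualObj (hR : ∀ᵐ x ∂P₀, ∀ a, x.2 a ∈ Set.Icc (0 : ℝ) 1) {δ : ℝ} (hδ : 0 ≤ δ)
    (p : Policy S A) {α : ℝ} (hα : 0 < α)
    (hmax : ∀ α' : ℝ, 0 < α' → dualObj P₀ δ p α' ≤ dualObj P₀ δ p α) :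
    robustValue P₀ δ p ≤ dualObj P₀ δ p α := by
  obtain ⟨P₁, hP₁, hac, hkl, hval⟩ := exists_worst_case
    measurable_chosenReward.aemeasurable (chosenReward_mem hR p) hα hmax
  refine csInf_le ⟨dualObj P₀ δ p α, ?_⟩ ⟨P₁, hP₁, hac, hkl, hval⟩
  rintro _ ⟨P₂, hP₂, hac₂, hkl₂, rfl⟩
  exact neg_log_integral_exp_le_integral measurable_chosenReward.aemeasurable
    (chosenReward_mem hR p) hac₂ hδ hkl₂ hα

lemma integrable_exp_chosenReward (hR : ∀ᵐ x ∂P₀, ∀ a, x.2 a ∈ Set.Icc (0 : ℝ) 1)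
    (p : Policy S A) (α : ℝ) :
    Integrable (fun x => Real.exp (-(chosenReward x) / α)) (jointLaw P₀ p) := by
  refine (integrable_exp_mul_of_mem_Icc (t := -1 / α)
    measurable_chosenReward.aemeasurable (chosenReward_mem hR p)).congr (ae_of_all _ fun x => ?_)
  show Real.exp _ = Real.exp _
  congr 1
  ring

lemma W_le_one (hR : ∀ᵐ x ∂P₀, ∀ a, x.2 a ∈ Set.Icc (0 : ℝ) 1) (p : Policy S A) {α : ℝ}
    (hα : 0 < α) : W P₀ p α ≤ 1 := by
  have : W P₀ p α ≤ ∫ _x, (1 : ℝ) ∂jointLaw P₀ p := by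
    refine integral_mono_ae (integrable_exp_chosenReward hR p α) (integrable_const _) ?_
    filter_upwards [chosenReward_mem hR p] with x hx
    exact Real.exp_le_one_iff.mpr (div_nonpos_of_nonpos_of_nonneg (by linarith [hx.1]) hα.le)
  simpa using this

lemma exp_neg_le_W (hR : ∀ᵐ x ∂P₀, ∀ a, x.2 a ∈ Set.Icc (0 : ℝ) 1) (p : Policy S A) {α : ℝ}
    (hα : 0 < α) : Real.exp (-1 / α) ≤ W P₀ p α := by
  have : ∫ _x, Real.exp (-1 / α) ∂jointLaw P₀ p ≤ W P₀ p α := by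
    refine integral_mono_ae (integrable_const _) (integrable_exp_chosenReward hR p α) ?_
    filter_upwards [chosenReward_mem hR p] with x hx
    refine Real.exp_le_exp.mpr ?_
    gcongr
    exact hx.2
  simpa using this

lemma le_alphaUp_of_isMax (hR : ∀ᵐ x ∂P₀, ∀ a, x.2 a ∈ Set.Icc (0 : ℝ) 1) {δ : ℝ} (hδ : 0 < δ)
    (p : Policy S A) {α : ℝ} (hα : 0 < α)
    (hmax : ∀ α' : ℝ, 0 < α' → dualObj P₀ δ p α' ≤ dualObj P₀ δ p α) : α ≤ alphaUp δ := by
  have h0 : 0 ≤ dualObj P₀ δ p α := by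
    refine le_of_forall_pos_lt_add fun e he => ?_
    have h1 := hmax (e / (2 * δ)) (by positivity)
    have h2 : Real.log (W P₀ p (e / (2 * δ))) ≤ 0 :=
      Real.log_nonpos ((Real.exp_pos _).le.trans (exp_neg_le_W hR p (by positivity)))
        (W_le_one hR p (by positivity))
    have h3 : -(e / 2) ≤ dualObj P₀ δ p (e / (2 * δ)) := by
      unfold dualObj
      have h4 : e / (2 * δ) * δ = e / 2 := by field_simp
      have h5 : 0 < e / (2 * δ) := by positivity
      nlinarith
    linarith
  have h1 : -1 / α ≤ Real.log (W P₀ p α) := by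
    rw [Real.le_log_iff_exp_le ((Real.exp_pos _).trans_le (exp_neg_le_W hR p hα))]
    exact exp_neg_le_W hR p hα
  unfold dualObj at h0
  unfold alphaUp
  rw [le_div_iff₀ hδ]
  have h2 : α * (-1 / α) = -1 := by field_simp
  nlinarith

/-- When `α⋆(p)` is positive it is a maximizer of the dual objective, and at most `1/δ`. -/
lemma alphaStar_isMax (hR : ∀ᵐ x ∂P₀, ∀ a, x.2 a ∈ Set.Icc (0 : ℝ) 1) {δ : ℝ} (hδ : 0 < δ)
    (p : Policy S A) (h0 : 0 < alphaStar P₀ δ p) :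
    alphaStar P₀ δ p ≤ alphaUp δ ∧
      ∀ α' : ℝ, 0 < α' → dualObj P₀ δ p α' ≤ dualObj P₀ δ p (alphaStar P₀ δ p) := by
  set T := {α : ℝ | 0 < α ∧ ∀ α' : ℝ, 0 < α' → dualObj P₀ δ p α' ≤ dualObj P₀ δ p α} with hT
  have hne : T.Nonempty := by
    by_contra hcon
    rw [Set.not_nonempty_iff_eq_empty] at hcon
    have : alphaStar P₀ δ p = sSup T := rfl
    rw [hcon, Real.sSup_empty] at this
    exact h0.ne' this
  have hup : ∀ α ∈ T, α ≤ alphaUp δ := fun α hα => le_alphaUp_of_isMax hR hδ p hα.1 hα.2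
  refine ⟨csSup_le hne hup, fun α' hα' => ?_⟩
  obtain ⟨x, hxT, hx⟩ := mem_closure_iff_seq_limit.mp (csSup_mem_closure hne ⟨_, hup⟩)
  have hcont : ContinuousAt (dualObj P₀ δ p) (alphaStar P₀ δ p) :=
    (hasDerivAt_dual measurable_chosenReward.aemeasurable (chosenReward_mem hR p) δ
      h0).continuousAt
  exact ge_of_tendsto (hcont.tendsto.comp hx) (Eventually.of_forall fun n => (hxT n).2 α' hα')

omit [Fintype A] [MeasurableSingletonClass A] in
lemma alphaStar_nonneg (P₀ : Env S A) (δ : ℝ) (p : Policy S A) : 0 ≤ alphaStar P₀ δ p :=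
  Real.sSup_nonneg fun _ hα => hα.1.le

omit [Fintype A] [MeasurableSingletonClass A] in
lemma alphaLow_le_alphaStar (P₀ : Env S A) (δ : ℝ) {Pol : Set (Policy S A)} {p : Policy S A}
    (hp : p ∈ Pol) : alphaLow P₀ δ Pol ≤ alphaStar P₀ δ p :=
  csInf_le ⟨0, by rintro _ ⟨q, _, rfl⟩; exact alphaStar_nonneg P₀ δ q⟩ (Set.mem_image_of_mem _ hp)

end Robust

section Policies

variable {S A : Type*} [MeasurableSpace S] [MeasurableSpace A]

instance (p : Policy S A) : IsMarkovKernel p.1 := p.2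

lemma Policy.prob_nonneg (p : Policy S A) (s : S) (a : A) : 0 ≤ p.prob s a := measureReal_nonneg

lemma Policy.prob_le_one (p : Policy S A) (s : S) (a : A) : p.prob s a ≤ 1 := measureReal_le_one

lemma overlap_le_prob (π₀ : Policy S A) (s : S) (a : A) : overlap π₀ ≤ π₀.prob s a :=
  ciInf_le ⟨0, by rintro _ ⟨x, rfl⟩; exact π₀.prob_nonneg _ _⟩ (s, a)

variable [MeasurableSingletonClass A]

lemma Policy.measurable_prob (p : Policy S A) (a : A) : Measurable (fun s => p.prob s a) :=
  (Kernel.measurable_coe p.1 (measurableSet_singleton a)).ennreal_toReal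

variable [Fintype A]

lemma Policy.sum_prob (p : Policy S A) (s : S) : ∑ a, p.prob s a = 1 := by
  have h := integral_fintype (μ := p.1 s) (f := fun _ : A => (1 : ℝ)) (integrable_const _)
  simp only [integral_const, probReal_univ, smul_eq_mul, mul_one] at h
  exact h.symm

lemma Policy.sum_prob_mul_le (p : Policy S A) (s : S) {h : A → ℝ} {C : ℝ} (hC : ∀ a, h a ≤ C) :
    ∑ a, p.prob s a * h a ≤ C := by
  calc ∑ a, p.prob s a * h a ≤ ∑ a, p.prob s a * C :=
        Finset.sum_le_sum fun a _ => mul_le_mul_of_nonneg_left (hC a) (p.prob_nonneg s a)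
    _ = C := by rw [← Finset.sum_mul, p.sum_prob, one_mul]

lemma Policy.le_sum_prob_mul (p : Policy S A) (s : S) {h : A → ℝ} {C : ℝ} (hC : ∀ a, C ≤ h a) :
    C ≤ ∑ a, p.prob s a * h a := by
  calc C = ∑ a, p.prob s a * C := by rw [← Finset.sum_mul, p.sum_prob, one_mul]
    _ ≤ ∑ a, p.prob s a * h a :=
        Finset.sum_le_sum fun a _ => mul_le_mul_of_nonneg_left (hC a) (p.prob_nonneg s a)

lemma measurable_obs_of_section {h : S → A → ℝ} (hh : ∀ a, Measurable fun s => h s a) :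
    Measurable fun z : Obs S A => h z.1 z.2.1 := by
  have h1 : Measurable fun y : S × A => h y.1 y.2 := measurable_from_prod_countable_left hh
  exact h1.comp (measurable_fst.prodMk (measurable_fst.comp measurable_snd))

variable {P₀ : Env S A} [IsProbabilityMeasure P₀]

lemma integral_jointLaw (p : Policy S A) {g : (S × (A → ℝ)) × A → ℝ}
    (hg : Integrable g (jointLaw P₀ p)) :
    ∫ x, g x ∂jointLaw P₀ p = ∫ x, ∑ a, p.prob x.1 a * g (x, a) ∂P₀ := by
  unfold jointLaw at hg ⊢
  rw [Measure.integral_compProd hg]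
  refine integral_congr_ae (ae_of_all _ fun x => ?_)
  simp only [Kernel.prodMkRight_apply]
  rw [integral_fintype .of_finite]
  rfl

lemma measurable_toObs : Measurable
    (fun x : (S × (A → ℝ)) × A => ((x.1.1, x.2, chosenReward x) : Obs S A)) :=
  (measurable_fst.comp measurable_fst).prodMk (measurable_snd.prodMk measurable_chosenReward)

instance (π₀ : Policy S A) : IsProbabilityMeasure (obsLaw P₀ π₀) :=
  Measure.isProbabilityMeasure_map measurable_toObs.aemeasurable

lemma integral_obsLaw (π₀ : Policy S A) {k : Obs S A → ℝ} (hk : Measurable k) {C : ℝ}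
    (hC : ∀ z, |k z| ≤ C) :
    ∫ z, k z ∂obsLaw P₀ π₀ = ∫ x, ∑ a, π₀.prob x.1 a * k (x.1, a, x.2 a) ∂P₀ := by
  unfold obsLaw
  rw [integral_map measurable_toObs.aemeasurable hk.aestronglyMeasurable, integral_jointLaw]
  · rfl
  · exact Integrable.of_bound (hk.comp measurable_toObs).aestronglyMeasurable C
      (ae_of_all _ fun x => hC _)

lemma obsLaw_reward_mem (hR : ∀ᵐ x ∂P₀, ∀ a, x.2 a ∈ Set.Icc (0 : ℝ) 1) (π₀ : Policy S A) :
    ∀ᵐ z ∂obsLaw P₀ π₀, z.2.2 ∈ Set.Icc (0 : ℝ) 1 := by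
  unfold obsLaw
  rw [ae_map_iff measurable_toObs.aemeasurable]
  · exact chosenReward_mem hR π₀
  · exact (measurable_snd.comp measurable_snd) measurableSet_Icc

end Policies

/-- The exponential loss `exp(-r/α)` with the reward clamped to `[0, 1]`. -/
noncomputable def expLoss (r α : ℝ) : ℝ := Real.exp (-(max 0 (min r 1)) / α)

lemma expLoss_of_mem {r : ℝ} (hr : r ∈ Set.Icc (0 : ℝ) 1) (α : ℝ) :
    expLoss r α = Real.exp (-r / α) := by
  unfold expLoss
  rw [min_eq_left hr.2, max_eq_right hr.1]

lemma expLoss_nonneg (r α : ℝ) : 0 ≤ expLoss r α := (Real.exp_pos _).le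

lemma expLoss_le_one (r : ℝ) {α : ℝ} (hα : 0 < α) : expLoss r α ≤ 1 :=
  Real.exp_le_one_iff.mpr (div_nonpos_of_nonpos_of_nonneg (by simp) hα.le)

lemma measurable_expLoss (α : ℝ) : Measurable fun r => expLoss r α := by
  unfold expLoss
  fun_prop

section RewardLaw

lemma integrable_exp_neg_div {ν : Measure ℝ} [IsFiniteMeasure ν]
    (hν : ∀ᵐ r ∂ν, r ∈ Set.Icc (0 : ℝ) 1) {α : ℝ} (hα : 0 < α) :
    Integrable (fun r => Real.exp (-r / α)) ν := by
  refine Integrable.of_bound (by fun_prop) 1 ?_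
  filter_upwards [hν] with r hr
  rw [Real.norm_eq_abs, abs_of_pos (Real.exp_pos _)]
  exact Real.exp_le_one_iff.mpr (div_nonpos_of_nonpos_of_nonneg (by linarith [hr.1]) hα.le)

/-- A law on `[0, 1]` whose Lebesgue density is at least `ω` has a Laplace transform bounded
below. -/
lemma le_integral_exp_of_density {ν : Measure ℝ} [IsFiniteMeasure ν]
    (hν : ∀ᵐ r ∂ν, r ∈ Set.Icc (0 : ℝ) 1) {ω : ℝ} (hω : 0 < ω)
    (hd : ∀ᵐ r ∂(volume.restrict (Set.Icc (0 : ℝ) 1)), ENNReal.ofReal ω ≤ ν.rnDeriv volume r)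
    {α : ℝ} (hα : 0 < α) : ω * (min α 1 / 2) ≤ ∫ r, Real.exp (-r / α) ∂ν := by
  set m := min α 1 with hm
  have hm0 : 0 < m := lt_min hα one_pos
  have hle : ENNReal.ofReal ω • volume.restrict (Set.Icc (0 : ℝ) m) ≤ ν := by
    refine le_trans ?_ (Measure.withDensity_rnDeriv_le ν volume)
    rw [← withDensity_const, ← withDensity_indicator measurableSet_Icc]
    refine withDensity_mono ?_
    rw [ae_restrict_iff' measurableSet_Icc] at hd
    filter_upwards [hd] with r hr
    by_cases h : r ∈ Set.Icc 0 m
    · rw [Set.indicator_of_mem h]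
      exact hr ⟨h.1, h.2.trans (min_le_right _ _)⟩
    · rw [Set.indicator_of_notMem h]; exact zero_le
  refine le_trans ?_ (integral_mono_measure hle (ae_of_all _ fun r => (Real.exp_pos _).le)
    (integrable_exp_neg_div hν hα))
  rw [integral_smul_measure, ENNReal.toReal_ofReal hω.le, smul_eq_mul]
  refine mul_le_mul_of_nonneg_left ?_ hω.le
  rw [integral_Icc_eq_integral_Ioc, ← intervalIntegral.integral_of_le hm0.le]
  have h1 : ∫ r in (0 : ℝ)..m, (1 - r / α) = m - m ^ 2 / (2 * α) := by
    rw [intervalIntegral.integral_sub (by simp) (by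
      apply Continuous.intervalIntegrable; fun_prop)]
    rw [intervalIntegral.integral_div, integral_id, intervalIntegral.integral_const]
    simp
    field_simp
  have h2 : m / 2 ≤ m - m ^ 2 / (2 * α) := by
    have : m ^ 2 / (2 * α) ≤ m / 2 := by
      rw [div_le_div_iff₀ (by positivity) two_pos]
      nlinarith [min_le_left α 1]
    linarith
  refine h2.trans (h1.symm.le.trans ?_)
  refine intervalIntegral.integral_mono_on hm0.le
    (by apply Continuous.intervalIntegrable; fun_prop)
    (by apply Continuous.intervalIntegrable; fun_prop) fun r _ => ?_
  have := Real.add_one_le_exp (-r / α)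
  rw [neg_div] at this ⊢
  linarith

lemma le_integral_exp_of_atom {ν : Measure ℝ} [IsFiniteMeasure ν]
    (hν : ∀ᵐ r ∂ν, r ∈ Set.Icc (0 : ℝ) 1) {ω : ℝ}
    (hd : ENNReal.ofReal ω ≤ ν {0}) {α : ℝ} (hα : 0 < α) :
    ω ≤ ∫ r, Real.exp (-r / α) ∂ν := by
  have h1 := setIntegral_le_integral (s := {(0 : ℝ)}) (integrable_exp_neg_div hν hα)
    (ae_of_all _ fun r => (Real.exp_pos _).le)
  refine le_trans ?_ h1
  rw [integral_singleton]
  simp only [neg_zero, zero_div, Real.exp_zero, smul_eq_mul, mul_one]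
  exact (ENNReal.ofReal_le_iff_le_toReal (measure_ne_top _ _)).mp hd

end RewardLaw

section Population

variable {S A : Type*} [MeasurableSpace S] [MeasurableSpace A] [Fintype A]
  [MeasurableSingletonClass A] {P₀ : Env S A} [IsProbabilityMeasure P₀]

lemma W_eq_integral_sum (hR : ∀ᵐ x ∂P₀, ∀ a, x.2 a ∈ Set.Icc (0 : ℝ) 1) (p : Policy S A)
    (α : ℝ) :
    W P₀ p α = ∫ x, ∑ a, p.prob x.1 a * expLoss (x.2 a) α ∂P₀ := by
  unfold W
  rw [integral_jointLaw p (integrable_exp_chosenReward hR p α)]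
  refine integral_congr_ae ?_
  filter_upwards [hR] with x hx
  refine Finset.sum_congr rfl fun a _ => ?_
  rw [expLoss_of_mem (hx a)]
  rfl

omit [Fintype A] [MeasurableSingletonClass A] in
lemma fst_compProd_condDistrib_reward (a : A) :
    P₀.fst ⊗ₘ condDistrib (fun x : S × (A → ℝ) => x.2 a) (fun x => x.1) P₀
      = P₀.map fun x => (x.1, x.2 a) := by
  have hY : Measurable fun x : S × (A → ℝ) => x.2 a := (measurable_pi_apply a).comp measurable_snd
  have h : (P₀.map fun x => x.1) ⊗ₘ condDistrib (fun x : S × (A → ℝ) => x.2 a) (fun x => x.1) P₀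
      = P₀.map fun x => (x.1, x.2 a) := compProd_map_condDistrib hY.aemeasurable
  exact h

omit [Fintype A] [MeasurableSingletonClass A] in
lemma rewardLaw_mem (hR : ∀ᵐ x ∂P₀, ∀ a, x.2 a ∈ Set.Icc (0 : ℝ) 1) (a : A) :
    ∀ᵐ s ∂P₀.fst, ∀ᵐ r ∂rewardLaw P₀ a s, r ∈ Set.Icc (0 : ℝ) 1 := by
  have hY : Measurable fun x : S × (A → ℝ) => x.2 a := (measurable_pi_apply a).comp measurable_snd
  refine Measure.ae_ae_of_ae_compProd (μ := P₀.fst) (κ := condDistrib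
    (fun x : S × (A → ℝ) => x.2 a) (fun x => x.1) P₀) (p := fun y => y.2 ∈ Set.Icc (0 : ℝ) 1) ?_
  rw [fst_compProd_condDistrib_reward, ae_map_iff
    (measurable_fst.prodMk hY).aemeasurable (measurable_snd measurableSet_Icc)]
  filter_upwards [hR] with x hx using hx a

omit [Fintype A] in
lemma integral_prob_mul_expLoss (p : Policy S A) (a : A) {α : ℝ} (hα : 0 < α) :
    ∫ x, p.prob x.1 a * expLoss (x.2 a) α ∂P₀
      = ∫ s, p.prob s a * ∫ r, expLoss r α ∂rewardLaw P₀ a s ∂P₀.fst := by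
  have hY : Measurable fun x : S × (A → ℝ) => x.2 a := (measurable_pi_apply a).comp measurable_snd
  have hg : Measurable fun y : S × ℝ => p.prob y.1 a * expLoss y.2 α :=
    ((p.measurable_prob a).comp measurable_fst).mul ((measurable_expLoss α).comp measurable_snd)
  have h1 : ∫ x, p.prob x.1 a * expLoss (x.2 a) α ∂P₀
      = ∫ y, p.prob y.1 a * expLoss y.2 α ∂(P₀.map fun x => (x.1, x.2 a)) :=
    (integral_map (measurable_fst.prodMk hY).aemeasurable hg.aestronglyMeasurable).symm
  rw [h1, ← fst_compProd_condDistrib_reward, Measure.integral_compProd]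
  · simp_rw [integral_const_mul]
    rfl
  · rw [fst_compProd_condDistrib_reward]
    refine Integrable.of_bound hg.aestronglyMeasurable 1 (ae_of_all _ fun y => ?_)
    rw [Real.norm_eq_abs, abs_of_nonneg (mul_nonneg (p.prob_nonneg _ _) (expLoss_nonneg _ _))]
    exact mul_le_one₀ (p.prob_le_one _ _) (expLoss_nonneg _ _) (expLoss_le_one _ hα)

lemma Wlow_pos {ω αlow : ℝ} (hω : 0 < ω) (hα : 0 < αlow) (kind : RewardKind) :
    0 < Wlow ω αlow kind := by
  cases kind
  · have := lt_min hα one_pos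
    simp only [Wlow]
    positivity
  · exact hω

/-- The lower bound `W̲ ≤ W(p, α)` for `α ≥ α̲`. -/
theorem Wlow_le_W (hR : ∀ᵐ x ∂P₀, ∀ a, x.2 a ∈ Set.Icc (0 : ℝ) 1) {ω : ℝ} (hω : 0 < ω)
    {kind : RewardKind} (hreward : RewardLowerBound P₀ ω kind) {αlow α : ℝ} (hlow : 0 < αlow)
    (hα : αlow ≤ α) (p : Policy S A) : Wlow ω αlow kind ≤ W P₀ p α := by
  have hα0 : 0 < α := hlow.trans_le hα
  have hkey : ∀ᵐ s ∂P₀.fst, ∀ a, Wlow ω αlow kind ≤ ∫ r, expLoss r α ∂rewardLaw P₀ a s := by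
    have hmem := ae_all_iff.mpr fun a => rewardLaw_mem hR a
    have hprob : ∀ a s, IsProbabilityMeasure (rewardLaw P₀ a s) := fun a s => by
      unfold rewardLaw; infer_instance
    cases kind with
    | continuous =>
      filter_upwards [hmem, hreward] with s hs hrew a
      have := hprob a s
      have h1 := le_integral_exp_of_density (hs a) hω (hrew a).2 hα0
      have h2 : ω * (min αlow 1 / 2) ≤ ω * (min α 1 / 2) := by gcongr
      refine h2.trans (h1.trans (le_of_eq (integral_congr_ae ?_)))
      filter_upwards [hs a] with r hr using (expLoss_of_mem hr α).symm
    | discrete =>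
      obtain ⟨D, -, -, h0, hD⟩ := hreward
      filter_upwards [hmem, hD] with s hs hrew a
      have := hprob a s
      have h1 := le_integral_exp_of_atom (hs a) ((hrew a).2 0 h0) hα0
      refine h1.trans (le_of_eq (integral_congr_ae ?_))
      filter_upwards [hs a] with r hr using (expLoss_of_mem hr α).symm
  have hmeas : ∀ a, AEStronglyMeasurable
      (fun s => p.prob s a * ∫ r, expLoss r α ∂rewardLaw P₀ a s) P₀.fst := by
    intro a
    refine ((p.measurable_prob a).stronglyMeasurable.mul ?_).aestronglyMeasurable
    exact StronglyMeasurable.integral_condDistrib (f := fun y : S × ℝ => expLoss y.2 α)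
      ((measurable_expLoss α).comp measurable_snd).stronglyMeasurable
  have hle1 : ∀ a s, |∫ r, expLoss r α ∂rewardLaw P₀ a s| ≤ 1 := by
    intro a s
    have : IsProbabilityMeasure (rewardLaw P₀ a s) := by unfold rewardLaw; infer_instance
    have := norm_integral_le_of_norm_le_const (μ := rewardLaw P₀ a s) (C := 1)
      (f := fun r => expLoss r α) (ae_of_all _ fun r => by
        rw [Real.norm_eq_abs, abs_of_nonneg (expLoss_nonneg _ _)]; exact expLoss_le_one _ hα0)
    simpa using this
  have hint : ∀ a, Integrable
      (fun s => p.prob s a * ∫ r, expLoss r α ∂rewardLaw P₀ a s) P₀.fst := by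
    intro a
    refine Integrable.of_bound (hmeas a) 1 (ae_of_all _ fun s => ?_)
    rw [norm_mul, Real.norm_eq_abs, Real.norm_eq_abs, abs_of_nonneg (p.prob_nonneg _ _)]
    exact mul_le_one₀ (p.prob_le_one _ _) (abs_nonneg _) (hle1 a s)
  have hint0 : ∀ a, Integrable (fun x : S × (A → ℝ) => p.prob x.1 a * expLoss (x.2 a) α) P₀ := by
    intro a
    refine Integrable.of_bound (((p.measurable_prob a).comp measurable_fst).mul
      ((measurable_expLoss α).comp
        ((measurable_pi_apply a).comp measurable_snd))).aestronglyMeasurable 1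
      (ae_of_all _ fun x => ?_)
    rw [Real.norm_eq_abs, abs_of_nonneg (mul_nonneg (p.prob_nonneg _ _) (expLoss_nonneg _ _))]
    exact mul_le_one₀ (p.prob_le_one _ _) (expLoss_nonneg _ _) (expLoss_le_one _ hα0)
  rw [W_eq_integral_sum hR, integral_finsetSum _ fun a _ => hint0 a]
  simp_rw [fun a => integral_prob_mul_expLoss (P₀ := P₀) p a hα0]
  rw [← integral_finsetSum _ fun a _ => hint a]
  have h1 : ∫ _s, Wlow ω αlow kind ∂P₀.fst
      ≤ ∫ s, ∑ a, p.prob s a * ∫ r, expLoss r α ∂rewardLaw P₀ a s ∂P₀.fst := by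
    refine integral_mono_ae (integrable_const _) (integrable_finsetSum _ fun a _ => hint a) ?_
    filter_upwards [hkey] with s hs using p.le_sum_prob_mul s hs
  simpa using h1

end Population

section DoublyRobust

variable {S A : Type*} [MeasurableSpace S] [MeasurableSpace A] [Fintype A]

/-- The doubly robust score with nuisances `q` and `f`. -/
noncomputable def drScore (q : S → A → ℝ) (f : S → A → ℝ → ℝ) (p : Policy S A) (α : ℝ)
    (z : Obs S A) : ℝ :=
  p.prob z.1 z.2.1 / q z.1 z.2.1 * (expLoss z.2.2 α - f z.1 z.2.1 α)
    + ∑ a, p.prob z.1 a * f z.1 a α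

lemma drScore_local (q : S → A → ℝ) (f : S → A → ℝ → ℝ) {p p' : Policy S A} (α : ℝ)
    {z : Obs S A} (h : p.1 z.1 = p'.1 z.1) : drScore q f p α z = drScore q f p' α z := by
  have : ∀ a, p.prob z.1 a = p'.prob z.1 a := fun a => by unfold Policy.prob; rw [h]
  simp only [drScore, this]

variable [MeasurableSingletonClass A]

lemma measurable_drScore {q : S → A → ℝ} {f : S → A → ℝ → ℝ} (hq : ∀ a, Measurable fun s => q s a)
    {α : ℝ} (hf : ∀ a, Measurable fun s => f s a α) (p : Policy S A) :
    Measurable (drScore q f p α) := by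
  unfold drScore
  refine Measurable.add (Measurable.mul (Measurable.div ?_ ?_) (Measurable.sub ?_ ?_)) ?_
  · exact measurable_obs_of_section p.measurable_prob
  · exact measurable_obs_of_section hq
  · exact (measurable_expLoss α).comp (measurable_snd.comp measurable_snd)
  · exact measurable_obs_of_section (h := fun s a => f s a α) hf
  · exact Finset.measurable_sum _ fun a _ =>
      (((p.measurable_prob a).mul (hf a)).comp measurable_fst)

lemma abs_drScore_le {q : S → A → ℝ} {f : S → A → ℝ → ℝ} {η α : ℝ} (hη : 0 < η)
    (hq : ∀ s a, q s a ∈ Set.Icc η 1) (hα : 0 < α) (hf : ∀ s a, f s a α ∈ Set.Ioc (0 : ℝ) 1)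
    (p : Policy S A) (z : Obs S A) : |drScore q f p α z| ≤ 1 / η := by
  classical
  set a := z.2.1
  set s := z.1
  have hq0 := hη.trans_le (hq s a).1
  have hη1 : 1 ≤ 1 / η := by
    rw [le_div_iff₀ hη]; linarith [(hq s a).1, (hq s a).2]
  have hqη : 1 / q s a ≤ 1 / η := one_div_le_one_div_of_le hη (hq s a).1
  have he0 := expLoss_nonneg z.2.2 α
  have he1 := expLoss_le_one z.2.2 hα
  have hp0 := p.prob_nonneg s a
  have hsum : p.prob s a * f s a α ≤ ∑ a, p.prob s a * f s a α :=
    Finset.single_le_sum (f := fun a => p.prob s a * f s a α)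
      (fun b _ => mul_nonneg (p.prob_nonneg s b) (hf s b).1.le) (Finset.mem_univ a)
  have hsum2 : ∑ b, p.prob s b * f s b α ≤ p.prob s a * f s a α + (1 - p.prob s a) := by
    have h1 := p.sum_prob s
    rw [← Finset.add_sum_erase _ _ (Finset.mem_univ a)] at h1 ⊢
    have h2 : ∑ b ∈ Finset.univ.erase a, p.prob s b * f s b α
        ≤ ∑ b ∈ Finset.univ.erase a, p.prob s b :=
      Finset.sum_le_sum fun b _ => mul_le_of_le_one_right (p.prob_nonneg s b) (hf s b).2
    linarith
  have hd : drScore q f p α z = p.prob s a * (1 / q s a) * (expLoss z.2.2 α - f s a α)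
      + ∑ b, p.prob s b * f s b α := by
    unfold drScore
    ring
  have hf0 := (hf s a).1
  have hf1 := (hf s a).2
  have hp1 := p.prob_le_one s a
  have hc0 : 0 ≤ 1 / q s a := by positivity
  rw [hd, abs_le]
  constructor
  · have h1 : -(p.prob s a * (1 / q s a)) ≤
        p.prob s a * (1 / q s a) * (expLoss z.2.2 α - f s a α) := by
      nlinarith [mul_nonneg hp0 hc0]
    have h2 : p.prob s a * (1 / q s a) ≤ 1 / η := by nlinarith
    nlinarith [mul_nonneg hp0 hf0.le]
  · have h1 : p.prob s a * (1 / q s a) * (expLoss z.2.2 α - f s a α)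
        ≤ p.prob s a * (1 / q s a) * (1 - f s a α) := by
      have := mul_nonneg hp0 hc0
      gcongr
    have h2 : p.prob s a * (1 / q s a) * (1 - f s a α)
        ≤ p.prob s a * (1 / η) * (1 - f s a α) := by
      have : 0 ≤ 1 - f s a α := by linarith
      gcongr
    have h3 : p.prob s a * (1 / η) * (1 - f s a α) + p.prob s a * f s a α
        ≤ p.prob s a * (1 / η) := by
      nlinarith [mul_nonneg (mul_nonneg hp0 hf0.le) (by linarith : 0 ≤ 1 / η - 1)]
    nlinarith

lemma abs_expLoss_sub_le (r : ℝ) {lo α α' : ℝ} (hlo : 0 < lo) (hα : lo ≤ α) (hα' : lo ≤ α') :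
    |expLoss r α - expLoss r α'| ≤ 1 / lo ^ 2 * |α - α'| := by
  set x := max 0 (min r 1) with hx
  have hx0 : 0 ≤ x := le_max_left _ _
  have hx1 : x ≤ 1 := max_le zero_le_one (min_le_right _ _)
  have hderiv : ∀ y ∈ Set.Ici lo, HasDerivWithinAt (fun α => Real.exp (-x / α))
      (Real.exp (-x / y) * (x / y ^ 2)) (Set.Ici lo) y := by
    intro y hy
    have hy0 : 0 < y := hlo.trans_le hy
    have h1 : HasDerivAt (fun α : ℝ => -x / α) (x / y ^ 2) y := by
      have := (hasDerivAt_inv hy0.ne').const_mul (-x)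
      simp only [div_eq_mul_inv]
      refine this.congr_deriv ?_
      ring
    exact h1.exp.hasDerivWithinAt
  have hbd : ∀ y ∈ Set.Ici lo, ‖Real.exp (-x / y) * (x / y ^ 2)‖ ≤ 1 / lo ^ 2 := by
    intro y hy
    have hy0 : 0 < y := hlo.trans_le hy
    rw [Real.norm_eq_abs, abs_of_nonneg (by positivity)]
    have h1 : Real.exp (-x / y) ≤ 1 :=
      Real.exp_le_one_iff.mpr (div_nonpos_of_nonpos_of_nonneg (by linarith) hy0.le)
    have h2 : x / y ^ 2 ≤ 1 / lo ^ 2 := by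
      have : lo ≤ y := hy
      gcongr
    calc Real.exp (-x / y) * (x / y ^ 2) ≤ 1 * (1 / lo ^ 2) := by gcongr
      _ = _ := one_mul _
  have := (convex_Ici lo).norm_image_sub_le_of_norm_hasDerivWithin_le hderiv hbd
    (Set.mem_Ici.mpr hα') (Set.mem_Ici.mpr hα)
  exact this

/-- The doubly robust scores form a regular family. -/
lemma isRegularFamily_drScore {q : S → A → ℝ} {f : S → A → ℝ → ℝ} {η lo hi : ℝ} (hη : 0 < η)
    (hlo : 0 < lo) (hq : ∀ s a, q s a ∈ Set.Icc η 1)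
    (hf : ∀ s a, ∀ α ∈ Set.Icc lo hi, f s a α ∈ Set.Ioc (0 : ℝ) 1)
    (hLip : ∀ s a, ∀ α ∈ Set.Icc lo hi, ∀ α' ∈ Set.Icc lo hi,
      |f s a α - f s a α'| ≤ 1 / lo ^ 2 * |α - α'|) :
    IsRegularFamily (drScore q f) Prod.fst lo hi (1 / η) (1 / lo ^ 2) where
  bound p α hα z := abs_drScore_le hη hq (hlo.trans_le hα.1) (fun s a => hf s a α hα) p z
  local_policy p p' α _ z h := drScore_local q f α h
  lipschitz p α hα α' hα' z := by
    set a := z.2.1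
    set s := z.1
    set l := 1 / lo ^ 2 * |α - α'| with hl
    have hl0 : 0 ≤ l := by positivity
    have hq0 := hη.trans_le (hq s a).1
    have hη1 : 1 ≤ 1 / η := by
      rw [le_div_iff₀ hη]; linarith [(hq s a).1, (hq s a).2]
    have hqη : p.prob s a / q s a ≤ 1 / η := by
      have := p.prob_le_one s a
      have := (hq s a).1
      gcongr
    have hc0 : 0 ≤ p.prob s a / q s a := div_nonneg (p.prob_nonneg s a) hq0.le
    have hd : drScore q f p α z - drScore q f p α' z
        = p.prob s a / q s a * ((expLoss z.2.2 α - expLoss z.2.2 α') - (f s a α - f s a α'))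
          + ∑ b, p.prob s b * (f s b α - f s b α') := by
      simp only [mul_sub, Finset.sum_sub_distrib, drScore]
      ring
    have h1 : |p.prob s a / q s a * ((expLoss z.2.2 α - expLoss z.2.2 α') - (f s a α - f s a α'))|
        ≤ 1 / η * (l + l) := by
      rw [abs_mul, abs_of_nonneg hc0]
      refine mul_le_mul hqη ((abs_sub _ _).trans (add_le_add ?_ ?_)) (abs_nonneg _) (by positivity)
      · exact abs_expLoss_sub_le _ hlo hα.1 hα'.1
      · exact hLip s a α hα α' hα'
    have h2 : |∑ b, p.prob s b * (f s b α - f s b α')| ≤ l := by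
      refine (Finset.abs_sum_le_sum_abs _ _).trans ?_
      simp_rw [abs_mul, abs_of_nonneg (p.prob_nonneg s _)]
      exact p.sum_prob_mul_le s fun b => hLip s b α hα α' hα'
    rw [hd]
    refine (abs_add_le _ _).trans ?_
    have h3 : l ≤ 1 / η * l := by nlinarith
    calc _ ≤ 1 / η * (l + l) + l := add_le_add h1 h2
      _ ≤ 3 * (1 / η) * (1 / lo ^ 2) * |α - α'| := by rw [hl] at h3 ⊢; linarith

variable {P₀ : Env S A} [IsProbabilityMeasure P₀]

omit [Fintype A] [MeasurableSingletonClass A] in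
lemma obsLaw_compProd_condDistrib (π₀ : Policy S A) :
    ((obsLaw P₀ π₀).map fun z => (z.1, z.2.1)) ⊗ₘ
        condDistrib (fun z : Obs S A => z.2.2) (fun z => (z.1, z.2.1)) (obsLaw P₀ π₀)
      = (obsLaw P₀ π₀).map fun z => ((z.1, z.2.1), z.2.2) :=
  compProd_map_condDistrib (measurable_snd.comp measurable_snd).aemeasurable

lemma f₀_eq (hR : ∀ᵐ x ∂P₀, ∀ a, x.2 a ∈ Set.Icc (0 : ℝ) 1) (π₀ : Policy S A) :
    ∀ᵐ z ∂obsLaw P₀ π₀, ∀ α, f₀ P₀ π₀ z.1 z.2.1 α = ∫ r, expLoss r α ∂(condDistrib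
      (fun z : Obs S A => z.2.2) (fun z => (z.1, z.2.1)) (obsLaw P₀ π₀) (z.1, z.2.1)) := by
  have hX : Measurable fun z : Obs S A => (z.1, z.2.1) :=
    measurable_fst.prodMk (measurable_fst.comp measurable_snd)
  have hY : Measurable fun z : Obs S A => z.2.2 := measurable_snd.comp measurable_snd
  have h1 : ∀ᵐ y ∂((obsLaw P₀ π₀).map fun z => (z.1, z.2.1)), ∀ᵐ r ∂(condDistrib
      (fun z : Obs S A => z.2.2) (fun z => (z.1, z.2.1)) (obsLaw P₀ π₀) y),
      r ∈ Set.Icc (0 : ℝ) 1 := by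
    refine Measure.ae_ae_of_ae_compProd (p := fun y => y.2 ∈ Set.Icc (0 : ℝ) 1) ?_
    rw [obsLaw_compProd_condDistrib, ae_map_iff (hX.prodMk hY).aemeasurable
      (measurable_snd measurableSet_Icc)]
    exact obsLaw_reward_mem hR π₀
  filter_upwards [ae_of_ae_map hX.aemeasurable h1] with z hz α
  unfold f₀
  refine integral_congr_ae ?_
  filter_upwards [hz] with r hr using (expLoss_of_mem hr α).symm

lemma f₀_mem (hR : ∀ᵐ x ∂P₀, ∀ a, x.2 a ∈ Set.Icc (0 : ℝ) 1) (π₀ : Policy S A) :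
    ∀ᵐ z ∂obsLaw P₀ π₀, ∀ α, 0 < α → f₀ P₀ π₀ z.1 z.2.1 α ∈ Set.Icc (0 : ℝ) 1 := by
  filter_upwards [f₀_eq hR π₀] with z hz α hα
  rw [hz α]
  refine ⟨integral_nonneg fun r => expLoss_nonneg r α, ?_⟩
  have := norm_integral_le_of_norm_le_const (C := 1) (μ := condDistrib
      (fun z : Obs S A => z.2.2) (fun z => (z.1, z.2.1)) (obsLaw P₀ π₀) (z.1, z.2.1))
      (f := fun r => expLoss r α) (ae_of_all _ fun r => by
        rw [Real.norm_eq_abs, abs_of_nonneg (expLoss_nonneg _ _)]; exact expLoss_le_one _ hα)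
  simp only [probReal_univ, mul_one] at this
  exact (le_abs_self _).trans this

omit [Fintype A] [MeasurableSingletonClass A] in
lemma stronglyMeasurable_f₀ (π₀ : Policy S A) (α : ℝ) :
    StronglyMeasurable (fun z : Obs S A => f₀ P₀ π₀ z.1 z.2.1 α) := by
  have hX : Measurable fun z : Obs S A => (z.1, z.2.1) :=
    measurable_fst.prodMk (measurable_fst.comp measurable_snd)
  have h1 : StronglyMeasurable fun y : S × A => f₀ P₀ π₀ y.1 y.2 α :=
    StronglyMeasurable.integral_condDistrib (f := fun y : (S × A) × ℝ => Real.exp (-y.2 / α))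
      (by fun_prop : Measurable fun y : (S × A) × ℝ => Real.exp (-y.2 / α)).stronglyMeasurable
  exact h1.comp_measurable hX

lemma integral_mul_expLoss_eq (hR : ∀ᵐ x ∂P₀, ∀ a, x.2 a ∈ Set.Icc (0 : ℝ) 1) (π₀ : Policy S A)
    {c : S → A → ℝ} (hc : ∀ a, Measurable fun s => c s a) {C α : ℝ} (hC : ∀ s a, |c s a| ≤ C)
    (hα : 0 < α) :
    ∫ z, c z.1 z.2.1 * expLoss z.2.2 α ∂obsLaw P₀ π₀
      = ∫ z, c z.1 z.2.1 * f₀ P₀ π₀ z.1 z.2.1 α ∂obsLaw P₀ π₀ := by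
  have hX : Measurable fun z : Obs S A => (z.1, z.2.1) :=
    measurable_fst.prodMk (measurable_fst.comp measurable_snd)
  have hY : Measurable fun z : Obs S A => z.2.2 := measurable_snd.comp measurable_snd
  have hc' : Measurable fun y : S × A => c y.1 y.2 := measurable_from_prod_countable_left hc
  have hg : Measurable fun y : (S × A) × ℝ => c y.1.1 y.1.2 * expLoss y.2 α :=
    (hc'.comp measurable_fst).mul ((measurable_expLoss α).comp measurable_snd)
  have h1 : ∫ z, c z.1 z.2.1 * expLoss z.2.2 α ∂obsLaw P₀ π₀
      = ∫ y, c y.1.1 y.1.2 * expLoss y.2 α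
        ∂((obsLaw P₀ π₀).map fun z => ((z.1, z.2.1), z.2.2)) :=
    (integral_map (hX.prodMk hY).aemeasurable hg.aestronglyMeasurable).symm
  rw [h1, ← obsLaw_compProd_condDistrib, Measure.integral_compProd]
  · simp_rw [integral_const_mul]
    rw [integral_map hX.aemeasurable]
    · refine integral_congr_ae ?_
      filter_upwards [f₀_eq hR π₀] with z hz
      rw [hz α]
    · refine (hc'.stronglyMeasurable.mul ?_).aestronglyMeasurable
      exact StronglyMeasurable.integral_condDistrib (f := fun y : (S × A) × ℝ => expLoss y.2 α)
        ((measurable_expLoss α).comp measurable_snd).stronglyMeasurable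
  · rw [obsLaw_compProd_condDistrib]
    refine Integrable.of_bound hg.aestronglyMeasurable C (ae_of_all _ fun y => ?_)
    rw [norm_mul, Real.norm_eq_abs, Real.norm_eq_abs, abs_of_nonneg (expLoss_nonneg _ _)]
    exact (mul_le_of_le_one_right (abs_nonneg _) (expLoss_le_one _ hα)).trans (hC _ _)

end DoublyRobust

section Bias

variable {S A : Type*} [MeasurableSpace S] [MeasurableSpace A] [Fintype A]
  [MeasurableSingletonClass A] {P₀ : Env S A} [IsProbabilityMeasure P₀]

lemma sum_prob_mul_drScore {q : S → A → ℝ} {f : S → A → ℝ → ℝ} {π₀ : Policy S A}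
    (hπ : ∀ s a, 0 < π₀.prob s a) (p : Policy S A) (α : ℝ) (s : S) (r : A → ℝ) :
    ∑ a, π₀.prob s a * drScore q f p α (s, a, r a)
      = ∑ a, p.prob s a * expLoss (r a) α
        + ∑ a, π₀.prob s a * (p.prob s a * (1 / q s a - 1 / π₀.prob s a)
          * (expLoss (r a) α - f s a α)) := by
  have h1 : ∑ a, π₀.prob s a * drScore q f p α (s, a, r a)
      = ∑ a, π₀.prob s a * (p.prob s a / q s a * (expLoss (r a) α - f s a α))
        + ∑ a, p.prob s a * f s a α := by
    simp only [drScore, mul_add, Finset.sum_add_distrib]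
    rw [← Finset.sum_mul, π₀.sum_prob, one_mul]
  rw [h1, ← Finset.sum_add_distrib, ← Finset.sum_add_distrib]
  refine Finset.sum_congr rfl fun a _ => ?_
  have := (hπ s a).ne'
  have h2 : π₀.prob s a * (p.prob s a * (1 / π₀.prob s a) * (expLoss (r a) α - f s a α))
      = p.prob s a * (expLoss (r a) α - f s a α) := by field_simp
  linear_combination h2

/-- The error of the mean doubly robust score as a product of nuisance errors. -/
lemma integral_drScore_sub_W (hR : ∀ᵐ x ∂P₀, ∀ a, x.2 a ∈ Set.Icc (0 : ℝ) 1) {π₀ : Policy S A}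
    (hη : 0 < overlap π₀) {q : S → A → ℝ} {f : S → A → ℝ → ℝ}
    (hqm : ∀ a, Measurable fun s => q s a) (hq : ∀ s a, q s a ∈ Set.Icc (overlap π₀) 1) {α : ℝ}
    (hα : 0 < α) (hfm : ∀ a, Measurable fun s => f s a α)
    (hf : ∀ s a, f s a α ∈ Set.Ioc (0 : ℝ) 1) (p : Policy S A) :
    ∫ z, drScore q f p α z ∂obsLaw P₀ π₀ - W P₀ p α
      = ∫ z, p.prob z.1 z.2.1 * (1 / q z.1 z.2.1 - 1 / π₀.prob z.1 z.2.1)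
          * (f₀ P₀ π₀ z.1 z.2.1 α - f z.1 z.2.1 α) ∂obsLaw P₀ π₀ := by
  set η := overlap π₀
  set c : S → A → ℝ := fun s a => p.prob s a * (1 / q s a - 1 / π₀.prob s a) with hc
  have hπ : ∀ s a, 0 < π₀.prob s a := fun s a => hη.trans_le (overlap_le_prob π₀ s a)
  have hcm : ∀ a, Measurable fun s => c s a := by
    intro a
    have h1 := p.measurable_prob a
    have h2 := hqm a
    have h3 := π₀.measurable_prob a
    simp only [hc]
    fun_prop
  have hC : ∀ s a, |c s a| ≤ 1 / η := by
    intro s a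
    have h1 : 1 / q s a ≤ 1 / η := one_div_le_one_div_of_le hη (hq s a).1
    have h2 : 1 / π₀.prob s a ≤ 1 / η := one_div_le_one_div_of_le hη (overlap_le_prob π₀ s a)
    have h3 : 0 < 1 / q s a := one_div_pos.mpr (hη.trans_le (hq s a).1)
    have h4 : 0 < 1 / π₀.prob s a := one_div_pos.mpr (hπ s a)
    simp only [hc]
    rw [abs_mul, abs_of_nonneg (p.prob_nonneg s a)]
    calc p.prob s a * |1 / q s a - 1 / π₀.prob s a| ≤ 1 * (1 / η) := by
          refine mul_le_mul (p.prob_le_one s a) ?_ (abs_nonneg _) zero_le_one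
          rw [abs_le]; constructor <;> linarith
      _ = 1 / η := one_mul _
  have hfabs : ∀ s a, |f s a α| ≤ 1 := fun s a => by
    rw [abs_of_pos (hf s a).1]; exact (hf s a).2
  have heabs : ∀ r s a, |expLoss r α - f s a α| ≤ 1 := fun r s a => by
    have h1 := expLoss_nonneg r α
    have h2 := expLoss_le_one r hα
    have h3 := (hf s a).1
    have h4 := (hf s a).2
    rw [abs_le]; constructor <;> linarith
  have hη0 : 0 ≤ 1 / η := by positivity
  have hcz : Measurable fun z : Obs S A => c z.1 z.2.1 := measurable_obs_of_section hcm
  have hfz : Measurable fun z : Obs S A => f z.1 z.2.1 α :=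
    measurable_obs_of_section (h := fun s a => f s a α) hfm
  have hez : Measurable fun z : Obs S A => expLoss z.2.2 α :=
    (measurable_expLoss α).comp (measurable_snd.comp measurable_snd)
  have hkm : Measurable fun z : Obs S A => c z.1 z.2.1 * (expLoss z.2.2 α - f z.1 z.2.1 α) :=
    hcz.mul (hez.sub hfz)
  have hkb : ∀ z : Obs S A, |c z.1 z.2.1 * (expLoss z.2.2 α - f z.1 z.2.1 α)| ≤ 1 / η := by
    intro z
    rw [abs_mul]
    calc _ ≤ 1 / η * 1 := mul_le_mul (hC _ _) (heabs _ _ _) (abs_nonneg _) hη0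
      _ = 1 / η := mul_one _
  have hRm : ∀ a, Measurable fun x : S × (A → ℝ) => expLoss (x.2 a) α := fun a =>
    (measurable_expLoss α).comp ((measurable_pi_apply a).comp measurable_snd)
  have hI1 : Integrable (fun x : S × (A → ℝ) => ∑ a, p.prob x.1 a * expLoss (x.2 a) α) P₀ := by
    refine Integrable.of_bound (Finset.measurable_sum _ fun a _ =>
      ((p.measurable_prob a).comp measurable_fst).mul (hRm a)).aestronglyMeasurable 1
      (ae_of_all _ fun x => ?_)
    rw [Real.norm_eq_abs, abs_of_nonneg (Finset.sum_nonneg fun a _ =>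
      mul_nonneg (p.prob_nonneg _ _) (expLoss_nonneg _ _))]
    exact p.sum_prob_mul_le x.1 fun a => expLoss_le_one _ hα
  have hI2 : Integrable (fun x : S × (A → ℝ) => ∑ a, π₀.prob x.1 a *
      (c x.1 a * (expLoss (x.2 a) α - f x.1 a α))) P₀ := by
    refine Integrable.of_bound (Finset.measurable_sum _ fun a _ =>
      ((π₀.measurable_prob a).comp measurable_fst).mul (((hcm a).comp measurable_fst).mul
        ((hRm a).sub ((hfm a).comp measurable_fst)))).aestronglyMeasurable (1 / η)
      (ae_of_all _ fun x => ?_)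
    refine (Finset.abs_sum_le_sum_abs _ _).trans ?_
    simp_rw [abs_mul (π₀.prob _ _), abs_of_nonneg (π₀.prob_nonneg _ _)]
    exact π₀.sum_prob_mul_le x.1 fun a => hkb (x.1, a, x.2 a)
  have h1 : ∫ z, drScore q f p α z ∂obsLaw P₀ π₀ - W P₀ p α
      = ∫ z, c z.1 z.2.1 * (expLoss z.2.2 α - f z.1 z.2.1 α) ∂obsLaw P₀ π₀ := by
    rw [integral_obsLaw π₀ (measurable_drScore hqm hfm p) (abs_drScore_le hη hq hα hf p),
      integral_obsLaw π₀ hkm hkb, W_eq_integral_sum hR]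
    simp_rw [sum_prob_mul_drScore hπ]
    rw [integral_add hI1 hI2]
    ring
  have hceI : Integrable (fun z : Obs S A => c z.1 z.2.1 * expLoss z.2.2 α) (obsLaw P₀ π₀) := by
    refine Integrable.of_bound (hcz.mul hez).aestronglyMeasurable (1 / η)
      (ae_of_all _ fun z => ?_)
    rw [norm_mul, Real.norm_eq_abs, Real.norm_eq_abs, abs_of_nonneg (expLoss_nonneg _ _)]
    exact (mul_le_of_le_one_right (abs_nonneg _) (expLoss_le_one _ hα)).trans (hC _ _)
  have hcfI : Integrable (fun z : Obs S A => c z.1 z.2.1 * f z.1 z.2.1 α) (obsLaw P₀ π₀) := by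
    refine Integrable.of_bound (hcz.mul hfz).aestronglyMeasurable (1 / η)
      (ae_of_all _ fun z => ?_)
    rw [norm_mul, Real.norm_eq_abs, Real.norm_eq_abs]
    exact (mul_le_of_le_one_right (abs_nonneg _) (hfabs _ _)).trans (hC _ _)
  have hcf₀I : Integrable (fun z : Obs S A => c z.1 z.2.1 * f₀ P₀ π₀ z.1 z.2.1 α)
      (obsLaw P₀ π₀) := by
    refine Integrable.of_bound (hcz.stronglyMeasurable.mul
      (stronglyMeasurable_f₀ π₀ α)).aestronglyMeasurable (1 / η) ?_
    filter_upwards [f₀_mem hR π₀] with z hz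
    have := hz α hα
    rw [norm_mul, Real.norm_eq_abs, Real.norm_eq_abs, abs_of_nonneg this.1]
    exact (mul_le_of_le_one_right (abs_nonneg _) this.2).trans (hC _ _)
  show _ = ∫ z, c z.1 z.2.1 * (f₀ P₀ π₀ z.1 z.2.1 α - f z.1 z.2.1 α) ∂obsLaw P₀ π₀
  rw [h1]
  simp_rw [mul_sub]
  rw [integral_sub hceI hcfI, integral_sub hcf₀I hcfI, integral_mul_expLoss_eq hR π₀ hcm hC hα]

/-- The doubly robust score is biased by at most the product of the two nuisance errors. -/
theorem abs_integral_drScore_sub_W_le (hR : ∀ᵐ x ∂P₀, ∀ a, x.2 a ∈ Set.Icc (0 : ℝ) 1)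
    {π₀ : Policy S A} (hη : 0 < overlap π₀) {q : S → A → ℝ} {f : S → A → ℝ → ℝ}
    (hqm : ∀ a, Measurable fun s => q s a) (hq : ∀ s a, q s a ∈ Set.Icc (overlap π₀) 1) {α : ℝ}
    (hα : 0 < α) (hfm : ∀ a, Measurable fun s => f s a α)
    (hf : ∀ s a, f s a α ∈ Set.Ioc (0 : ℝ) 1) (p : Policy S A) {r₁ r₂ : ℝ≥0}
    (h₁ : eLpNorm (fun z : Obs S A => q z.1 z.2.1 - π₀.prob z.1 z.2.1) 2 (obsLaw P₀ π₀) ≤ r₁)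
    (h₂ : eLpNorm (fun z : Obs S A => f z.1 z.2.1 α - f₀ P₀ π₀ z.1 z.2.1 α) 2 (obsLaw P₀ π₀)
      ≤ r₂) :
    |∫ z, drScore q f p α z ∂obsLaw P₀ π₀ - W P₀ p α| ≤ r₁ * r₂ / overlap π₀ ^ 2 := by
  rw [integral_drScore_sub_W hR hη hqm hq hα hfm hf p]
  set η := overlap π₀
  set c : ℝ≥0 := (1 / η ^ 2).toNNReal
  have hc : (c : ℝ) = 1 / η ^ 2 := Real.coe_toNNReal _ (by positivity)
  set b : ℝ → ℝ → ℝ := fun x y => 1 / η ^ 2 * (x * y) with hb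
  have hqz : Measurable fun z : Obs S A => q z.1 z.2.1 := measurable_obs_of_section hqm
  have hπz : Measurable fun z : Obs S A => π₀.prob z.1 z.2.1 :=
    measurable_obs_of_section π₀.measurable_prob
  have hfz : Measurable fun z : Obs S A => f z.1 z.2.1 α :=
    measurable_obs_of_section (h := fun s a => f s a α) hfm
  have hholder := eLpNorm_le_eLpNorm_mul_eLpNorm_of_nnnorm (p := 2) (q := 2) (r := 1)
    (hqz.sub hπz).aestronglyMeasurable
    (hfz.stronglyMeasurable.sub (stronglyMeasurable_f₀ (P₀ := P₀) π₀ α)).aestronglyMeasurable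
    (μ := obsLaw P₀ π₀) b c (ae_of_all _ fun z => by
      refine le_of_eq ?_
      ext
      simp only [hb, coe_nnnorm, NNReal.coe_mul, norm_mul, hc]
      rw [Real.norm_of_nonneg (by positivity : 0 ≤ 1 / η ^ 2)]
      rw [mul_assoc])
  have hmono : eLpNorm (fun z : Obs S A => p.prob z.1 z.2.1
        * (1 / q z.1 z.2.1 - 1 / π₀.prob z.1 z.2.1)
          * (f₀ P₀ π₀ z.1 z.2.1 α - f z.1 z.2.1 α)) 1 (obsLaw P₀ π₀)
      ≤ eLpNorm (fun z : Obs S A => b (q z.1 z.2.1 - π₀.prob z.1 z.2.1)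
          (f z.1 z.2.1 α - f₀ P₀ π₀ z.1 z.2.1 α)) 1 (obsLaw P₀ π₀) := by
    refine eLpNorm_mono fun z => ?_
    have hq0 := hη.trans_le (hq z.1 z.2.1).1
    have hπ1 := overlap_le_prob π₀ z.1 z.2.1
    have hπ0 := hη.trans_le hπ1
    simp only [hb, norm_mul, Real.norm_eq_abs]
    rw [abs_of_nonneg (p.prob_nonneg _ _), abs_of_nonneg (by positivity : 0 ≤ 1 / η ^ 2),
      abs_sub_comm (f₀ P₀ π₀ z.1 z.2.1 α), ← mul_assoc]
    refine mul_le_mul_of_nonneg_right ?_ (abs_nonneg _)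
    have h1 : 1 / q z.1 z.2.1 - 1 / π₀.prob z.1 z.2.1
        = -((q z.1 z.2.1 - π₀.prob z.1 z.2.1) / (q z.1 z.2.1 * π₀.prob z.1 z.2.1)) := by
      field_simp
      ring
    rw [h1, abs_neg, abs_div, abs_of_pos (mul_pos hq0 hπ0)]
    have h2 : η ^ 2 ≤ q z.1 z.2.1 * π₀.prob z.1 z.2.1 := by
      rw [sq]; exact mul_le_mul (hq _ _).1 hπ1 hη.le hq0.le
    calc p.prob z.1 z.2.1 * (|q z.1 z.2.1 - π₀.prob z.1 z.2.1|
          / (q z.1 z.2.1 * π₀.prob z.1 z.2.1))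
        ≤ 1 * (|q z.1 z.2.1 - π₀.prob z.1 z.2.1| / η ^ 2) := by
          have := p.prob_le_one z.1 z.2.1
          gcongr
      _ = _ := by ring
  have hfin : eLpNorm (fun z : Obs S A => p.prob z.1 z.2.1
        * (1 / q z.1 z.2.1 - 1 / π₀.prob z.1 z.2.1)
          * (f₀ P₀ π₀ z.1 z.2.1 α - f z.1 z.2.1 α)) 1 (obsLaw P₀ π₀)
      ≤ (c * r₁ * r₂ : ℝ≥0) := by
    refine hmono.trans (hholder.trans ?_)
    push_cast
    gcongr
    · exact h₁
    · exact h₂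
  rw [eLpNorm_one_eq_lintegral_enorm] at hfin
  have h3 := (enorm_integral_le_lintegral_enorm _).trans hfin
  have h4 := ENNReal.toReal_mono ENNReal.coe_ne_top h3
  rw [toReal_enorm, ENNReal.coe_toReal, Real.norm_eq_abs] at h4
  refine h4.trans (le_of_eq ?_)
  simp only [NNReal.coe_mul, hc]
  ring

end Bias

lemma abs_deviation_le_of_tendsto {I Z : Type*} [Fintype I] [MeasurableSpace Z] {P : Measure Z}
    [IsProbabilityMeasure P] {g : ℕ → Z → ℝ} {g' : Z → ℝ} {M T : ℝ} (hm : ∀ n, Measurable (g n))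
    (hM : ∀ n z, |g n z| ≤ M) (hg : ∀ z, Tendsto (fun n => g n z) atTop (𝓝 (g' z))) (z : I → Z)
    (hT : ∀ n, |∑ i, (g n (z i) - ∫ y, g n y ∂P)| ≤ T) :
    |∑ i, (g' (z i) - ∫ y, g' y ∂P)| ≤ T := by
  have hint : Tendsto (fun n => ∫ y, g n y ∂P) atTop (𝓝 (∫ y, g' y ∂P)) :=
    tendsto_integral_of_dominated_convergence (fun _ => M)
      (fun n => (hm n).aestronglyMeasurable) (integrable_const _)
      (fun n => ae_of_all _ fun y => hM n y) (ae_of_all _ hg)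
  have h : Tendsto (fun n => |∑ i, (g n (z i) - ∫ y, g n y ∂P)|) atTop
      (𝓝 |∑ i, (g' (z i) - ∫ y, g' y ∂P)|) :=
    (tendsto_finsetSum _ fun i _ => (hg (z i)).sub hint).abs
  exact le_of_tendsto h (Eventually.of_forall hT)

section Separability

variable {S A : Type*} [MeasurableSpace S] [MeasurableSpace A] [Fintype A]
  [MeasurableSingletonClass A]

/-- A deviation bound for the doubly robust scores along a countable dense family of policies and
dual variables extends to the whole class. -/
lemma abs_deviation_drScore_le {I : Type*} [Fintype I] {P : Measure (Obs S A)}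
    [IsProbabilityMeasure P] {q : S → A → ℝ} {f : S → A → ℝ → ℝ} {η lo hi : ℝ} (hη : 0 < η)
    (hlo : 0 < lo) (hqm : ∀ a, Measurable fun s => q s a) (hq : ∀ s a, q s a ∈ Set.Icc η 1)
    (hfm : ∀ a α, Measurable fun s => f s a α)
    (hf : ∀ s a, ∀ α ∈ Set.Icc lo hi, f s a α ∈ Set.Ioc (0 : ℝ) 1)
    (hLip : ∀ s a, ∀ α ∈ Set.Icc lo hi, ∀ α' ∈ Set.Icc lo hi,
      |f s a α - f s a α'| ≤ 1 / lo ^ 2 * |α - α'|) {Pol C : Set (Policy S A)}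
    (hC : ∀ p ∈ Pol, ∃ p' : ℕ → Policy S A,
      (∀ n, p' n ∈ C) ∧ ∀ s a, Tendsto (fun n => (p' n).prob s a) atTop (𝓝 (p.prob s a)))
    {d : ℕ → Set.Icc lo hi} (hd : DenseRange d) (z : I → Obs S A) {T : ℝ}
    (hT : ∀ p ∈ C, ∀ n, |∑ i, (drScore q f p (d n) (z i) - ∫ y, drScore q f p (d n) y ∂P)| ≤ T)
    {p : Policy S A} (hp : p ∈ Pol) {α : ℝ} (hα : α ∈ Set.Icc lo hi) :
    |∑ i, (drScore q f p α (z i) - ∫ y, drScore q f p α y ∂P)| ≤ T := by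
  have hreg := isRegularFamily_drScore hη hlo hq hf hLip
  have h1 : ∀ n, |∑ i, (drScore q f p (d n) (z i) - ∫ y, drScore q f p (d n) y ∂P)| ≤ T := by
    intro n
    obtain ⟨p', hp'C, hp'⟩ := hC p hp
    refine abs_deviation_le_of_tendsto (g := fun m => drScore q f (p' m) (d n))
      (fun m => measurable_drScore hqm (fun a => hfm a _) _)
      (fun m y => hreg.bound _ _ (d n).2 y) (fun y => ?_) z fun m => hT _ (hp'C m) n
    unfold drScore
    exact (((hp' _ _).div_const _).mul_const _).add
      (tendsto_finsetSum _ fun a _ => (hp' _ a).mul_const _)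
  obtain ⟨y, hyd, hy⟩ := mem_closure_iff_seq_limit.mp (hd ⟨α, hα⟩)
  refine abs_deviation_le_of_tendsto (g := fun m => drScore q f p (y m))
    (fun m => measurable_drScore hqm (fun a => hfm a _) _)
    (fun m w => hreg.bound _ _ (y m).2 w) (fun w => ?_) z fun m => ?_
  · have hy' : Tendsto (fun m => (y m : ℝ)) atTop (𝓝 α) :=
      (continuous_subtype_val.tendsto _).comp hy
    rw [tendsto_iff_dist_tendsto_zero]
    have h2 : Tendsto (fun m => 3 * (1 / η) * (1 / lo ^ 2) * |(y m : ℝ) - α|) atTop (𝓝 0) := by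
      have := ((hy'.sub_const α).abs).const_mul (3 * (1 / η) * (1 / lo ^ 2))
      simpa using this
    exact squeeze_zero (fun _ => dist_nonneg)
      (fun m => hreg.lipschitz p _ (y m).2 α hα w) h2
  · obtain ⟨n, hn⟩ := hyd m
    show |∑ i, (drScore q f p (y m) (z i) - ∫ w, drScore q f p (y m) w ∂P)| ≤ T
    rw [← hn]
    exact h1 n

end Separability

section Folds

variable {S A U : Type*} [MeasurableSpace S] [MeasurableSpace A] [Fintype A]
  [MeasurableSingletonClass A] [MeasurableSpace U] {N K : ℕ} {fold : Fin N → Fin K}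

/-- The doubly robust score of fold `k`, with the nuisances trained on the seed `u` and the
out-of-fold data `D`. -/
noncomputable def foldScore (πhat : PropensityLearner S A U fold)
    (fhat : RegressionLearner S A U fold) (k : Fin K) (u : U) (D : OutOfFold S A fold k)
    (p : Policy S A) (α : ℝ) : Obs S A → ℝ :=
  drScore (πhat.est k u D) (fhat.est k u D) p α

lemma measurable_foldScore (πhat : PropensityLearner S A U fold)
    (fhat : RegressionLearner S A U fold) (k : Fin K) (p : Policy S A) (α : ℝ) :
    Measurable fun x : (U × OutOfFold S A fold k) × Obs S A =>
      foldScore πhat fhat k x.1.1 x.1.2 p α x.2 := by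
  have hs : Measurable fun x : (U × OutOfFold S A fold k) × Obs S A =>
      ((x.1.1, x.1.2, x.2.1) : U × OutOfFold S A fold k × S) :=
    (measurable_fst.comp measurable_fst).prodMk
      ((measurable_snd.comp measurable_fst).prodMk (measurable_fst.comp measurable_snd))
  have ha : Measurable fun x : (U × OutOfFold S A fold k) × Obs S A => x.2.2.1 :=
    measurable_fst.comp (measurable_snd.comp measurable_snd)
  have hsec : ∀ h : U × OutOfFold S A fold k × S → A → ℝ, (∀ a, Measurable fun y => h y a) →
      Measurable fun x : (U × OutOfFold S A fold k) × Obs S A =>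
        h (x.1.1, x.1.2, x.2.1) x.2.2.1 := by
    intro h hh
    have h1 : Measurable fun y : (U × OutOfFold S A fold k × S) × A => h y.1 y.2 :=
      measurable_from_prod_countable_left hh
    exact h1.comp (hs.prodMk ha)
  unfold foldScore drScore
  refine Measurable.add (Measurable.mul (Measurable.div ?_ ?_) (Measurable.sub ?_ ?_)) ?_
  · exact (measurable_obs_of_section p.measurable_prob).comp measurable_snd
  · exact hsec (fun y a => πhat.est k y.1 y.2.1 y.2.2 a) fun a => πhat.measurable_est k a
  · exact (measurable_expLoss α).comp
      (measurable_snd.comp (measurable_snd.comp measurable_snd))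
  · exact hsec (fun y a => fhat.est k y.1 y.2.1 y.2.2 a α) fun a => fhat.measurable_est k a α
  · exact Finset.measurable_sum _ fun a _ =>
      ((p.measurable_prob a).comp (measurable_fst.comp measurable_snd)).mul
        ((fhat.measurable_est k a α).comp hs)

omit [Fintype A] [MeasurableSingletonClass A] in
lemma measurable_propensity_section (πhat : PropensityLearner S A U fold) (k : Fin K) (u : U)
    (D : OutOfFold S A fold k) (a : A) : Measurable fun s => πhat.est k u D s a :=
  (πhat.measurable_est k a).comp (measurable_const.prodMk (measurable_const.prodMk measurable_id))

omit [Fintype A] [MeasurableSingletonClass A] in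
lemma measurable_regression_section (fhat : RegressionLearner S A U fold) (k : Fin K) (u : U)
    (D : OutOfFold S A fold k) (a : A) (α : ℝ) : Measurable fun s => fhat.est k u D s a α :=
  (fhat.measurable_est k a α).comp
    (measurable_const.prodMk (measurable_const.prodMk measurable_id))

variable {P₀ : Env S A} [IsProbabilityMeasure P₀]

/-- Conditioning on the seed and on the out-of-fold data: an event about one fold that has small
probability for all nuisance values has small probability. -/
lemma dataLaw_le_of_forall_section (ρ : Measure U) [IsProbabilityMeasure ρ] (π₀ : Policy S A)
    (k : Fin K) {B : Set (U × (({i : Fin N // fold i = k} → Obs S A) × OutOfFold S A fold k))}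
    (hB : MeasurableSet B) {c : ℝ≥0∞}
    (hc : ∀ u D, Measure.pi (fun _ => obsLaw P₀ π₀) {d | (u, d, D) ∈ B} ≤ c) :
    dataLaw ρ P₀ π₀ N {x | (x.1, (fun i : {i : Fin N // fold i = k} => x.2 i),
      outOfFold fold k x.2) ∈ B} ≤ c := by
  have hmp := (MeasurePreserving.id ρ).prod
    (measurePreserving_piEquivPiSubtypeProd (fun _ : Fin N => obsLaw P₀ π₀)
      (fun i => fold i = k))
  have h1 := hmp.measure_preimage hB.nullMeasurableSet
  have h2 : dataLaw ρ P₀ π₀ N {x | (x.1, (fun i : {i : Fin N // fold i = k} => x.2 i),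
      outOfFold fold k x.2) ∈ B} = _ := h1
  rw [h2, Measure.prod_apply hB]
  calc _ ≤ ∫⁻ _u, c ∂ρ := by
        refine lintegral_mono fun u => ?_
        rw [Measure.prod_apply_symm (measurable_prodMk_left hB)]
        calc _ ≤ ∫⁻ _D, c ∂(Measure.pi fun _ : {i : Fin N // ¬ fold i = k} => obsLaw P₀ π₀) :=
              lintegral_mono fun D => hc u D
          _ = c := by simp
    _ = c := by simp

/-- Uniform deviation of the scores of one fold along a countable subclass. -/
theorem dataLaw_foldScore_deviation_le (ρ : Measure U) [IsProbabilityMeasure ρ] (π₀ : Policy S A)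
    (πhat : PropensityLearner S A U fold) (fhat : RegressionLearner S A U fold) {η lo hi : ℝ}
    (hη : 0 < η) (hlo : 0 < lo) (hlohi : lo ≤ hi)
    (hq : ∀ k u D s a, πhat.est k u D s a ∈ Set.Icc η 1)
    (hf : ∀ k u D s a, ∀ α ∈ Set.Icc lo hi, fhat.est k u D s a α ∈ Set.Ioc (0 : ℝ) 1)
    (hLip : ∀ k u D s a, ∀ α ∈ Set.Icc lo hi, ∀ α' ∈ Set.Icc lo hi,
      |fhat.est k u D s a α - fhat.est k u D s a α'| ≤ 1 / lo ^ 2 * |α - α'|)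
    {b : ℝ} (hb : 0 < b) (hb1 : b ≤ 1) {Pol : Set (Policy S A)} (hκ : entropyIntegral Pol ≠ ∞)
    {ι : Type*} [Countable ι] (p : ι → Policy S A) (α : ι → ℝ) (hp : ∀ j, p j ∈ Pol)
    (hα : ∀ j, α j ∈ Set.Icc lo hi) (k : Fin K) :
    dataLaw ρ P₀ π₀ N {x | ∃ j,
        1 / η * √(Fintype.card {i : Fin N // fold i = k}) * (128 * (entropyIntegral Pol).toReal
          + 50 * max (1 / lo ^ 2 * hi) 1 + 12 * √(Real.log (1 / b)))
        < |∑ i : {i : Fin N // fold i = k},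
          (foldScore πhat fhat k x.1 (outOfFold fold k x.2) (p j) (α j) (x.2 i)
            - ∫ y, foldScore πhat fhat k x.1 (outOfFold fold k x.2) (p j) (α j) y
              ∂obsLaw P₀ π₀)|} ≤ ENNReal.ofReal (4 * b) := by
  have hmeas : ∀ j, ∀ i : {i : Fin N // fold i = k}, Measurable
      fun y : U × (({i : Fin N // fold i = k} → Obs S A) × OutOfFold S A fold k) =>
        foldScore πhat fhat k y.1 y.2.2 (p j) (α j) (y.2.1 i)
          - ∫ w, foldScore πhat fhat k y.1 y.2.2 (p j) (α j) w ∂obsLaw P₀ π₀ := by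
    intro j i
    have hm := measurable_foldScore πhat fhat k (p j) (α j)
    have h1 : Measurable fun y : U × OutOfFold S A fold k =>
        ∫ w, foldScore πhat fhat k y.1 y.2 (p j) (α j) w ∂obsLaw P₀ π₀ :=
      hm.stronglyMeasurable.integral_prod_right'.measurable
    have h2 : Measurable fun y : U × (({i : Fin N // fold i = k} → Obs S A)
        × OutOfFold S A fold k) => (y.1, y.2.2) :=
      measurable_fst.prodMk (measurable_snd.comp measurable_snd)
    have h3 : Measurable fun y : U × (({i : Fin N // fold i = k} → Obs S A)
        × OutOfFold S A fold k) => y.2.1 i :=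
      (measurable_pi_apply i).comp (measurable_fst.comp measurable_snd)
    exact (hm.comp (h2.prodMk h3)).sub (h1.comp h2)
  have hdev : ∀ u D, Measure.pi (fun _ : {i : Fin N // fold i = k} => obsLaw P₀ π₀) {d | ∃ j,
        1 / η * √(Fintype.card {i : Fin N // fold i = k}) * (128 * (entropyIntegral Pol).toReal
          + 50 * max (1 / lo ^ 2 * hi) 1 + 12 * √(Real.log (1 / b)))
        < |∑ i, (foldScore πhat fhat k u D (p j) (α j) (d i)
            - ∫ y, foldScore πhat fhat k u D (p j) (α j) y ∂obsLaw P₀ π₀)|}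
      ≤ ENNReal.ofReal (4 * b) := by
    intro u D
    have hreg := isRegularFamily_drScore hη hlo (hq k u D) (hf k u D) (hLip k u D)
    have hD : 1 / lo ^ 2 * (hi - lo) ≤ max (1 / lo ^ 2 * hi) 1 := by
      refine le_trans ?_ (le_max_left _ _)
      gcongr
      linarith
    exact hreg.measure_deviation_le (by positivity) (by positivity) hlohi (le_max_right _ _) hD
      hb hb1 hκ (obsLaw P₀ π₀) p α hp hα fun j =>
        measurable_drScore (measurable_propensity_section πhat k u D)
          (fun a => measurable_regression_section fhat k u D a _) _
  generalize 1 / η * √(Fintype.card {i : Fin N // fold i = k})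
    * (128 * (entropyIntegral Pol).toReal + 50 * max (1 / lo ^ 2 * hi) 1
      + 12 * √(Real.log (1 / b))) = t at hdev ⊢
  have hB : MeasurableSet {y : U × (({i : Fin N // fold i = k} → Obs S A)
      × OutOfFold S A fold k) | ∃ j, t < |∑ i, (foldScore πhat fhat k y.1 y.2.2 (p j) (α j)
        (y.2.1 i) - ∫ w, foldScore πhat fhat k y.1 y.2.2 (p j) (α j) w ∂obsLaw P₀ π₀)|} := by
    simp only [Set.ofPred_exists]
    exact MeasurableSet.iUnion fun j => measurableSet_lt measurable_const
      (continuous_abs.measurable.comp (Finset.measurable_sum _ fun i _ => hmeas j i))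
  exact dataLaw_le_of_forall_section ρ π₀ k hB hdev

end Folds

lemma abs_log_sub_log_le {m Δ x y : ℝ} (hm : 0 < m) (hΔ : Δ ≤ m / 2) (hx : m ≤ x)
    (hxy : |y - x| ≤ Δ) : |Real.log y - Real.log x| ≤ 2 * Δ / m := by
  have hxy' := abs_le.mp hxy
  have hx0 : 0 < x := hm.trans_le hx
  have hym : m / 2 ≤ y := by linarith
  have hy0 : 0 < y := by linarith
  have h0 : 0 ≤ Δ := (abs_nonneg _).trans hxy
  have key : ∀ u v : ℝ, 0 < u → m / 2 ≤ v → u - v ≤ Δ →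
      Real.log u - Real.log v ≤ 2 * Δ / m := by
    intro u v hu hv huv
    have hv0 : 0 < v := by linarith
    rw [← Real.log_div hu.ne' hv0.ne']
    calc Real.log (u / v) ≤ u / v - 1 := Real.log_le_sub_one_of_pos (div_pos hu hv0)
      _ = (u - v) / v := by field_simp
      _ ≤ Δ / v := by gcongr
      _ ≤ Δ / (m / 2) := by gcongr
      _ = 2 * Δ / m := by field_simp
  rw [abs_le]
  exact ⟨by linarith [key x y hx0 hym (by linarith)], key y x hy0 (by linarith) (by linarith)⟩

section Regret

variable {S A : Type*} [MeasurableSpace S] [MeasurableSpace A] [Fintype A]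
  [MeasurableSingletonClass A] {P₀ : Env S A} [IsProbabilityMeasure P₀]

/-- The regret of a maximizer of a plug-in dual objective is controlled by the uniform error of the
estimated moment generating function. -/
theorem robustRegret_le_of_abs_sub_W_le (hR : ∀ᵐ x ∂P₀, ∀ a, x.2 a ∈ Set.Icc (0 : ℝ) 1) {δ : ℝ}
    (hδ : 0 < δ) {Pol : Set (Policy S A)} (hα : 0 < alphaLow P₀ δ Pol)
    {What : Policy S A → ℝ → ℝ} {m Δ : ℝ} (hm : 0 < m) (hΔ : Δ ≤ m / 2)
    (hmW : ∀ p ∈ Pol, ∀ α ∈ Set.Icc (alphaLow P₀ δ Pol) (alphaUp δ), m ≤ W P₀ p α)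
    (hdev : ∀ p ∈ Pol, ∀ α ∈ Set.Icc (alphaLow P₀ δ Pol) (alphaUp δ),
      |What p α - W P₀ p α| ≤ Δ) {p₁ : Policy S A} (hp₁ : p₁ ∈ Pol)
    (hmax : ∀ p ∈ Pol, sSup ((fun α => -α * Real.log (What p α) - α * δ) ''
        Set.Icc (alphaLow P₀ δ Pol) (alphaUp δ))
      ≤ sSup ((fun α => -α * Real.log (What p₁ α) - α * δ) ''
        Set.Icc (alphaLow P₀ δ Pol) (alphaUp δ))) :
    robustRegret P₀ δ Pol p₁ ≤ 4 * alphaUp δ / m * Δ := by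
  set lo := alphaLow P₀ δ Pol with hlo
  set hi := alphaUp δ with hhi
  set e := hi * (2 * Δ / m) with he
  have hclose : ∀ p ∈ Pol, ∀ α ∈ Set.Icc lo hi,
      |(-α * Real.log (What p α) - α * δ) - dualObj P₀ δ p α| ≤ e := by
    intro p hp α hαm
    have h1 := abs_log_sub_log_le hm hΔ (hmW p hp α hαm) (hdev p hp α hαm)
    have hα0 : 0 < α := hα.trans_le hαm.1
    have h2 : (-α * Real.log (What p α) - α * δ) - dualObj P₀ δ p α
        = -(α * (Real.log (What p α) - Real.log (W P₀ p α))) := by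
      unfold dualObj
      ring
    rw [h2, abs_neg, abs_mul, abs_of_pos hα0]
    exact mul_le_mul hαm.2 h1 (abs_nonneg _) (hα0.le.trans hαm.2)
  have hbdd : ∀ p ∈ Pol, ∀ α ∈ Set.Icc lo hi,
      -α * Real.log (What p α) - α * δ ≤ robustValue P₀ δ p + e := by
    intro p hp α hαm
    have h1 := dualObj_le_robustValue hR hδ.le p (hα.trans_le hαm.1)
    linarith [(abs_le.mp (hclose p hp α hαm)).2]
  have hmem : ∀ p ∈ Pol, alphaStar P₀ δ p ∈ Set.Icc lo hi := fun p hp =>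
    ⟨alphaLow_le_alphaStar P₀ δ hp,
      (alphaStar_isMax hR hδ p (hα.trans_le (alphaLow_le_alphaStar P₀ δ hp))).1⟩
  have hp₁le : sSup ((fun α => -α * Real.log (What p₁ α) - α * δ) '' Set.Icc lo hi)
      ≤ robustValue P₀ δ p₁ + e := by
    refine csSup_le ((Set.nonempty_of_mem (hmem p₁ hp₁)).image _) ?_
    rintro _ ⟨α, hαm, rfl⟩
    exact hbdd p₁ hp₁ α hαm
  have hsup : sSup (robustValue P₀ δ '' Pol) ≤ robustValue P₀ δ p₁ + 2 * e := by
    refine csSup_le ((Set.nonempty_of_mem hp₁).image _) ?_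
    rintro _ ⟨p, hp, rfl⟩
    have hpos := hα.trans_le (hmem p hp).1
    have h1 := robustValue_le_dualObj hR hδ.le p hpos (alphaStar_isMax hR hδ p hpos).2
    have h2 := (abs_le.mp (hclose p hp _ (hmem p hp))).1
    have h3 : -alphaStar P₀ δ p * Real.log (What p (alphaStar P₀ δ p)) - alphaStar P₀ δ p * δ
        ≤ sSup ((fun α => -α * Real.log (What p α) - α * δ) '' Set.Icc lo hi) := by
      refine le_csSup ⟨robustValue P₀ δ p + e, ?_⟩ (Set.mem_image_of_mem _ (hmem p hp))
      rintro _ ⟨α, hαm, rfl⟩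
      exact hbdd p hp α hαm
    linarith [hmax p hp]
  have : 4 * hi / m * Δ = 2 * e := by rw [he]; ring
  rw [this]
  unfold robustRegret
  linarith

end Regret

section CrossFitError

variable {S A U : Type*} [MeasurableSpace S] [MeasurableSpace A] [Fintype A]
  [MeasurableSingletonClass A] [MeasurableSpace U] {N K : ℕ} {fold : Fin N → Fin K}
  {P₀ : Env S A} [IsProbabilityMeasure P₀]

omit [MeasurableSpace S] [MeasurableSpace A] [Fintype A] [MeasurableSingletonClass A]
  [MeasurableSpace U] in
lemma sum_sqrt_card_fold_le (fold : Fin N → Fin K) :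
    ∑ k, √(Fintype.card {i : Fin N // fold i = k}) ≤ √K * √N := by
  have h1 : ∑ k, (Fintype.card {i : Fin N // fold i = k} : ℝ) = N := by
    have h := Fintype.sum_fiberwise fold (fun _ => (1 : ℝ))
    simpa using h
  rw [← Real.sqrt_mul (by positivity)]
  refine Real.le_sqrt_of_sq_le ?_
  have h2 := sq_sum_le_card_mul_sum_sq (s := (Finset.univ : Finset (Fin K)))
    (f := fun k => √(Fintype.card {i : Fin N // fold i = k} : ℝ))
  simpa [Real.sq_sqrt, h1] using h2

omit [MeasurableSingletonClass A] in
lemma Wdr_eq_sum_foldScore (πhat : PropensityLearner S A U fold)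
    (fhat : RegressionLearner S A U fold) {x : U × (Fin N → Obs S A)}
    (hx : ∀ i, (x.2 i).2.2 ∈ Set.Icc (0 : ℝ) 1) (p : Policy S A) (α : ℝ) :
    Wdr πhat fhat x p α = (1 / (N : ℝ)) * ∑ k, ∑ i : {i : Fin N // fold i = k},
      foldScore πhat fhat k x.1 (outOfFold fold k x.2) p α (x.2 i) := by
  have h : ∑ k, ∑ i : {i : Fin N // fold i = k},
      foldScore πhat fhat k x.1 (outOfFold fold k x.2) p α (x.2 i)
      = ∑ i : Fin N, foldScore πhat fhat (fold i) x.1 (outOfFold fold (fold i) x.2) p α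
          (x.2 i) := by
    rw [← Fintype.sum_fiberwise fold]
    refine Finset.sum_congr rfl fun k _ => Finset.sum_congr rfl fun i _ => ?_
    obtain ⟨i, rfl⟩ := i
    rfl
  rw [h]
  unfold Wdr
  congr 1
  refine Finset.sum_congr rfl fun i _ => ?_
  unfold foldScore drScore
  rw [expLoss_of_mem (hx i)]

/-- The estimation error of the cross-fitted moment generating function, given uniform deviation
bounds in each fold and bounds on the nuisance errors. -/
lemma abs_Wdr_sub_W_le (hR : ∀ᵐ x ∂P₀, ∀ a, x.2 a ∈ Set.Icc (0 : ℝ) 1) {π₀ : Policy S A}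
    (hη : 0 < overlap π₀) (hN : 1 ≤ N) {πhat : PropensityLearner S A U fold}
    {fhat : RegressionLearner S A U fold}
    (hq : ∀ k u D s a, πhat.est k u D s a ∈ Set.Icc (overlap π₀) 1) {α : ℝ} (hα : 0 < α)
    (hf : ∀ k u D s a, fhat.est k u D s a α ∈ Set.Ioc (0 : ℝ) 1)
    {x : U × (Fin N → Obs S A)} (hx : ∀ i, (x.2 i).2.2 ∈ Set.Icc (0 : ℝ) 1) {r₁ r₂ : ℝ≥0}
    (h₁ : ∀ k, eLpNorm (fun z : Obs S A =>
      πhat.est k x.1 (outOfFold fold k x.2) z.1 z.2.1 - π₀.prob z.1 z.2.1) 2 (obsLaw P₀ π₀) ≤ r₁)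
    (h₂ : ∀ k, eLpNorm (fun z : Obs S A =>
      fhat.est k x.1 (outOfFold fold k x.2) z.1 z.2.1 α - f₀ P₀ π₀ z.1 z.2.1 α) 2 (obsLaw P₀ π₀)
        ≤ r₂) {c : ℝ} (hc : 0 ≤ c) (p : Policy S A)
    (hdev : ∀ k, |∑ i : {i : Fin N // fold i = k},
      (foldScore πhat fhat k x.1 (outOfFold fold k x.2) p α (x.2 i)
        - ∫ y, foldScore πhat fhat k x.1 (outOfFold fold k x.2) p α y ∂obsLaw P₀ π₀)|
      ≤ 1 / overlap π₀ * √(Fintype.card {i : Fin N // fold i = k}) * c) :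
    |Wdr πhat fhat x p α - W P₀ p α|
      ≤ √K / (overlap π₀ * √N) * c + r₁ * r₂ / overlap π₀ ^ 2 := by
  have hN0 : (0 : ℝ) < N := by exact_mod_cast hN
  set R := (r₁ : ℝ) * r₂ / overlap π₀ ^ 2
  set F := fun k => foldScore πhat fhat k x.1 (outOfFold fold k x.2) p α
  have hbias : ∀ k, |∫ y, F k y ∂obsLaw P₀ π₀ - W P₀ p α| ≤ R := fun k =>
    abs_integral_drScore_sub_W_le hR hη (measurable_propensity_section πhat k _ _) (hq k _ _) hα
      (fun a => measurable_regression_section fhat k _ _ a α) (hf k _ _) p (h₁ k) (h₂ k)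
  have hcard : ∑ k, (Fintype.card {i : Fin N // fold i = k} : ℝ) = N := by
    have h := Fintype.sum_fiberwise fold (fun _ => (1 : ℝ))
    simpa using h
  have hfoldk : ∀ k, |∑ i : {i : Fin N // fold i = k}, F k (x.2 i)
      - (Fintype.card {i : Fin N // fold i = k} : ℝ) * W P₀ p α|
      ≤ 1 / overlap π₀ * √(Fintype.card {i : Fin N // fold i = k}) * c
        + (Fintype.card {i : Fin N // fold i = k} : ℝ) * R := by
    intro k
    have h3 : ∑ i : {i : Fin N // fold i = k}, F k (x.2 i)
        - (Fintype.card {i : Fin N // fold i = k} : ℝ) * W P₀ p α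
        = ∑ i : {i : Fin N // fold i = k}, (F k (x.2 i) - ∫ y, F k y ∂obsLaw P₀ π₀)
          + (Fintype.card {i : Fin N // fold i = k} : ℝ)
            * (∫ y, F k y ∂obsLaw P₀ π₀ - W P₀ p α) := by
      rw [Finset.sum_sub_distrib, Finset.sum_const, Finset.card_univ, nsmul_eq_mul]
      ring
    rw [h3]
    refine (abs_add_le _ _).trans (add_le_add (hdev k) ?_)
    rw [abs_mul, Nat.abs_cast]
    exact mul_le_mul_of_nonneg_left (hbias k) (Nat.cast_nonneg _)
  have hW : Wdr πhat fhat x p α - W P₀ p α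
      = (1 / (N : ℝ)) * ∑ k, (∑ i : {i : Fin N // fold i = k}, F k (x.2 i)
        - (Fintype.card {i : Fin N // fold i = k} : ℝ) * W P₀ p α) := by
    rw [Wdr_eq_sum_foldScore πhat fhat hx, Finset.sum_sub_distrib, ← Finset.sum_mul, hcard, mul_sub]
    congr 1
    field_simp
  have hsum : |∑ k, (∑ i : {i : Fin N // fold i = k}, F k (x.2 i)
        - (Fintype.card {i : Fin N // fold i = k} : ℝ) * W P₀ p α)|
      ≤ 1 / overlap π₀ * (√K * √N) * c + N * R := by
    refine (Finset.abs_sum_le_sum_abs _ _).trans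
      ((Finset.sum_le_sum fun k _ => hfoldk k).trans ?_)
    rw [Finset.sum_add_distrib, ← Finset.sum_mul, ← Finset.sum_mul, ← Finset.mul_sum, hcard]
    gcongr
    exact sum_sqrt_card_fold_le fold
  rw [hW, abs_mul, abs_of_pos (by positivity)]
  calc 1 / (N : ℝ) * _ ≤ 1 / (N : ℝ) * (1 / overlap π₀ * (√K * √N) * c + N * R) := by gcongr
    _ = √K / (overlap π₀ * √N) * c + R := by
      have hs : √(N : ℝ) * √N = N := Real.mul_self_sqrt hN0.le
      have hs0 : 0 < √(N : ℝ) := Real.sqrt_pos.mpr hN0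
      field_simp
      linear_combination √K * c * hs

lemma eLpNorm_regression_error_le {π₀ : Policy S A}
    (hR : ∀ᵐ x ∂P₀, ∀ a, x.2 a ∈ Set.Icc (0 : ℝ) 1) {f : S → A → ℝ → ℝ} {lo hi : ℝ} (hlo : 0 < lo)
    (hf : ∀ s a, ∀ α ∈ Set.Icc lo hi, f s a α ∈ Set.Ioc (0 : ℝ) 1) {α : ℝ}
    (hα : α ∈ Set.Icc lo hi) {r : ℝ≥0∞}
    (h : eLpNorm (fun z : Obs S A => ⨆ α : Set.Icc lo hi,
      |f z.1 z.2.1 α - f₀ P₀ π₀ z.1 z.2.1 α|) 2 (obsLaw P₀ π₀) ≤ r) :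
    eLpNorm (fun z : Obs S A => f z.1 z.2.1 α - f₀ P₀ π₀ z.1 z.2.1 α) 2 (obsLaw P₀ π₀) ≤ r := by
  refine le_trans (eLpNorm_mono_ae ?_) h
  filter_upwards [f₀_mem hR π₀] with z hz
  have hbdd : BddAbove (Set.range fun α : Set.Icc lo hi =>
      |f z.1 z.2.1 α - f₀ P₀ π₀ z.1 z.2.1 α|) := by
    refine ⟨1, ?_⟩
    rintro _ ⟨α', rfl⟩
    have h1 := hf z.1 z.2.1 α' α'.2
    have h2 := hz α' (hlo.trans_le α'.2.1)
    exact abs_le.mpr ⟨by linarith [h1.1, h2.2], by linarith [h1.2, h2.1]⟩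
  rw [Real.norm_eq_abs, Real.norm_eq_abs]
  exact (le_ciSup hbdd ⟨α, hα⟩).trans (le_abs_self _)

end CrossFitError

lemma SufficientlyLarge.error_le {N K : ℕ} {m η κ lo hi β r₁ r₂ : ℝ}
    (h : SufficientlyLarge N K m η κ lo hi β r₁ r₂) (hη : 0 < η) (hκ : 0 ≤ κ) (hr₁ : 0 ≤ r₁)
    (hr₂ : 0 ≤ r₂) :
    √K / (η * √N) * (128 * κ + 50 * max (1 / lo ^ 2 * hi) 1 + 12 * √(Real.log (K / β)))
      + r₁ * r₂ / η ^ 2 ≤ m / 2 := by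
  have h2 := h.2
  have hs : 0 ≤ √K / (η * √N) := by positivity
  have hr : 0 ≤ r₁ * r₂ / η ^ 2 := by positivity
  have hD : (0 : ℝ) ≤ max (1 / lo ^ 2 * hi) 1 := zero_le_one.trans (le_max_right _ _)
  have hg := Real.sqrt_nonneg (Real.log (K / β))
  rw [mul_div_assoc, mul_div_assoc] at h2
  nlinarith [mul_nonneg hs hκ, mul_nonneg hs hD, mul_nonneg hs hg]

lemma regret_bound_le {N K : ℕ} {m η κ lo hi β r₁ r₂ : ℝ} (hK : 1 ≤ K) (hβ₀ : 0 < β)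
    (hβ : β < 1 / 6) (hm : 0 < m) (hη : 0 < η) (hκ : 0 ≤ κ) (hhi : 0 < hi) :
    4 * hi / m * (√K / (η * √N) * (128 * κ + 50 * max (1 / lo ^ 2 * hi) 1
        + 12 * √(Real.log (K / β))) + r₁ * r₂ / η ^ 2)
      ≤ 2112 * hi * √K / (m * η * √N) * (κ + hi / lo ^ 2 + √(Real.log (K / β)))
        + 4 * hi / (m * η ^ 2) * (r₁ * r₂) := by
  have hK' : (1 : ℝ) ≤ K := by exact_mod_cast hK
  have hg : 1 ≤ √(Real.log (K / β)) := by
    rw [Real.one_le_sqrt, Real.le_log_iff_exp_le (by positivity), le_div_iff₀ hβ₀]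
    have := Real.exp_one_lt_d9
    nlinarith
  have hD : max (1 / lo ^ 2 * hi) 1 ≤ hi / lo ^ 2 + √(Real.log (K / β)) := by
    have h1 : 0 ≤ hi / lo ^ 2 := by positivity
    have h2 : 1 / lo ^ 2 * hi = hi / lo ^ 2 := by ring
    rw [h2]
    exact max_le (by linarith) (by linarith)
  have h3 : 0 ≤ hi / lo ^ 2 := by positivity
  calc 4 * hi / m * (√K / (η * √N) * (128 * κ + 50 * max (1 / lo ^ 2 * hi) 1
        + 12 * √(Real.log (K / β))) + r₁ * r₂ / η ^ 2)
      = hi / m * (√K / (η * √N)) * (4 * (128 * κ + 50 * max (1 / lo ^ 2 * hi) 1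
        + 12 * √(Real.log (K / β)))) + 4 * hi / m * (r₁ * r₂ / η ^ 2) := by ring
    _ ≤ hi / m * (√K / (η * √N)) * (2112 * (κ + hi / lo ^ 2 + √(Real.log (K / β))))
        + 4 * hi / m * (r₁ * r₂ / η ^ 2) := by
      refine add_le_add (mul_le_mul_of_nonneg_left ?_ (by positivity)) le_rfl
      linarith
    _ = _ := by
      simp only [div_eq_mul_inv, mul_inv]
      ring

lemma dataLaw_reward_mem {S A U : Type*} [MeasurableSpace S] [MeasurableSpace A]
    [Fintype A] [MeasurableSingletonClass A] [MeasurableSpace U] {P₀ : Env S A}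
    [IsProbabilityMeasure P₀] (hR : ∀ᵐ x ∂P₀, ∀ a, x.2 a ∈ Set.Icc (0 : ℝ) 1) (π₀ : Policy S A)
    (ρ : Measure U) [IsProbabilityMeasure ρ] (N : ℕ) :
    ∀ᵐ x ∂dataLaw ρ P₀ π₀ N, ∀ i, (x.2 i).2.2 ∈ Set.Icc (0 : ℝ) 1 := by
  rw [ae_all_iff]
  intro i
  have h1 : MeasurePreserving (fun x : U × (Fin N → Obs S A) => x.2 i) (dataLaw ρ P₀ π₀ N)
      (obsLaw P₀ π₀) :=
    (measurePreserving_eval (fun _ : Fin N => obsLaw P₀ π₀) i).comp measurePreserving_snd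
  exact h1.quasiMeasurePreserving.ae (obsLaw_reward_mem hR π₀)

end KLDRO

open KLDRO in
theorem theorem2
    {S A U : Type*} [MeasurableSpace S] [MeasurableSpace A] [Fintype A]
    [MeasurableSingletonClass A] [MeasurableSpace U]
    -- nominal environment, with rewards in `[0, 1]`, and behavior policy with strong overlap
    (P₀ : Env S A) [IsProbabilityMeasure P₀]
    (hR : ∀ᵐ x ∂P₀, ∀ a, x.2 a ∈ Set.Icc (0 : ℝ) 1)
    (π₀ : Policy S A) (hη : 0 < overlap π₀)
    (kind : RewardKind) (ω : ℝ) (hω : 0 < ω) (hreward : RewardLowerBound P₀ ω kind)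
    -- uncertainty radius and policy class, with dual optima bounded away from zero
    (δ : ℝ) (hδ : 0 < δ)
    (Pol : Set (Policy S A)) (hPol : PointwiseMeasurable Pol)
    (hα : 0 < alphaLow P₀ δ Pol)
    -- cross-fitting
    (N K : ℕ) (hN : 1 ≤ N) (fold : Fin N → Fin K) (hfold : EvenFolds fold)
    (ρ : Measure U) [IsProbabilityMeasure ρ]
    (πhat : PropensityLearner S A U fold) (fhat : RegressionLearner S A U fold)
    (hπhat : ∀ k u D s a, πhat.est k u D s a ∈ Set.Icc (overlap π₀) 1)
    (hfhat : ∀ k u D s a, ∀ α ∈ Set.Icc (alphaLow P₀ δ Pol) (alphaUp δ),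
      fhat.est k u D s a α ∈ Set.Ioc (0 : ℝ) 1)
    (hLip : ∀ k u D s a, ∀ α ∈ Set.Icc (alphaLow P₀ δ Pol) (alphaUp δ),
      ∀ α' ∈ Set.Icc (alphaLow P₀ δ Pol) (alphaUp δ),
        |fhat.est k u D s a α - fhat.est k u D s a α'|
          ≤ 1 / alphaLow P₀ δ Pol ^ 2 * |α - α'|)
    -- confidence and estimation rates
    (β : ℝ) (hβ₀ : 0 < β) (hβ : β < 1 / 6)
    (rateπ ratef : ℕ → ℝ → ℝ≥0)
    (hrateπ : IsPropensityRate ρ P₀ π₀ πhat (β / K) (rateπ N (β / K)))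
    (hratef : IsRegressionRate ρ P₀ π₀ fhat (alphaLow P₀ δ Pol) (alphaUp δ) (β / K)
      (ratef N (β / K)))
    -- the sample size is sufficiently large
    (hκ : entropyIntegral Pol ≠ ∞)
    (hlarge : SufficientlyLarge N K (Wlow ω (alphaLow P₀ δ Pol) kind) (overlap π₀)
      (entropyIntegral Pol).toReal (alphaLow P₀ δ Pol) (alphaUp δ) β
      (rateπ N (β / K)) (ratef N (β / K))) :
    -- with probability at least `1 - 6β`, every maximizer of the objective has small regret
    dataLaw ρ P₀ π₀ N {x | ¬ ∀ πDR ∈ Pol,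
        (∀ p ∈ Pol, Vdr πhat fhat δ (alphaLow P₀ δ Pol) (alphaUp δ) x p
          ≤ Vdr πhat fhat δ (alphaLow P₀ δ Pol) (alphaUp δ) x πDR) →
        robustRegret P₀ δ Pol πDR ≤
          2112 * alphaUp δ * √K / (Wlow ω (alphaLow P₀ δ Pol) kind * overlap π₀ * √N)
            * ((entropyIntegral Pol).toReal + alphaUp δ / alphaLow P₀ δ Pol ^ 2
              + √(Real.log (K / β)))
          + 4 * alphaUp δ / (Wlow ω (alphaLow P₀ δ Pol) kind * overlap π₀ ^ 2)
            * (rateπ N (β / K) * ratef N (β / K))}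
      ≤ ENNReal.ofReal (6 * β) := by

  set lo := alphaLow P₀ δ Pol with hlo
  set hi := alphaUp δ with hhi
  set κ := (entropyIntegral Pol).toReal with hκ'
  set r₁ := rateπ N (β / K)
  set r₂ := ratef N (β / K)
  have hK : 1 ≤ K := Fin.pos (fold ⟨0, hN⟩)
  have hK' : (1 : ℝ) ≤ K := by exact_mod_cast hK
  have hhi0 : 0 < hi := by
    rw [hhi, alphaUp]
    positivity
  have hm := Wlow_pos hω hα kind
  have hκ0 : 0 ≤ κ := ENNReal.toReal_nonneg
  by_cases hPol0 : Pol = ∅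
  · simp [hPol0]
  obtain ⟨p₀, hp₀⟩ := Set.nonempty_iff_ne_empty.mpr hPol0
  have hlohi : lo ≤ hi := (alphaLow_le_alphaStar P₀ δ hp₀).trans
    (alphaStar_isMax hR hδ p₀ (hα.trans_le (alphaLow_le_alphaStar P₀ δ hp₀))).1
  obtain ⟨C, hCPol, hCc, hC⟩ := hPol
  have := hCc.to_subtype
  have : Nonempty (Set.Icc lo hi) := ⟨⟨lo, le_rfl, hlohi⟩⟩
  have hb : 0 < β / K := by positivity
  have hb1 : β / K ≤ 1 := by
    rw [div_le_one (by positivity)]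
    linarith
  have hg : Real.log (1 / (β / K)) = Real.log (K / β) := by rw [one_div_div]
  set c := 128 * κ + 50 * max (1 / lo ^ 2 * hi) 1 + 12 * √(Real.log (K / β)) with hc
  have hc0 : 0 ≤ c := by
    have : (0 : ℝ) ≤ max (1 / lo ^ 2 * hi) 1 := zero_le_one.trans (le_max_right _ _)
    positivity
  have hdev : ∀ k, dataLaw ρ P₀ π₀ N {x | ∃ j : C × ℕ,
      1 / overlap π₀ * √(Fintype.card {i : Fin N // fold i = k}) * c
        < |∑ i : {i : Fin N // fold i = k},
          (foldScore πhat fhat k x.1 (outOfFold fold k x.2) j.1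
              (TopologicalSpace.denseSeq (Set.Icc lo hi) j.2) (x.2 i)
            - ∫ y, foldScore πhat fhat k x.1 (outOfFold fold k x.2) j.1
              (TopologicalSpace.denseSeq (Set.Icc lo hi) j.2) y ∂obsLaw P₀ π₀)|}
      ≤ ENNReal.ofReal (4 * (β / K)) := by
    intro k
    have h := dataLaw_foldScore_deviation_le (P₀ := P₀) ρ π₀ πhat fhat hη hα hlohi hπhat hfhat hLip
      hb hb1 hκ (ι := C × ℕ) (fun j => j.1)
      (fun j => TopologicalSpace.denseSeq (Set.Icc lo hi) j.2) (fun j => hCPol j.1.2)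
      (fun j => (TopologicalSpace.denseSeq (Set.Icc lo hi) j.2).2) k
    rw [hg] at h
    exact h
  have hreward0 : dataLaw ρ P₀ π₀ N {x | ¬ ∀ i, (x.2 i).2.2 ∈ Set.Icc (0 : ℝ) 1} = 0 :=
    ae_iff.mp (dataLaw_reward_mem hR π₀ ρ N)
  set E₀ := {x : U × (Fin N → Obs S A) | ¬ ∀ i, (x.2 i).2.2 ∈ Set.Icc (0 : ℝ) 1} with hE₀
  set E₁ := fun k => {x : U × (Fin N → Obs S A) | ∃ j : C × ℕ,
      1 / overlap π₀ * √(Fintype.card {i : Fin N // fold i = k}) * c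
        < |∑ i : {i : Fin N // fold i = k},
          (foldScore πhat fhat k x.1 (outOfFold fold k x.2) j.1
              (TopologicalSpace.denseSeq (Set.Icc lo hi) j.2) (x.2 i)
            - ∫ y, foldScore πhat fhat k x.1 (outOfFold fold k x.2) j.1
              (TopologicalSpace.denseSeq (Set.Icc lo hi) j.2) y ∂obsLaw P₀ π₀)|} with hE₁
  set E₂ := fun k => {x : U × (Fin N → Obs S A) | ¬ eLpNorm (fun z : Obs S A =>
      πhat.est k x.1 (outOfFold fold k x.2) z.1 z.2.1 - π₀.prob z.1 z.2.1) 2 (obsLaw P₀ π₀)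
        ≤ (r₁ : ℝ≥0∞)} with hE₂
  set E₃ := fun k => {x : U × (Fin N → Obs S A) | ¬ eLpNorm (fun z : Obs S A =>
      ⨆ α : Set.Icc lo hi, |fhat.est k x.1 (outOfFold fold k x.2) z.1 z.2.1 α
        - f₀ P₀ π₀ z.1 z.2.1 α|) 2 (obsLaw P₀ π₀) ≤ (r₂ : ℝ≥0∞)} with hE₃
  have hsub : {x : U × (Fin N → Obs S A) | ¬ ∀ πDR ∈ Pol,
        (∀ p ∈ Pol, Vdr πhat fhat δ lo hi x p ≤ Vdr πhat fhat δ lo hi x πDR) →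
        robustRegret P₀ δ Pol πDR ≤
          2112 * hi * √K / (Wlow ω lo kind * overlap π₀ * √N)
            * (κ + hi / lo ^ 2 + √(Real.log (K / β)))
          + 4 * hi / (Wlow ω lo kind * overlap π₀ ^ 2) * (r₁ * r₂)}
      ⊆ E₀ ∪ ⋃ k, (E₁ k ∪ E₂ k ∪ E₃ k) := by
    intro x hx
    by_contra hgood
    refine hx fun πDR hπ hmax => ?_
    simp only [Set.mem_union, Set.mem_iUnion, not_or, not_exists] at hgood
    obtain ⟨h0, h123⟩ := hgood
    have h0 : ∀ i, (x.2 i).2.2 ∈ Set.Icc (0 : ℝ) 1 := not_not.mp h0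
    have h1 : ∀ k, ∀ p ∈ C, ∀ n, |∑ i : {i : Fin N // fold i = k},
          (foldScore πhat fhat k x.1 (outOfFold fold k x.2) p
              (TopologicalSpace.denseSeq (Set.Icc lo hi) n) (x.2 i)
            - ∫ y, foldScore πhat fhat k x.1 (outOfFold fold k x.2) p
              (TopologicalSpace.denseSeq (Set.Icc lo hi) n) y ∂obsLaw P₀ π₀)|
        ≤ 1 / overlap π₀ * √(Fintype.card {i : Fin N // fold i = k}) * c :=
      fun k p hp n => not_lt.mp fun hlt => (h123 k).1.1 ⟨(⟨p, hp⟩, n), hlt⟩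
    have h2 := fun k => not_not.mp (h123 k).1.2
    have h3 := fun k => not_not.mp (h123 k).2
    have hW : ∀ p ∈ Pol, ∀ α ∈ Set.Icc lo hi, |Wdr πhat fhat x p α - W P₀ p α|
        ≤ √K / (overlap π₀ * √N) * c + r₁ * r₂ / overlap π₀ ^ 2 := by
      intro p hp α hαm
      exact abs_Wdr_sub_W_le hR hη hN hπhat (hα.trans_le hαm.1)
        (fun k u D s a => hfhat k u D s a α hαm) h0 h2
        (fun k => eLpNorm_regression_error_le hR hα (hfhat k _ _) hαm (h3 k)) hc0 p
        fun k => abs_deviation_drScore_le hη hα (measurable_propensity_section πhat k _ _)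
          (hπhat k _ _) (measurable_regression_section fhat k _ _) (hfhat k _ _) (hLip k _ _) hC
          (TopologicalSpace.denseRange_denseSeq _) (fun i : {i : Fin N // fold i = k} => x.2 i)
          (h1 k) hp hαm
    have hreg := robustRegret_le_of_abs_sub_W_le hR hδ hα hm
      (hlarge.error_le hη hκ0 r₁.2 r₂.2)
      (fun p _ α hαm => Wlow_le_W hR hω hreward hα hαm.1 p) hW hπ hmax
    exact hreg.trans (regret_bound_le hK hβ₀ hβ hm hη hκ0 hhi0)
  calc _ ≤ dataLaw ρ P₀ π₀ N (E₀ ∪ ⋃ k, (E₁ k ∪ E₂ k ∪ E₃ k)) := measure_mono hsub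
    _ ≤ 0 + ∑ k : Fin K, (ENNReal.ofReal (4 * (β / K)) + ENNReal.ofReal (β / K)
        + ENNReal.ofReal (β / K)) := by
      refine (measure_union_le _ _).trans (add_le_add hreward0.le ?_)
      refine (measure_iUnion_fintype_le _ _).trans (Finset.sum_le_sum fun k _ => ?_)
      refine (measure_union_le _ _).trans (add_le_add ?_ (hratef k))
      exact (measure_union_le _ _).trans (add_le_add (hdev k) (hrateπ k))
    _ = ENNReal.ofReal (6 * β) := by
      rw [← ENNReal.ofReal_add (by positivity) hb.le, ← ENNReal.ofReal_add (by positivity) hb.le,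
        Finset.sum_const, Finset.card_univ, Fintype.card_fin, nsmul_eq_mul, zero_add,
        ← ENNReal.ofReal_natCast K, ← ENNReal.ofReal_mul (by positivity)]
      congr 1
      field_simp
      ring
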